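/- **Theorem.** Let $K/\mathbb{Q}_2$ be a finite extension with ring of integers $\mathcal{O}$ and residue field $k$. Let $F(x)\in\mathcal{O}[x]$ be a monic cubic square-free polynomial, let $E/K$ be the elliptic curve $y^2=F(x)$, let $A_K=K[T]/(F(T))$, and let $A_{\mathcal{O}}$ be the ring of integers of $A_K$ (the integral closure of $\mathcal{O}$ in $A_K$). Suppose that $E$ satisfies (†) at least one of the following conditions holds: - (i) $A_K$ is a field; - (ii) $A_{\mathcal{O}}=\mathcal{O}[T]/(F(T))$; - (iii) $\operatorname{char}(k)>2$ and $[E(K):E_0(K)]$ is odd, where $E_0(K)$ is the subgroup of points with non-singular reduction (this never occurs here, since $\operatorname{char}(k)=2$); - (iv) $\operatorname{char}(k)=2$, $K/\mathbb{Q}_2$ is unramified and $E$ has good reduction. Let $\delta_K:E(K)\to A_K^\times/(A_K^\times)^2$ be the Kummer map: $\delta_K(O)=1$; $\delta_K(P)$ is the class of $x(P)-T$ if $P\neq O$ and $x(P)-T$ is invertible in $A_K$ (that is, $y(P)\ne 0$); and if $P=(c,0)$ with $F(T)=(T-c)G(T)$, then $\delta_K(P)$ is the class of $c-T+G(T)$,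 i.e. of $(F'(c),\,c-T)$ in $A_K\simeq K\times K[T]/(G(T))$. Let $\delta_K(E)$ be its image. Let $(A_{\mathcal{O}}^\times/(A_{\mathcal{O}}^\times)^2)_\square$ be the subgroup of classes in $A_{\mathcal{O}}^\times/(A_{\mathcal{O}}^\times)^2$ whose norm to $K$ is a square, identified with its image under the natural inclusion $A_{\mathcal{O}}^\times/(A_{\mathcal{O}}^\times)^2\hookrightarrow A_K^\times/(A_K^\times)^2$. Then $\delta_K(E)$ is a subgroup of $(A_{\mathcal{O}}^\times/(A_{\mathcal{O}}^\times)^2)_\square$ of index exactly $2^{[K:\mathbb{Q}_2]}$. Furthermore, $\delta_K(E)$ contains the class of every element of $$U_4=\{u\in A_{\mathcal{O}}^\times : u\equiv \beta^2 \pmod{4A_{\mathcal{O}}}\text{ for some }\beta\in A_{\mathcal{O}},\ \text{and } \mathrm{N}_{A_K/K}(u)\text{ is a square in }K\}.$$ -/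

import Mathlib

open Polynomial

noncomputable section

namespace KummerTwo

/-! ### The elliptic curve `y² = f(x)` and the cubic algebra `A_K = K[T]/(f(T))` -/

section Field

variable {K : Type*} [Field K]

/-- `f` is a monic cubic square-free polynomial. -/
structure IsMonicCubic (f : K[X]) : Prop where
  monic : f.Monic
  natDegree_eq : f.natDegree = 3
  squarefree : Squarefree f

/-- The Weierstrass curve `y² = x³ + a₂ x² + a₄ x + a₆`, for `f = x³ + a₂ x² + a₄ x + a₆`. -/
def cubicCurve (f : K[X]) : WeierstrassCurve K :=
  ⟨0, f.coeff 2, 0, f.coeff 1, f.coeff 0⟩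

/-- The group `E(K)` of `K`-rational points of `E : y² = f(x)`. -/
abbrev CurvePoint (f : K[X]) : Type _ := (cubicCurve f).toAffine.Point

/-- The group `B^× / (B^×)²` of a commutative ring `B`. -/
def UnitsModSquares (B : Type*) [CommRing B] : Type _ := Bˣ ⧸ Subgroup.square Bˣ

instance (B : Type*) [CommRing B] : CommGroup (UnitsModSquares B) :=
  inferInstanceAs (CommGroup (Bˣ ⧸ Subgroup.square Bˣ))

/-- The class of a unit modulo squares. -/
def sqClass {B : Type*} [CommRing B] : Bˣ →* UnitsModSquares B :=
  QuotientGroup.mk' (Subgroup.square Bˣ)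

/-- The map `B^× / (B^×)² → C^× / (C^×)²` induced by a ring homomorphism `B → C`. -/
def UnitsModSquares.map {B C : Type*} [CommRing B] [CommRing C] (φ : B →+* C) :
    UnitsModSquares B →* UnitsModSquares C :=
  QuotientGroup.map _ _ (Units.map (φ : B →* C)) fun _ hu => IsSquare.map (Units.map (φ : B →* C)) hu

/-- A polynomial over `K` whose value is `δ_K(P)`. For `P = O` it is `1`. For `P = (x, y)` it is
`x - T` if `y ≠ 0`, which is when `x - T` is invertible in `K[T]/(f(T))`. If `y = 0`, write
`f = (T - x) g`, so that `K[T]/(f(T)) = K × K[T]/(g(T))`; then the value is `x - T` in the second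
factor and `g(x) = f'(x)` in the first one, which makes the norm a square. This is the element
`x - T + g(T)`. -/
def kummerPoly (f : K[X]) : CurvePoint f → K[X]
  | .zero => 1
  | .some x y _ =>
    open scoped Classical in
    if y = 0 then C x - X + f /ₘ (X - C x) else C x - X

theorem cubic_eq {f : K[X]} (hf : IsMonicCubic f) :
    f = X ^ 3 + C (f.coeff 2) * X ^ 2 + C (f.coeff 1) * X + C (f.coeff 0) := by
  have h3 : f.coeff 3 = 1 := by
    have := hf.monic.coeff_natDegree
    rwa [hf.natDegree_eq] at this
  conv_lhs => rw [f.as_sum_range_C_mul_X_pow, hf.natDegree_eq]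
  simp only [Finset.sum_range_succ, Finset.sum_range_zero, h3, pow_zero, pow_one, map_one]
  ring

theorem eval_eq_sq {f : K[X]} (hf : IsMonicCubic f) {x y : K}
    (h : (cubicCurve f).toAffine.Nonsingular x y) : f.eval x = y ^ 2 := by
  have h1 := (WeierstrassCurve.Affine.equation_iff _ _).1 h.1
  simp only [cubicCurve] at h1
  conv_lhs => rw [cubic_eq hf]
  simp only [eval_add, eval_mul, eval_pow, eval_X, eval_C]
  linear_combination -h1

theorem isCoprime_kummerPoly {f : K[X]} (hf : IsMonicCubic f) (P : CurvePoint f) :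
    IsCoprime (kummerPoly f P) f := by
  match P with
  | .zero => exact isCoprime_one_left
  | .some x y h =>
    have hxy := eval_eq_sq hf h
    have key : ∀ g : K[X], g.eval x ≠ 0 → IsCoprime (X - C x) g := fun g hg =>
      (irreducible_X_sub_C x).coprime_iff_not_dvd.2 fun hd => hg (dvd_iff_isRoot.1 hd)
    simp only [kummerPoly]
    split_ifs with hy
    · have hroot : f.IsRoot x := by simp [IsRoot, hxy, hy]
      set g := f /ₘ (X - C x) with hg
      have hfg : (X - C x) * g = f := mul_divByMonic_eq_iff_isRoot.2 hroot
      have hgx : g.eval x ≠ 0 := by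
        intro h0
        obtain ⟨q, hq⟩ := dvd_iff_isRoot.2 (show g.IsRoot x from h0)
        have := hf.squarefree (X - C x) ⟨q, by rw [← hfg, hq]; ring⟩
        exact (irreducible_X_sub_C x).not_isUnit this
      have hc := key g hgx
      rw [← hfg]
      refine IsCoprime.mul_right ?_ ?_
      · have : C x - X + g = g + (X - C x) * (-1) := by ring
        rw [this]
        exact (IsCoprime.add_mul_left_left hc.symm _)
      · have : C x - X + g = -(X - C x) + g * 1 := by ring
        rw [this]
        exact IsCoprime.add_mul_left_left hc.neg_left _
    · have : C x - X = -(X - C x) := by ring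
      rw [this]
      exact (key f (by rw [hxy]; exact pow_ne_zero 2 hy)).neg_left

theorem isUnit_kummerPoly {f : K[X]} (hf : IsMonicCubic f) (P : CurvePoint f) :
    IsUnit (AdjoinRoot.mk f (kummerPoly f P)) := by
  obtain ⟨a, b, hab⟩ := isCoprime_kummerPoly hf P
  refine IsUnit.of_mul_eq_one (AdjoinRoot.mk f a) ?_
  have := congrArg (AdjoinRoot.mk f) hab
  rw [map_add, map_mul, map_mul, AdjoinRoot.mk_self, mul_zero, add_zero, map_one] at this
  rw [mul_comm, this]

/-- The Kummer map `δ_K : E(K) → A_K^× / (A_K^×)²`, with `A_K = K[T]/(f(T))`. -/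
def kummerMap {f : K[X]} (hf : IsMonicCubic f) (P : CurvePoint f) :
    UnitsModSquares (AdjoinRoot f) :=
  sqClass (isUnit_kummerPoly hf P).unit

end Field

/-! ### Integers, units with square norm, and the condition on `E` -/

section Integral

variable (O : Type*) [CommRing O] {K : Type*} [Field K] [Algebra O K]

/-- The ring of integers `A_O` of `A_K = K[T]/(f(T))`. -/
abbrev integersA (f : K[X]) : Subalgebra O (AdjoinRoot f) :=
  integralClosure O (AdjoinRoot f)

/-- The units of `A_O` whose norm to `K` is a square. -/
def squareNormUnits (f : K[X]) : Subgroup (integersA O f)ˣ :=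
  (Subgroup.square Kˣ).comap
    ((Units.map (Algebra.norm K : AdjoinRoot f →* K)).comp
      (Units.map ((integersA O f).val : integersA O f →* AdjoinRoot f)))

/-- The group `(A_O^× / (A_O^×)²)_□` of classes with square norm. -/
def squareNormClasses (f : K[X]) : Subgroup (UnitsModSquares (integersA O f)) :=
  (squareNormUnits O f).map sqClass

/-- The natural map `A_O^× / (A_O^×)² → A_K^× / (A_K^×)²`. -/
def inclusionA (f : K[X]) :
    UnitsModSquares (integersA O f) →* UnitsModSquares (AdjoinRoot f) :=
  UnitsModSquares.map (integersA O f).val.toRingHom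

theorem inclusionA_injective (f : K[X]) : Function.Injective (inclusionA O f) := by
  rw [injective_iff_map_eq_one]
  intro c hc
  obtain ⟨u, rfl⟩ := QuotientGroup.mk'_surjective _ c
  have h1 : Units.map ((integersA O f).val : integersA O f →* AdjoinRoot f) u
      ∈ Subgroup.square (AdjoinRoot f)ˣ := (QuotientGroup.eq_one_iff _).1 hc
  obtain ⟨v, hv⟩ := h1
  have int : ∀ (w : (AdjoinRoot f)ˣ) (t : integersA O f),
      (w : AdjoinRoot f) * w = t → IsIntegral O (w : AdjoinRoot f) := fun w t ht =>
    IsIntegral.of_pow (n := 2) two_pos (by rw [pow_two, ht]; exact t.2)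
  have e1 : (v : AdjoinRoot f) * v = ((u : integersA O f) : AdjoinRoot f) :=
    (congrArg Units.val hv).symm
  have e2 : ((v⁻¹ : (AdjoinRoot f)ˣ) : AdjoinRoot f) * (v⁻¹ : (AdjoinRoot f)ˣ)
      = ((u⁻¹ : (integersA O f)ˣ) : integersA O f) := by
    have := congrArg (fun w : (AdjoinRoot f)ˣ => ((w⁻¹ : (AdjoinRoot f)ˣ) : AdjoinRoot f)) hv
    simp only [mul_inv, ← map_inv] at this
    exact this.symm
  refine (QuotientGroup.eq_one_iff _).2 ⟨⟨⟨v, int v _ e1⟩, ⟨_, int v⁻¹ _ e2⟩, ?_, ?_⟩, ?_⟩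
  · exact Subtype.ext (by simp)
  · exact Subtype.ext (by simp)
  · exact Units.ext (Subtype.ext e1.symm)

/-- The set `U_4` of units of `A_O` which are congruent to a square modulo `4 A_O` and whose norm
is a square. -/
def unitsFour (f : K[X]) : Set (integersA O f)ˣ :=
  {u | (∃ b : integersA O f, (u : integersA O f) - b ^ 2 ∈ Ideal.span {(4 : integersA O f)}) ∧
    u ∈ squareNormUnits O f}

variable [IsDomain O] [IsDiscreteValuationRing O] [IsFractionRing O K]

open scoped Classical in
/-- The subgroup `E_0(K)` of the points whose reduction is non-singular, for a minimal Weierstrass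
equation `W` of `E`. A point `(x, y)` with `x` not integral reduces to the point at infinity.
The set below is a subgroup, hence equal to its closure. -/
def nonsingularReduction (W : WeierstrassCurve K) [W.IsMinimal O] :
    AddSubgroup W.toAffine.Point :=
  AddSubgroup.closure {P | ∀ (x y : K) (h : W.toAffine.Nonsingular x y), P = .some x y h →
    ∀ x₀ y₀ : O, algebraMap O K x₀ = x → algebraMap O K y₀ = y →
      (W.reduction O).toAffine.Nonsingular (IsLocalRing.residue O x₀) (IsLocalRing.residue O y₀)}

open scoped Classical in
/-- The condition (†) on `E : y² = F(x)` over the fraction field `K` of the ring of integers `O`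
of a finite extension of `ℚ_p`. -/
structure Dagger (p : ℕ) [Fact p.Prime] [Algebra ℤ_[p] O] (K : Type*) [Field K] [Algebra O K]
    [IsFractionRing O K] (F : O[X]) : Prop where
  isMonicCubic : IsMonicCubic (F.map (algebraMap O K))
  cond :
    -- `A_K` is a field
    IsField (AdjoinRoot (F.map (algebraMap O K))) ∨
    -- `A_O = O[T]/(F(T))`
    Algebra.adjoin O {AdjoinRoot.root (F.map (algebraMap O K))} =
      integersA O (F.map (algebraMap O K)) ∨
    -- `char k > 2` and `[E(K) : E_0(K)]` is odd
    (2 < ringChar (IsLocalRing.ResidueField O) ∧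
      ∃ (C : WeierstrassCurve.VariableChange K)
        (_ : (C • cubicCurve (F.map (algebraMap O K))).IsMinimal O),
        Odd (nonsingularReduction O (C • cubicCurve (F.map (algebraMap O K)))).index) ∨
    -- `char k = 2`, the extension `K/ℚ_2` is unramified, and `E` has good reduction
    (ringChar (IsLocalRing.ResidueField O) = 2 ∧ Algebra.Unramified ℤ_[p] O ∧
      ∃ C : WeierstrassCurve.VariableChange K,
        (C • cubicCurve (F.map (algebraMap O K))).HasGoodReduction O)

end Integral

/-! ### The ring of integers of a finite extension of `ℚ_p` -/

section LocalField

variable {p : ℕ} [Fact p.Prime] {K : Type*} [Field K] [Algebra ℚ_[p] K]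
  [FiniteDimensional ℚ_[p] K] [Algebra ℤ_[p] K] [IsScalarTower ℤ_[p] ℚ_[p] K]

instance isFractionRing_integers : IsFractionRing (integralClosure ℤ_[p] K) K :=
  integralClosure.isFractionRing_of_finite_extension ℚ_[p] K

theorem isIntegral_of_spectralNorm_le_one {x : K} (hx : spectralNorm ℚ_[p] K x ≤ 1) :
    IsIntegral ℤ_[p] x := by
  have hint : IsIntegral ℚ_[p] x := Algebra.IsIntegral.isIntegral x
  have hc := (spectralValue_le_one_iff (minpoly.monic hint)).1 hx
  have hl : minpoly ℚ_[p] x ∈ lifts (algebraMap ℤ_[p] ℚ_[p]) := by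
    rw [lifts_iff_coeff_lifts]
    exact fun n => ⟨⟨_, hc n⟩, rfl⟩
  obtain ⟨q, hq, -, hqm⟩ := lifts_and_natDegree_eq_and_monic hl (minpoly.monic hint)
  refine ⟨q, hqm, ?_⟩
  rw [IsScalarTower.algebraMap_eq ℤ_[p] ℚ_[p] K, ← eval₂_map, hq]
  exact minpoly.aeval ℚ_[p] x

instance isDiscreteValuationRing_integers :
    IsDiscreteValuationRing (integralClosure ℤ_[p] K) := by
  have hval : ValuationRing (integralClosure ℤ_[p] K) := by
    refine (ValuationRing.iff_isInteger_or_isInteger _ K).2 fun x => ?_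
    by_cases hx : spectralNorm ℚ_[p] K x ≤ 1
    · exact Or.inl ⟨⟨x, isIntegral_of_spectralNorm_le_one hx⟩, rfl⟩
    · have hx1 : 1 < spectralNorm ℚ_[p] K x := not_le.1 hx
      have hx0 : x ≠ 0 := by
        rintro rfl
        rw [spectralNorm_zero] at hx1
        exact absurd hx1 (by norm_num)
      have hm : spectralNorm ℚ_[p] K x * spectralNorm ℚ_[p] K x⁻¹ = 1 := by
        have := map_mul (spectralMulAlgNorm ℚ_[p] K) x x⁻¹
        rw [mul_inv_cancel₀ hx0] at this
        simp only [spectralMulAlgNorm_def, spectralNorm_one] at this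
        exact this.symm
      have hle : spectralNorm ℚ_[p] K x⁻¹ ≤ 1 := by
        have := spectralNorm_nonneg (K := ℚ_[p]) x⁻¹
        nlinarith
      exact Or.inr ⟨⟨x⁻¹, isIntegral_of_spectralNorm_le_one hle⟩, rfl⟩
  have : IsNoetherianRing (integralClosure ℤ_[p] K) :=
    IsIntegralClosure.isNoetherianRing ℤ_[p] ℚ_[p] K _
  have hnf : ¬ IsField (integralClosure ℤ_[p] K) := fun h =>
    IsDiscreteValuationRing.not_isField ℤ_[p]
      (isField_of_isIntegral_of_isField
        (fun a b hab => by
          have h1 := congrArg (algebraMap (integralClosure ℤ_[p] K) K) hab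
          rw [← IsScalarTower.algebraMap_apply, ← IsScalarTower.algebraMap_apply,
            IsScalarTower.algebraMap_apply ℤ_[p] ℚ_[p] K,
            IsScalarTower.algebraMap_apply ℤ_[p] ℚ_[p] K] at h1
          exact Subtype.ext ((algebraMap ℚ_[p] K).injective h1)) h)
  exact ((IsDiscreteValuationRing.TFAE (integralClosure ℤ_[p] K) hnf).out 0 1).2 hval

end LocalField

end KummerTwo

end

open Polynomial

set_option linter.unusedSectionVars false

noncomputable section

namespace KummerTwo

section Curve

variable {K : Type*} [Field K]

theorem IsMonicCubic.eval_eq {f : K[X]} (hf : IsMonicCubic f) (x : K) :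
    f.eval x = x ^ 3 + f.coeff 2 * x ^ 2 + f.coeff 1 * x + f.coeff 0 := by
  conv_lhs => rw [cubic_eq hf]
  simp

theorem IsMonicCubic.deriv_ne_zero {f : K[X]} (hf : IsMonicCubic f) {x : K}
    (hx : f.eval x = 0) : 3 * x ^ 2 + 2 * f.coeff 2 * x + f.coeff 1 ≠ 0 := by
  intro h
  rw [hf.eval_eq] at hx
  refine (irreducible_X_sub_C x).not_isUnit (hf.squarefree (X - C x)
    ⟨X + C (f.coeff 2 + 2 * x), ?_⟩)
  have h0 : f.coeff 0 = -(x ^ 3 + f.coeff 2 * x ^ 2 + f.coeff 1 * x) := by linear_combination hx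
  have h1 : f.coeff 1 = -(3 * x ^ 2 + 2 * f.coeff 2 * x) := by linear_combination h
  conv_lhs => rw [cubic_eq hf]
  rw [h0, h1]
  simp only [map_neg, map_add, map_mul, map_pow, map_ofNat]
  ring

/-- The line `y = l x + m` meets `y² = f(x)` in points with abscissas `x₁`, `x₂`, `x₃`. -/
structure IsLine (f : K[X]) (l m x₁ x₂ x₃ : K) : Prop where
  e1 : x₁ + x₂ + x₃ = l ^ 2 - f.coeff 2
  e2 : x₁ * x₂ + x₁ * x₃ + x₂ * x₃ = f.coeff 1 - 2 * l * m
  e3 : x₁ * x₂ * x₃ = m ^ 2 - f.coeff 0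

theorem IsLine.identity {f : K[X]} (hf : IsMonicCubic f) {l m x₁ x₂ x₃ : K}
    (h : IsLine f l m x₁ x₂ x₃) :
    f - (C l * X + C m) ^ 2 = (X - C x₁) * (X - C x₂) * (X - C x₃) := by
  have h2 : f.coeff 2 = l ^ 2 - (x₁ + x₂ + x₃) := by linear_combination h.e1
  have h1 : f.coeff 1 = x₁ * x₂ + x₁ * x₃ + x₂ * x₃ + 2 * l * m := by linear_combination -h.e2
  have h0 : f.coeff 0 = m ^ 2 - x₁ * x₂ * x₃ := by linear_combination h.e3
  conv_lhs => rw [cubic_eq hf, h2, h1, h0]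
  simp only [map_add, map_mul, map_pow, map_ofNat, map_sub]
  ring

variable [CharZero K]

theorem nonsingular_of_eval {f : K[X]} (hf : IsMonicCubic f) {x y : K}
    (h : f.eval x = y ^ 2) : (cubicCurve f).toAffine.Nonsingular x y := by
  rw [WeierstrassCurve.Affine.nonsingular_iff, WeierstrassCurve.Affine.equation_iff]
  have h' := h
  rw [hf.eval_eq] at h'
  refine ⟨by simp only [cubicCurve]; linear_combination -h', ?_⟩
  simp only [cubicCurve]
  by_cases hy : y = 0
  · left
    intro h0
    refine hf.deriv_ne_zero (x := x) (by rw [h, hy]; ring) ?_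
    linear_combination -h0
  · right
    intro h0
    exact hy (self_eq_neg.1 (by linear_combination h0))

theorem IsLine.of_eval {f : K[X]} {l m x₁ x₂ x₃ : K}
    (h : ∀ x, x ^ 3 + f.coeff 2 * x ^ 2 + f.coeff 1 * x + f.coeff 0 - (l * x + m) ^ 2 =
      (x - x₁) * (x - x₂) * (x - x₃)) : IsLine f l m x₁ x₂ x₃ := by
  have h0 := h 0
  have h1 := h 1
  have h2 := h (-1)
  have two : (2 : K) ≠ 0 := two_ne_zero
  have a : x₁ + x₂ + x₃ = l ^ 2 - f.coeff 2 := by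
    apply mul_left_cancel₀ two
    linear_combination h1 + h2 - 2 * h0
  refine ⟨a, ?_, by linear_combination h0⟩
  linear_combination h0 - h1 + a

open scoped Classical in
theorem exists_isLine {f : K[X]} {x₁ y₁ x₂ y₂ x₃ y₃ : K}
    {h₁ : (cubicCurve f).toAffine.Nonsingular x₁ y₁}
    {h₂ : (cubicCurve f).toAffine.Nonsingular x₂ y₂}
    {h₃ : (cubicCurve f).toAffine.Nonsingular x₃ y₃}
    (h : (.some x₁ y₁ h₁ + .some x₂ y₂ h₂ + .some x₃ y₃ h₃ : CurvePoint f) = 0) :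
    ∃ l m, IsLine f l m x₁ x₂ x₃ ∧ y₁ = l * x₁ + m ∧ y₂ = l * x₂ + m ∧ y₃ = l * x₃ + m := by
  have h' := eq_neg_of_add_eq_zero_left h
  rw [WeierstrassCurve.Affine.Point.neg_some] at h'
  have hxy : ¬(x₁ = x₂ ∧ y₁ = (cubicCurve f).toAffine.negY x₂ y₂) := by
    rintro ⟨hx, hy⟩
    rw [WeierstrassCurve.Affine.Point.add_of_Y_eq hx hy] at h'
    exact WeierstrassCurve.Affine.Point.some_ne_zero _ h'.symm
  rw [WeierstrassCurve.Affine.Point.add_some hxy] at h'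
  have hpoly := WeierstrassCurve.Affine.addPolynomial_slope h₁.1 h₂.1 hxy
  have h5 : y₂ = (cubicCurve f).toAffine.slope x₁ x₂ y₁ y₂ * x₂ +
      (y₁ - (cubicCurve f).toAffine.slope x₁ x₂ y₁ y₂ * x₁) := by
    by_cases hx : x₁ = x₂
    · have hy := WeierstrassCurve.Affine.Y_eq_of_Y_ne h₁.1 h₂.1 hx (fun hy => hxy ⟨hx, hy⟩)
      rw [hx, hy]; ring
    · rw [WeierstrassCurve.Affine.slope_of_X_ne hx]
      have := sub_ne_zero.2 hx
      field_simp
      ring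
  set l := (cubicCurve f).toAffine.slope x₁ x₂ y₁ y₂ with hl
  injection h' with hx3 hy3
  rw [hx3, WeierstrassCurve.Affine.addPolynomial_eq] at hpoly
  have hy3' : y₃ = l * x₃ + (y₁ - l * x₁) := by
    have := hy3
    rw [WeierstrassCurve.Affine.addY, WeierstrassCurve.Affine.negAddY, hx3, ← hl] at this
    simp only [WeierstrassCurve.Affine.negY, cubicCurve] at this
    linear_combination this
  refine ⟨l, y₁ - l * x₁, IsLine.of_eval fun x => ?_, by ring, h5, hy3'⟩
  have hev := congrArg (eval x) hpoly
  have he := (WeierstrassCurve.Affine.equation_iff _ _).1 h₁.1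
  simp only [Cubic.toPoly, cubicCurve, eval_neg, eval_add, eval_mul, eval_C, eval_pow, eval_X,
    eval_sub] at hev he
  linear_combination -hev

open scoped Classical in
theorem add_eq_zero_of_isLine {f : K[X]} (hf : IsMonicCubic f) {l m x₁ y₁ x₂ y₂ x₃ y₃ : K}
    {h₁ : (cubicCurve f).toAffine.Nonsingular x₁ y₁}
    {h₂ : (cubicCurve f).toAffine.Nonsingular x₂ y₂}
    {h₃ : (cubicCurve f).toAffine.Nonsingular x₃ y₃}
    (h : IsLine f l m x₁ x₂ x₃) (e₁ : y₁ = l * x₁ + m) (e₂ : y₂ = l * x₂ + m)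
    (e₃ : y₃ = l * x₃ + m) :
    (.some x₁ y₁ h₁ + .some x₂ y₂ h₂ + .some x₃ y₃ h₃ : CurvePoint f) = 0 := by
  have hval : ∀ x, x ^ 3 + f.coeff 2 * x ^ 2 + f.coeff 1 * x + f.coeff 0 - (l * x + m) ^ 2 =
      (x - x₁) * (x - x₂) * (x - x₃) := fun x => by
    linear_combination x ^ 2 * h.e1 - x * h.e2 + h.e3
  have hneg : ∀ x y, (cubicCurve f).toAffine.negY x y = -y := fun x y => by
    simp [WeierstrassCurve.Affine.negY, cubicCurve]
  have hxy : ¬(x₁ = x₂ ∧ y₁ = (cubicCurve f).toAffine.negY x₂ y₂) := by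
    rintro ⟨hx, hy⟩
    rw [hneg, e₂, ← hx, ← e₁] at hy
    have hy0 : y₁ = 0 := self_eq_neg.1 hy
    have hF := eval_eq_sq hf h₁
    refine hf.deriv_ne_zero (x := x₁) (by rw [hF, hy0]; ring) ?_
    have h0 : l * x₁ + m = 0 := by rw [← e₁, hy0]
    subst hx
    linear_combination x₁ * 2 * h.e1 - h.e2 + 2 * l * h0
  have hs : (cubicCurve f).toAffine.slope x₁ x₂ y₁ y₂ = l := by
    by_cases hx : x₁ = x₂
    · have hy : y₁ ≠ (cubicCurve f).toAffine.negY x₂ y₂ := fun hy => hxy ⟨hx, hy⟩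
      rw [WeierstrassCurve.Affine.slope_of_Y_ne hx hy, hneg]
      have hy0 : y₁ ≠ 0 := fun h0 => hy (by rw [hneg, e₂, ← hx, ← e₁, h0, neg_zero])
      have : y₁ - -y₁ ≠ 0 := by
        rw [sub_neg_eq_add, ← two_mul]; exact mul_ne_zero two_ne_zero hy0
      rw [div_eq_iff this]
      subst hx
      simp only [cubicCurve]
      rw [e₁]
      linear_combination x₁ * 2 * h.e1 - h.e2
    · rw [WeierstrassCurve.Affine.slope_of_X_ne hx, div_eq_iff (sub_ne_zero.2 hx), e₁, e₂]
      ring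
  rw [WeierstrassCurve.Affine.Point.add_some hxy, add_eq_zero_iff_eq_neg,
    WeierstrassCurve.Affine.Point.neg_some]
  have ex : (cubicCurve f).toAffine.addX x₁ x₂ l = x₃ := by
    simp only [WeierstrassCurve.Affine.addX, cubicCurve]
    linear_combination -h.e1
  congr 1
  · rw [hs, ex]
  · rw [hs, WeierstrassCurve.Affine.addY, WeierstrassCurve.Affine.negAddY, ex, hneg, hneg]
    rw [e₁, e₃]; ring

end Curve

section UnitsModSquares

variable {B : Type*} [CommRing B]

theorem sqClass_eq_one_iff {u : Bˣ} : sqClass u = 1 ↔ ∃ h : B, (u : B) = h ^ 2 := by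
  rw [show sqClass u = 1 ↔ u ∈ Subgroup.square Bˣ from QuotientGroup.eq_one_iff u]
  constructor
  · rintro ⟨v, rfl⟩
    exact ⟨v, by simp [pow_two]⟩
  · rintro ⟨h, hh⟩
    have hu : IsUnit h := (isUnit_pow_iff two_ne_zero).1 (hh ▸ u.isUnit)
    exact ⟨hu.unit, Units.ext (by simp [hh, pow_two])⟩

theorem sqClass_surjective : Function.Surjective (sqClass : Bˣ →* UnitsModSquares B) :=
  QuotientGroup.mk'_surjective _

theorem UnitsModSquares.mul_self (c : UnitsModSquares B) : c * c = 1 := by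
  obtain ⟨u, rfl⟩ := sqClass_surjective c
  rw [← map_mul, sqClass_eq_one_iff]
  exact ⟨u, by simp [pow_two]⟩

theorem UnitsModSquares.inv_eq (c : UnitsModSquares B) : c⁻¹ = c :=
  inv_eq_of_mul_eq_one_left c.mul_self

theorem sqClass_eq_iff {u v : Bˣ} : sqClass u = sqClass v ↔ ∃ h : B, (u : B) * v = h ^ 2 := by
  rw [← mul_inv_eq_one, UnitsModSquares.inv_eq, ← map_mul, sqClass_eq_one_iff, Units.val_mul]

theorem sqClass_eq_of_eq {u v h : Bˣ} (e : (u : B) = v * h ^ 2) : sqClass u = sqClass v :=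
  sqClass_eq_iff.2 ⟨v * h, by rw [e]; ring⟩

end UnitsModSquares

section Coordinates

variable {K : Type*} [Field K]

/-- The element `u + v T + w T²` of `K[T]/(f(T))`. -/
def coord (f : K[X]) (u v w : K) : AdjoinRoot f :=
  AdjoinRoot.mk f (C u + C v * X + C w * X ^ 2)

theorem coord_eq (f : K[X]) (u v w : K) : coord f u v w =
    algebraMap K _ u + algebraMap K _ v * AdjoinRoot.root f +
      algebraMap K _ w * AdjoinRoot.root f ^ 2 := by
  simp [coord, AdjoinRoot.algebraMap_eq]

theorem eq_zero_of_dvd {f : K[X]} (hf : IsMonicCubic f) {u v w : K}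
    (h : f ∣ C u + C v * X + C w * X ^ 2) : u = 0 ∧ v = 0 ∧ w = 0 := by
  have h0 : C u + C v * X + C w * X ^ 2 = 0 := by
    refine eq_zero_of_dvd_of_natDegree_lt h ?_
    rw [hf.natDegree_eq]
    have : (C u + C v * X + C w * X ^ 2).natDegree ≤ 2 := by compute_degree
    omega
  refine ⟨?_, ?_, ?_⟩
  · simpa [coeff_X, coeff_C] using congrArg (coeff · 0) h0
  · simpa [coeff_X, coeff_C] using congrArg (coeff · 1) h0
  · simpa [coeff_X, coeff_C] using congrArg (coeff · 2) h0

theorem coord_injective {f : K[X]} (hf : IsMonicCubic f) {u v w u' v' w' : K}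
    (h : coord f u v w = coord f u' v' w') : u = u' ∧ v = v' ∧ w = w' := by
  rw [coord, coord, AdjoinRoot.mk_eq_mk] at h
  have h' : f ∣ C (u - u') + C (v - v') * X + C (w - w') * X ^ 2 := by
    convert h using 1
    simp only [map_sub]; ring
  obtain ⟨h1, h2, h3⟩ := eq_zero_of_dvd hf h'
  exact ⟨sub_eq_zero.1 h1, sub_eq_zero.1 h2, sub_eq_zero.1 h3⟩

theorem exists_coord {f : K[X]} (hf : IsMonicCubic f) (a : AdjoinRoot f) :
    ∃ u v w, a = coord f u v w := by
  obtain ⟨p, rfl⟩ := AdjoinRoot.mk_surjective a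
  have hd : (p %ₘ f).natDegree < 3 := by
    rw [← hf.natDegree_eq]
    exact natDegree_modByMonic_lt p hf.monic fun h => by
      have := hf.natDegree_eq; rw [h] at this; simp at this
  refine ⟨(p %ₘ f).coeff 0, (p %ₘ f).coeff 1, (p %ₘ f).coeff 2, ?_⟩
  have h1 : p %ₘ f = C ((p %ₘ f).coeff 0) + C ((p %ₘ f).coeff 1) * X +
      C ((p %ₘ f).coeff 2) * X ^ 2 := by
    conv_lhs => rw [(p %ₘ f).as_sum_range_C_mul_X_pow' hd]
    simp [Finset.sum_range_succ]
  rw [coord, ← h1, AdjoinRoot.mk_eq_mk]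
  exact ⟨p /ₘ f, by linear_combination -(modByMonic_add_div p f)⟩

end Coordinates

section Hom

variable {K : Type*} [Field K]

theorem kummerPoly_of_ne {f : K[X]} {x y : K} {h : (cubicCurve f).toAffine.Nonsingular x y}
    (hy : y ≠ 0) : kummerPoly f (.some x y h) = C x - X := by
  simp [kummerPoly, hy]

theorem kummerPoly_of_eq {f : K[X]} {x y : K} {h : (cubicCurve f).toAffine.Nonsingular x y}
    (hy : y = 0) : kummerPoly f (.some x y h) = C x - X + f /ₘ (X - C x) := by
  simp [kummerPoly, hy]

theorem kummerMap_eq_iff {f : K[X]} (hf : IsMonicCubic f) (P : CurvePoint f)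
    (u : (AdjoinRoot f)ˣ) : kummerMap hf P = sqClass u ↔
      ∃ h, AdjoinRoot.mk f (kummerPoly f P) * u = h ^ 2 := by
  rw [kummerMap, sqClass_eq_iff, IsUnit.unit_spec]

theorem kummerMap_prod {f : K[X]} (hf : IsMonicCubic f) (P Q R : CurvePoint f)
    (h : ∃ q H, kummerPoly f P * kummerPoly f Q * kummerPoly f R - H ^ 2 = f * q) :
    kummerMap hf P * kummerMap hf Q * kummerMap hf R = 1 := by
  obtain ⟨q, H, h⟩ := h
  rw [kummerMap, kummerMap, kummerMap, ← map_mul, ← map_mul, sqClass_eq_one_iff]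
  refine ⟨AdjoinRoot.mk f H, ?_⟩
  simp only [Units.val_mul, IsUnit.unit_spec]
  rw [← map_mul, ← map_mul, ← map_pow, AdjoinRoot.mk_eq_mk]
  exact ⟨q, h⟩

theorem cofactor {f : K[X]} {x : K} (hx : f.eval x = 0) :
    (X - C x) * (f /ₘ (X - C x)) = f :=
  mul_divByMonic_eq_iff_isRoot.2 hx

theorem IsLine.prod_sub {f : K[X]} (hf : IsMonicCubic f) {l m x₁ x₂ x₃ : K}
    (h : IsLine f l m x₁ x₂ x₃) :
    (C x₁ - X) * (C x₂ - X) * (C x₃ - X) - (C l * X + C m) ^ 2 = f * (-1) := by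
  linear_combination h.identity hf

theorem IsLine.rotate {f : K[X]} {l m x₁ x₂ x₃ : K} (h : IsLine f l m x₁ x₂ x₃) :
    IsLine f l m x₂ x₃ x₁ :=
  ⟨by linear_combination h.e1, by linear_combination h.e2, by linear_combination h.e3⟩

theorem IsLine.prod_sub_one {f : K[X]} (hf : IsMonicCubic f) {l m x₁ x₂ x₃ : K}
    (h : IsLine f l m x₁ x₂ x₃) (h1 : l * x₁ + m = 0) :
    ∃ q H, (C x₁ - X + f /ₘ (X - C x₁)) * (C x₂ - X) * (C x₃ - X) - H ^ 2 = f * q := by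
  have hid := h.identity hf
  have hr : f.eval x₁ = 0 := by
    have := congrArg (eval x₁) hid
    simpa [h1] using this
  have hc := cofactor hr
  set G := f /ₘ (X - C x₁)
  have hm : C m = - (C l * C x₁) := by
    rw [← map_mul, ← map_neg]; congr 1; linear_combination h1
  have h2 : G - C l ^ 2 * (X - C x₁) = (X - C x₂) * (X - C x₃) := by
    refine mul_left_cancel₀ (X_sub_C_ne_zero x₁) ?_
    rw [hm] at hid
    linear_combination hid + hc
  refine ⟨-(1 + C l ^ 2) - 2 * C l, G + C l * (X - C x₁), ?_⟩
  linear_combination -(C x₁ - X + G) * h2 + (-(1 + C l ^ 2) - 2 * C l) * hc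

theorem IsLine.prod_sub_three {f : K[X]} (hf : IsMonicCubic f) {x₁ x₂ x₃ : K}
    (h : IsLine f 0 0 x₁ x₂ x₃) :
    ∃ q H, (C x₁ - X + f /ₘ (X - C x₁)) * (C x₂ - X + f /ₘ (X - C x₂)) *
      (C x₃ - X + f /ₘ (X - C x₃)) - H ^ 2 = f * q := by
  have hid := h.identity hf
  rw [map_zero, zero_mul, zero_add, zero_pow two_ne_zero, sub_zero] at hid
  have key : ∀ a b c : K, f = (X - C a) * (X - C b) * (X - C c) →
      f /ₘ (X - C a) = (X - C b) * (X - C c) := fun a b c e =>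
    mul_left_cancel₀ (X_sub_C_ne_zero a)
      ((cofactor (by rw [e]; simp)).trans (by rw [e]; ring))
  rw [key x₁ x₂ x₃ hid, key x₂ x₃ x₁ (by rw [hid]; ring), key x₃ x₁ x₂ (by rw [hid]; ring)]
  refine ⟨f - ((X - C x₁) ^ 2 + (X - C x₂) ^ 2 + (X - C x₃) ^ 2) - 1 -
    2 * ((X - C x₁) + (X - C x₂) + (X - C x₃)), (X - C x₂) * (X - C x₃) +
    (X - C x₃) * (X - C x₁) + (X - C x₁) * (X - C x₂), ?_⟩
  rw [hid]
  ring

theorem IsLine.eq_zero_of_two {f : K[X]} (hf : IsMonicCubic f) {l m x₁ x₂ x₃ : K}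
    (h : IsLine f l m x₁ x₂ x₃) (h1 : l * x₁ + m = 0) (h2 : l * x₂ + m = 0) :
    l = 0 ∧ m = 0 := by
  have hl : l = 0 := by
    by_contra hl
    have hx : x₁ = x₂ := mul_left_cancel₀ hl (by linear_combination h1 - h2)
    subst hx
    refine hf.deriv_ne_zero (x := x₁) ?_ ?_
    · simpa [h1] using congrArg (eval x₁) (h.identity hf)
    · linear_combination x₁ * 2 * h.e1 - h.e2 + 2 * l * h1
  exact ⟨hl, by simpa [hl] using h1⟩

open scoped Classical in
theorem kummerPoly_neg {f : K[X]} (P : CurvePoint f) :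
    kummerPoly f (-P) = kummerPoly f P := by
  match P with
  | .zero => rfl
  | .some x y h =>
    rw [WeierstrassCurve.Affine.Point.neg_some]
    simp [kummerPoly, WeierstrassCurve.Affine.negY, cubicCurve]

theorem kummerMap_neg {f : K[X]} (hf : IsMonicCubic f) (P : CurvePoint f) :
    kummerMap hf (-P) = kummerMap hf P := by
  unfold kummerMap
  congr 1
  exact Units.ext (by simp [kummerPoly_neg])

theorem kummerMap_zero {f : K[X]} (hf : IsMonicCubic f) :
    kummerMap hf (0 : CurvePoint f) = 1 := by
  rw [kummerMap, sqClass_eq_one_iff]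
  exact ⟨1, by simp [kummerPoly]⟩

variable [CharZero K]

open scoped Classical in
theorem kummerMap_mul_mul {f : K[X]} (hf : IsMonicCubic f) {P Q R : CurvePoint f}
    (h : P + Q + R = 0) : kummerMap hf P * kummerMap hf Q * kummerMap hf R = 1 := by
  by_cases hP : P = 0
  · rw [hP, zero_add] at h
    rw [hP, kummerMap_zero, one_mul, eq_neg_of_add_eq_zero_left h, kummerMap_neg,
      UnitsModSquares.mul_self]
  by_cases hQ : Q = 0
  · rw [hQ, add_zero] at h
    rw [hQ, kummerMap_zero, mul_one, eq_neg_of_add_eq_zero_left h, kummerMap_neg,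
      UnitsModSquares.mul_self]
  by_cases hR : R = 0
  · rw [hR, add_zero] at h
    rw [hR, kummerMap_zero, mul_one, eq_neg_of_add_eq_zero_left h, kummerMap_neg,
      UnitsModSquares.mul_self]
  match P, Q, R with
  | .zero, _, _ => exact absurd rfl hP
  | _, .zero, _ => exact absurd rfl hQ
  | _, _, .zero => exact absurd rfl hR
  | .some x₁ y₁ h₁, .some x₂ y₂ h₂, .some x₃ y₃ h₃ =>
    obtain ⟨l, m, hl, e₁, e₂, e₃⟩ := exists_isLine h
    apply kummerMap_prod
    have three : l = 0 ∧ m = 0 → ∃ q H, kummerPoly f (.some x₁ y₁ h₁) *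
        kummerPoly f (.some x₂ y₂ h₂) * kummerPoly f (.some x₃ y₃ h₃) - H ^ 2 = f * q := by
      rintro ⟨rfl, rfl⟩
      rw [kummerPoly_of_eq (by simp [e₁]), kummerPoly_of_eq (by simp [e₂]),
        kummerPoly_of_eq (by simp [e₃])]
      exact hl.prod_sub_three hf
    by_cases z₁ : y₁ = 0
    · by_cases z₂ : y₂ = 0
      · exact three (hl.eq_zero_of_two hf (e₁ ▸ z₁) (e₂ ▸ z₂))
      by_cases z₃ : y₃ = 0
      · exact three (hl.rotate.rotate.eq_zero_of_two hf (e₃ ▸ z₃) (e₁ ▸ z₁))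
      rw [kummerPoly_of_eq z₁, kummerPoly_of_ne z₂, kummerPoly_of_ne z₃]
      exact hl.prod_sub_one hf (e₁ ▸ z₁)
    by_cases z₂ : y₂ = 0
    · by_cases z₃ : y₃ = 0
      · exact three (hl.rotate.eq_zero_of_two hf (e₂ ▸ z₂) (e₃ ▸ z₃))
      rw [kummerPoly_of_ne z₁, kummerPoly_of_eq z₂, kummerPoly_of_ne z₃]
      obtain ⟨q, H, hH⟩ := hl.rotate.prod_sub_one hf (e₂ ▸ z₂)
      exact ⟨q, H, by rw [← hH]; ring⟩
    by_cases z₃ : y₃ = 0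
    · rw [kummerPoly_of_ne z₁, kummerPoly_of_ne z₂, kummerPoly_of_eq z₃]
      obtain ⟨q, H, hH⟩ := hl.rotate.rotate.prod_sub_one hf (e₃ ▸ z₃)
      exact ⟨q, H, by rw [← hH]; ring⟩
    rw [kummerPoly_of_ne z₁, kummerPoly_of_ne z₂, kummerPoly_of_ne z₃]
    exact ⟨_, _, hl.prod_sub hf⟩

open scoped Classical in
/-- The Kummer map as a homomorphism. -/
def kummerHom {f : K[X]} (hf : IsMonicCubic f) :
    CurvePoint f →+ Additive (UnitsModSquares (AdjoinRoot f)) where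
  toFun P := Additive.ofMul (kummerMap hf P)
  map_zero' := congrArg Additive.ofMul (kummerMap_zero hf)
  map_add' P Q := by
    rw [← ofMul_mul]
    congr 1
    have h := kummerMap_mul_mul hf (add_neg_cancel (P + Q))
    rwa [kummerMap_neg, ← UnitsModSquares.inv_eq (kummerMap hf (P + Q)), mul_inv_eq_one,
      eq_comm] at h

end Hom

section Halving

variable {K : Type*} [Field K]

theorem eval_cofactor_ne_zero {f : K[X]} (hf : IsMonicCubic f) {x : K} (hx : f.eval x = 0) :
    (f /ₘ (X - C x)).eval x ≠ 0 := by
  intro h0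
  obtain ⟨q, hq⟩ := dvd_iff_isRoot.2 (show (f /ₘ (X - C x)).IsRoot x from h0)
  exact (irreducible_X_sub_C x).not_isUnit
    (hf.squarefree (X - C x) ⟨q, by rw [← cofactor hx, hq]; ring⟩)

/-- The idempotent of `K[T]/(f(T))` which is `1` at the root `c` of `f` and `0` at the others. -/
def rootIdem (f : K[X]) (c : K) : AdjoinRoot f :=
  AdjoinRoot.mk f (C ((f /ₘ (X - C c)).eval c)⁻¹ * (f /ₘ (X - C c)))

theorem rootIdem_mul {f : K[X]} {c : K} (hc : f.eval c = 0) (p : K[X]) :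
    AdjoinRoot.mk f p * rootIdem f c = algebraMap K _ (p.eval c) * rootIdem f c := by
  rw [AdjoinRoot.algebraMap_eq, rootIdem, AdjoinRoot.of, RingHom.comp_apply, ← map_mul,
    ← map_mul, AdjoinRoot.mk_eq_mk]
  obtain ⟨q, hq⟩ := X_sub_C_dvd_sub_C_eval (a := c) (p := p)
  exact ⟨q * C ((f /ₘ (X - C c)).eval c)⁻¹, by
    linear_combination C ((f /ₘ (X - C c)).eval c)⁻¹ * (f /ₘ (X - C c)) * hq +
      q * C ((f /ₘ (X - C c)).eval c)⁻¹ * cofactor hc⟩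

theorem rootIdem_sq {f : K[X]} (hf : IsMonicCubic f) {c : K} (hc : f.eval c = 0) :
    rootIdem f c * rootIdem f c = rootIdem f c := by
  conv_lhs => arg 1; rw [rootIdem]
  rw [rootIdem_mul hc]
  simp [inv_mul_cancel₀ (eval_cofactor_ne_zero hf hc)]

variable [CharZero K]

open scoped Classical in
theorem exists_half {f : K[X]} (hf : IsMonicCubic f) {x₀ y₀ u v w : K}
    (h₀ : (cubicCurve f).toAffine.Nonsingular x₀ y₀)
    (h : coord f u v w ^ 2 = AdjoinRoot.mk f (C x₀ - X)) :
    w ≠ 0 ∧ ∃ (x y : K) (h₁ : (cubicCurve f).toAffine.Nonsingular x y),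
      x * w = v - f.coeff 2 * w ∧
      (.some x y h₁ + .some x y h₁ : CurvePoint f) = .some x₀ y₀ h₀ := by
  rw [coord, ← map_pow, AdjoinRoot.mk_eq_mk] at h
  have hw : w ≠ 0 := by
    rintro rfl
    have h' : f ∣ C (u ^ 2 - x₀) + C (2 * u * v + 1) * X + C (v ^ 2) * X ^ 2 := by
      convert h using 1
      simp only [map_sub, map_add, map_mul, map_pow, map_ofNat, map_one, map_zero]
      ring
    obtain ⟨-, h2, h3⟩ := eq_zero_of_dvd hf h'
    rw [pow_eq_zero_iff two_ne_zero] at h3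
    simp [h3] at h2
  refine ⟨hw, ?_⟩
  set b := f.coeff 2 * w - v with hb
  set β := u * w + v * b - w ^ 2 * f.coeff 1 with hβ
  set α := u * b - w ^ 2 * f.coeff 0 with hα
  obtain ⟨q, hq⟩ := h
  have hdvd : f ∣ C (x₀ * b ^ 2 - α ^ 2 + w ^ 2 * f.coeff 0) +
      C (2 * x₀ * w * b - b ^ 2 - 2 * α * β + w ^ 2 * f.coeff 1) * X +
      C (x₀ * w ^ 2 - 2 * w * b - β ^ 2 + w ^ 2 * f.coeff 2) * X ^ 2 := by
    have e1 : (C u + C v * X + C w * X ^ 2) * (C w * X + C b) - C (w ^ 2) * f =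
        C α + C β * X := by
      rw [hα, hβ]
      conv_lhs => rw [cubic_eq hf]
      rw [hb]
      simp only [map_sub, map_add, map_mul, map_pow]
      ring
    refine ⟨-(q * (C w * X + C b) ^ 2) + C (w ^ 2) + C (w ^ 2) *
      ((C u + C v * X + C w * X ^ 2) * (C w * X + C b) + (C α + C β * X)), ?_⟩
    have e2 := cubic_eq hf
    have hb' : C b = C (f.coeff 2) * C w - C v := by rw [hb]; simp
    have e3 : C (x₀ * b ^ 2 - α ^ 2 + w ^ 2 * f.coeff 0) +
      C (2 * x₀ * w * b - b ^ 2 - 2 * α * β + w ^ 2 * f.coeff 1) * X +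
      C (x₀ * w ^ 2 - 2 * w * b - β ^ 2 + w ^ 2 * f.coeff 2) * X ^ 2 =
      (C x₀ - X) * (C w * X + C b) ^ 2 - (C α + C β * X) ^ 2 + C w ^ 2 * f := by
      conv_rhs => rw [e2]
      simp only [map_sub, map_add, map_mul, map_pow, map_ofNat]
      ring
    rw [e3]
    rw [map_pow] at e1 ⊢
    linear_combination (-(C w * X + C b) ^ 2) * hq +
      ((C u + C v * X + C w * X ^ 2) * (C w * X + C b) + (C α + C β * X)) * e1
  obtain ⟨c0, c1, c2⟩ := eq_zero_of_dvd hf hdvd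
  have hl : IsLine f (β / w) (α / w) x₀ (-b / w) (-b / w) := by
    refine ⟨?_, ?_, ?_⟩
    · field_simp
      linear_combination c2
    · field_simp
      linear_combination -c1
    · field_simp
      linear_combination c0
  have hev : ∀ x, (x = x₀ ∨ x = -b / w) → f.eval x = (β / w * x + α / w) ^ 2 := by
    intro x hx
    have := congrArg (eval x) (hl.identity hf)
    simp only [eval_sub, eval_mul, eval_add, eval_pow, eval_C, eval_X] at this
    rcases hx with rfl | rfl <;> linear_combination this
  have n0 := nonsingular_of_eval hf (hev x₀ (Or.inl rfl))
  have n1 := nonsingular_of_eval hf (hev (-b / w) (Or.inr rfl))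
  have hsum := add_eq_zero_of_isLine hf (h₁ := n0) (h₂ := n1) (h₃ := n1) hl rfl rfl rfl
  have hx : -b / w * w = v - f.coeff 2 * w := by
    rw [div_mul_cancel₀ _ hw, hb]; ring
  have hy : y₀ = β / w * x₀ + α / w ∨ y₀ = -(β / w * x₀ + α / w) := by
    rw [← sq_eq_sq_iff_eq_or_eq_neg, ← eval_eq_sq hf h₀, hev x₀ (Or.inl rfl)]
  rw [add_assoc] at hsum
  rcases hy with hy | hy
  · have n1' : (cubicCurve f).toAffine.Nonsingular (-b / w)
        ((cubicCurve f).toAffine.negY (-b / w) (β / w * (-b / w) + α / w)) :=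
      (WeierstrassCurve.Affine.nonsingular_neg _ _).2 n1
    refine ⟨_, _, n1', hx, ?_⟩
    have h2 := eq_neg_of_add_eq_zero_left hsum
    rw [neg_add, WeierstrassCurve.Affine.Point.neg_some] at h2
    rw [← h2]
    congr 1
    exact hy.symm
  · refine ⟨_, _, n1, hx, ?_⟩
    rw [eq_neg_of_add_eq_zero_right hsum, WeierstrassCurve.Affine.Point.neg_some]
    congr 1
    rw [hy]
    simp [WeierstrassCurve.Affine.negY, cubicCurve]

open scoped Classical in
theorem kummerMap_eq_one_iff {f : K[X]} (hf : IsMonicCubic f) {P : CurvePoint f} :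
    kummerMap hf P = 1 ↔ ∃ Q : CurvePoint f, Q + Q = P := by
  constructor
  · intro h
    match P with
    | .zero => exact ⟨0, add_zero 0⟩
    | .some x y hxy =>
      rw [kummerMap, sqClass_eq_one_iff, IsUnit.unit_spec] at h
      obtain ⟨h, hh⟩ := h
      have : ∃ h' : AdjoinRoot f, h' ^ 2 = AdjoinRoot.mk f (C x - X) := by
        by_cases hy : y = 0
        · have hx : f.eval x = 0 := by rw [eval_eq_sq hf hxy, hy]; ring
          refine ⟨h * (1 - rootIdem f x), ?_⟩
          rw [kummerPoly_of_eq hy] at hh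
          have e1 : (1 - rootIdem f x) ^ 2 = 1 - rootIdem f x := by
            linear_combination rootIdem_sq hf hx
          have e2 := rootIdem_mul hx (C x - X)
          have e3 : AdjoinRoot.mk f (f /ₘ (X - C x)) * rootIdem f x =
              AdjoinRoot.mk f (f /ₘ (X - C x)) := by
            rw [rootIdem_mul hx, rootIdem, map_mul, ← mul_assoc, AdjoinRoot.algebraMap_eq,
              AdjoinRoot.mk_C, ← map_mul, mul_inv_cancel₀ (eval_cofactor_ne_zero hf hx),
              map_one, one_mul]
          rw [mul_pow, e1, ← hh, map_add]
          simp only [eval_sub, eval_C, eval_X, sub_self, map_zero, zero_mul] at e2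
          linear_combination -e2 - e3
        · exact ⟨h, by rw [← hh, kummerPoly_of_ne hy]⟩
      obtain ⟨h', hh'⟩ := this
      obtain ⟨u, v, w, rfl⟩ := exists_coord hf h'
      obtain ⟨-, x', y', h₁, -, e⟩ := exists_half hf hxy hh'
      exact ⟨_, e⟩
  · rintro ⟨Q, rfl⟩
    have := (kummerHom hf).map_add Q Q
    exact (Additive.ofMul.injective this).trans (UnitsModSquares.mul_self _)

end Halving

section Index

variable {G : Type*} [CommGroup G]

@[to_additive index_addRange_eq]
theorem index_range_eq (φ : G →* G) (N : Subgroup G) (hN : N.index ≠ 0) (hk : N ⊓ φ.ker = ⊥)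
    (hle : N.map φ ≤ N) : φ.range.index = (N.map φ).relIndex N * Nat.card φ.ker := by
  have h1 := N.index_map φ
  have h2 := Subgroup.relIndex_mul_index hle
  have h3 := Subgroup.relIndex_mul_index (le_sup_left : N ≤ N ⊔ φ.ker)
  have h4 : N.relIndex (N ⊔ φ.ker) = Nat.card φ.ker := by
    rw [sup_comm, Subgroup.relIndex_sup_right, ← Subgroup.inf_relIndex_right, hk,
      Subgroup.relIndex_bot_left]
  have h5 : (N ⊔ φ.ker).index ≠ 0 := fun h => hN (by rw [← h3, h, mul_zero])
  rw [h4] at h3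
  rw [← h2, ← h3] at h1
  refine Nat.eq_of_mul_eq_mul_left (Nat.pos_of_ne_zero h5) ?_
  rw [← h1]
  ring

@[to_additive relIndex_of_addHom]
theorem relIndex_of_hom {M : Type*} [Group M] {N N' : Subgroup G} (ψ : N →* M)
    (hψ : Function.Surjective ψ) (h : ∀ u : N, ψ u = 1 ↔ (u : G) ∈ N') :
    N'.relIndex N = Nat.card M := by
  have : N'.subgroupOf N = ψ.ker := by
    ext u
    rw [Subgroup.mem_subgroupOf, MonoidHom.mem_ker, h]
  rw [Subgroup.relIndex, this, Subgroup.index_ker, MonoidHom.range_eq_top.2 hψ,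
    Subgroup.card_top]

end Index

section TwoAdic

theorem two_pow_dvd_padicInt_iff {n : ℕ} {x : ℤ_[2]} :
    (2 : ℤ_[2]) ^ n ∣ x ↔ x ∈ IsLocalRing.maximalIdeal ℤ_[2] ^ n := by
  rw [PadicInt.maximalIdeal_eq_span_p, Ideal.span_singleton_pow, Ideal.mem_span_singleton]
  simp

variable {R : Type*} [CommRing R] [Algebra ℤ_[2] R] [Module.Finite ℤ_[2] R]
  [Module.Free ℤ_[2] R]

omit [Module.Finite ℤ_[2] R] [Module.Free ℤ_[2] R] in
theorem two_pow_dvd_iff {ι : Type*} [Fintype ι] (b : Module.Basis ι ℤ_[2] R) {n : ℕ} {x : R} :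
    (2 : R) ^ n ∣ x ↔ ∀ i, (2 : ℤ_[2]) ^ n ∣ b.equivFun x i := by
  have key : ∀ y : R, (2 : R) ^ n * y = (2 : ℤ_[2]) ^ n • y := fun y => by
    rw [Algebra.smul_def, map_pow, map_ofNat]
  constructor
  · rintro ⟨y, rfl⟩ i
    exact ⟨b.equivFun y i, by rw [key, map_smul]; rfl⟩
  · intro h
    choose y hy using h
    refine ⟨b.equivFun.symm y, b.equivFun.injective ?_⟩
    ext i
    rw [key, map_smul, LinearEquiv.apply_symm_apply, hy]
    rfl

variable (R) in
theorem exists_mod_two_hom : ∃ ρ : R →+ (Fin (Module.finrank ℤ_[2] R) → ZMod 2),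
    Function.Surjective ρ ∧ ∀ x, ρ x = 0 ↔ (2 : R) ∣ x := by
  let b := Module.finBasis ℤ_[2] R
  refine ⟨(RingHom.pi fun i => (PadicInt.toZMod (p := 2)).comp
    (Pi.evalRingHom (fun _ => ℤ_[2]) i)).toAddMonoidHom.comp b.equivFun.toAddMonoidHom, ?_, ?_⟩
  · intro y
    choose z hz using fun i => ZMod.ringHom_surjective (PadicInt.toZMod (p := 2)) (y i)
    refine ⟨b.equivFun.symm z, funext fun i => ?_⟩
    change PadicInt.toZMod (b.equivFun (b.equivFun.symm z) i) = y i
    rw [LinearEquiv.apply_symm_apply, hz]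
  · intro x
    have h2 : (∀ i, PadicInt.toZMod (b.equivFun x i) = 0) ↔ (2 : R) ∣ x := by
      rw [← pow_one (2 : R), two_pow_dvd_iff b]
      refine forall_congr' fun i => ?_
      rw [← RingHom.mem_ker, PadicInt.ker_toZMod, two_pow_dvd_padicInt_iff, pow_one]
    rw [← h2]
    exact ⟨fun h i => congrFun h i, fun h => funext h⟩

theorem exists_limit (s : ℕ → R) (hs : ∀ n, (2 : R) ^ n ∣ s (n + 1) - s n) :
    ∃ L, ∀ n, (2 : R) ^ n ∣ L - s n := by
  let b := Module.finBasis ℤ_[2] R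
  have h1 : ∀ i, ∃ L : ℤ_[2], ∀ n, (2 : ℤ_[2]) ^ n ∣ L - b.equivFun (s n) i := by
    intro i
    have hstep : ∀ n, (2 : ℤ_[2]) ^ n ∣ b.equivFun (s (n + 1)) i - b.equivFun (s n) i :=
      fun n => by simpa using (two_pow_dvd_iff b).1 (hs n) i
    have hmono : ∀ m k, (2 : ℤ_[2]) ^ m ∣ b.equivFun (s (m + k)) i - b.equivFun (s m) i := by
      intro m k
      induction k with
      | zero => simp
      | succ k ih =>
        have := dvd_add ((pow_dvd_pow 2 (Nat.le_add_right m k)).trans (hstep (m + k))) ih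
        rwa [sub_add_sub_cancel] at this
    obtain ⟨L, hL⟩ := IsPrecomplete.prec (I := IsLocalRing.maximalIdeal ℤ_[2]) (M := ℤ_[2])
      inferInstance (f := fun n => b.equivFun (s n) i) (fun {m n} hmn => by
        rw [SModEq.sub_mem, smul_eq_mul, Ideal.mul_top, ← two_pow_dvd_padicInt_iff]
        obtain ⟨k, rfl⟩ := Nat.exists_eq_add_of_le hmn
        exact (dvd_sub_comm).1 (hmono m k))
    refine ⟨L, fun n => ?_⟩
    have := hL n
    rw [SModEq.sub_mem, smul_eq_mul, Ideal.mul_top, ← two_pow_dvd_padicInt_iff] at this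
    exact dvd_sub_comm.1 this
  choose L hL using h1
  refine ⟨b.equivFun.symm L, fun n => (two_pow_dvd_iff b).2 fun i => ?_⟩
  rw [map_sub, Pi.sub_apply, LinearEquiv.apply_symm_apply]
  exact hL i n

theorem eq_zero_of_two_pow_dvd {x : R} (h : ∀ n, (2 : R) ^ n ∣ x) : x = 0 := by
  let b := Module.finBasis ℤ_[2] R
  refine b.equivFun.injective (funext fun i => ?_)
  rw [map_zero, Pi.zero_apply]
  refine IsHausdorff.haus (I := IsLocalRing.maximalIdeal ℤ_[2]) (M := ℤ_[2]) inferInstance _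
    fun n => ?_
  rw [SModEq.sub_mem, smul_eq_mul, Ideal.mul_top, ← two_pow_dvd_padicInt_iff, sub_zero]
  exact (two_pow_dvd_iff b).1 (h n) i

/-- A contraction `x ↦ c + 2 g(x)` has a fixed point. -/
theorem exists_fixed_point (c : R) (g : R[X]) : ∃ x, x = c + 2 * g.eval x := by
  let s : ℕ → R := fun n => Nat.rec 0 (fun _ x => c + 2 * g.eval x) n
  have hs : ∀ n, s (n + 1) = c + 2 * g.eval (s n) := fun n => rfl
  have hd : ∀ n, (2 : R) ^ n ∣ s (n + 1) - s n := by
    intro n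
    induction n with
    | zero => simp
    | succ n ih =>
      rw [hs (n + 1), hs n, add_sub_add_left_eq_sub, ← mul_sub, pow_succ']
      exact mul_dvd_mul_left _ (ih.trans (sub_dvd_eval_sub _ _ g))
  obtain ⟨L, hL⟩ := exists_limit s hd
  refine ⟨L, sub_eq_zero.1 (eq_zero_of_two_pow_dvd fun n => ?_)⟩
  have e : L - (c + 2 * g.eval L) = (L - s (n + 1)) - 2 * (g.eval L - g.eval (s n)) := by
    rw [hs]; ring
  rw [e]
  exact dvd_sub ((pow_dvd_pow 2 n.le_succ).trans (hL _))
    (((hL n).trans (sub_dvd_eval_sub _ _ g)).mul_left _)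

theorem isUnit_one_add_two_mul (x : R) : IsUnit (1 + 2 * x) := by
  obtain ⟨y, hy⟩ := exists_fixed_point (1 : R) (C (-x) * X)
  refine IsUnit.of_mul_eq_one y ?_
  simp only [eval_mul, eval_C, eval_X] at hy
  linear_combination hy

/-- If `γ` is congruent to `η² + η` up to an element nilpotent modulo `2`, then it is of the form
`θ² + θ`. -/
theorem exists_sq_add_self {γ η : R} (h : ∃ n, (2 : R) ∣ (γ - (η ^ 2 + η)) ^ n) :
    ∃ θ, θ ^ 2 + θ = γ := by
  obtain ⟨n, hn⟩ := h
  have key : ∀ J : ℕ, ∃ η', (2 : R) ∣ γ - (η' ^ 2 + η') - (γ - (η ^ 2 + η)) ^ 2 ^ J := by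
    intro J
    induction J with
    | zero => exact ⟨η, by simp⟩
    | succ J ih =>
      obtain ⟨η', r, hr⟩ := ih
      set ν := (γ - (η ^ 2 + η)) ^ 2 ^ J
      exact ⟨η' + ν, r - η' * ν - ν ^ 2, by
        rw [pow_succ 2 J, pow_mul]; linear_combination hr⟩
  obtain ⟨η', h1⟩ := key n
  have h2 : (2 : R) ∣ γ - (η' ^ 2 + η') := by
    rw [← sub_add_cancel (γ - (η' ^ 2 + η')) ((γ - (η ^ 2 + η)) ^ 2 ^ n)]
    exact dvd_add h1 (hn.trans (pow_dvd_pow _ Nat.lt_two_pow_self.le))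
  obtain ⟨γ', hγ'⟩ := h2
  obtain ⟨y, hy⟩ := exists_fixed_point γ' (-(C η' * X) - X ^ 2)
  refine ⟨η' + 2 * y, ?_⟩
  simp only [eval_sub, eval_neg, eval_mul, eval_C, eval_X, eval_pow] at hy
  linear_combination -hγ' + 2 * hy

theorem exists_sq_of_eight (s : R) : ∃ y, 1 + 8 * s = (1 + 2 * y) ^ 2 := by
  obtain ⟨y, hy⟩ := exists_sq_add_self (γ := 2 * s) (η := 0) ⟨1, by simp⟩
  exact ⟨y, by linear_combination -4 * hy⟩

omit [Module.Finite ℤ_[2] R] in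
theorem two_mul_cancel {x y : R} (h : 2 * x = 2 * y) : x = y := by
  have h' : (2 : ℤ_[2]) • (x - y) = 0 := by
    rw [Algebra.smul_def, map_ofNat, mul_sub, h, sub_self]
  rcases smul_eq_zero.1 h' with h0 | h0
  · exact absurd h0 two_ne_zero
  · exact sub_eq_zero.1 h0

variable (R)

/-- The units which are congruent to `1` modulo `2 ^ n`. -/
def congrUnits (n : ℕ) : Subgroup Rˣ :=
  (Units.map (Ideal.Quotient.mk (Ideal.span {(2 : R) ^ n})).toMonoidHom).ker

variable {R}

omit [Algebra ℤ_[2] R] [Module.Finite ℤ_[2] R] [Module.Free ℤ_[2] R] in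
theorem mem_congrUnits {n : ℕ} {u : Rˣ} :
    u ∈ congrUnits R n ↔ (2 : R) ^ n ∣ (u : R) - 1 := by
  rw [congrUnits, MonoidHom.mem_ker, Units.ext_iff, Units.coe_map, Units.val_one,
    ← Ideal.mem_span_singleton, ← Ideal.Quotient.eq, map_one]
  rfl

variable (R) in
theorem finite_quotient_two_pow (n : ℕ) : Finite (R ⧸ Ideal.span {(2 : R) ^ n}) := by
  let b := Module.finBasis ℤ_[2] R
  have : Finite (ℤ_[2] ⧸ (IsLocalRing.maximalIdeal ℤ_[2]) ^ n) := by
    rw [PadicInt.maximalIdeal_eq_span_p, Ideal.span_singleton_pow,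
      ← PadicInt.ker_toZModPow]
    exact Finite.of_injective _ (RingHom.kerLift_injective (PadicInt.toZModPow (p := 2) n))
  refine Finite.of_injective (β := Fin (Module.finrank ℤ_[2] R) →
    ℤ_[2] ⧸ (IsLocalRing.maximalIdeal ℤ_[2]) ^ n)
    (fun x i => Ideal.Quotient.mk _ (b.equivFun (Quotient.out x) i)) ?_
  intro x y hxy
  have h : (2 : R) ^ n ∣ Quotient.out x - Quotient.out y := by
    refine (two_pow_dvd_iff b).2 fun i => ?_
    rw [map_sub, Pi.sub_apply, two_pow_dvd_padicInt_iff, ← Ideal.Quotient.eq]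
    exact congrFun hxy i
  rw [← Ideal.mem_span_singleton, ← Ideal.Quotient.eq] at h
  have hx : Ideal.Quotient.mk (Ideal.span {(2 : R) ^ n}) (Quotient.out x) = x :=
    Quotient.out_eq x
  have hy : Ideal.Quotient.mk (Ideal.span {(2 : R) ^ n}) (Quotient.out y) = y :=
    Quotient.out_eq y
  rw [← hx, ← hy, h]

theorem index_congrUnits (n : ℕ) : (congrUnits R n).index ≠ 0 := by
  have hfin := finite_quotient_two_pow R
  have := hfin n
  rw [congrUnits, Subgroup.index_ker]
  exact Nat.card_pos.ne'

theorem card_unitsModSquares : Nat.card (UnitsModSquares R) =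
    2 ^ Module.finrank ℤ_[2] R * Nat.card (powMonoidHom 2 : Rˣ →* Rˣ).ker := by
  have hmap : (congrUnits R 2).map (powMonoidHom 2) = congrUnits R 3 := by
    ext u
    rw [Subgroup.mem_map]
    constructor
    · rintro ⟨v, hv, rfl⟩
      rw [mem_congrUnits] at hv ⊢
      obtain ⟨r, hr⟩ := hv
      refine ⟨r + 2 * r ^ 2, ?_⟩
      rw [powMonoidHom_apply, Units.val_pow_eq_pow_val]
      linear_combination ((v : R) + 1 + 4 * r) * hr
    · intro hu
      rw [mem_congrUnits] at hu
      obtain ⟨s, hs⟩ := hu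
      obtain ⟨r, hr⟩ := exists_fixed_point s (-X ^ 2)
      have hunit := isUnit_one_add_two_mul (2 * r)
      refine ⟨hunit.unit, mem_congrUnits.2 ⟨r, by simp; ring⟩, Units.ext ?_⟩
      rw [powMonoidHom_apply, Units.val_pow_eq_pow_val, IsUnit.unit_spec]
      simp only [eval_neg, eval_pow, eval_X] at hr
      linear_combination 8 * hr - hs
  have hinf : congrUnits R 2 ⊓ (powMonoidHom 2 : Rˣ →* Rˣ).ker = ⊥ := by
    rw [eq_bot_iff]
    rintro u ⟨hu, hu2⟩
    obtain ⟨r, hr⟩ := mem_congrUnits.1 hu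
    have h2 : (u : R) ^ 2 = 1 := by simpa using congrArg Units.val hu2
    have h3 : 2 * (2 * (2 * (r * (1 + 2 * r)))) = 2 * (2 * (2 * 0)) := by
      linear_combination h2 - ((u : R) + 1 + 4 * r) * hr
    have h4 := two_mul_cancel (two_mul_cancel (two_mul_cancel h3))
    have h5 : r = 0 := (isUnit_one_add_two_mul r).mul_left_eq_zero.1 h4
    rw [h5, mul_zero, sub_eq_zero] at hr
    exact Units.ext hr
  have hle : congrUnits R 3 ≤ congrUnits R 2 := fun u hu =>
    mem_congrUnits.2 ((pow_dvd_pow 2 (by norm_num)).trans (mem_congrUnits.1 hu))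
  have h := index_range_eq (powMonoidHom 2) (congrUnits R 2) (index_congrUnits 2) hinf
    (hmap ▸ hle)
  have hrange : (powMonoidHom 2 : Rˣ →* Rˣ).range = Subgroup.square Rˣ := by
    ext u
    simp only [MonoidHom.mem_range, powMonoidHom_apply, Subgroup.mem_square, isSquare_iff_exists_sq]
    exact ⟨fun ⟨v, hv⟩ => ⟨v, hv.symm⟩, fun ⟨v, hv⟩ => ⟨v, hv.symm⟩⟩
  rw [hrange, hmap] at h
  rw [show Nat.card (UnitsModSquares R) = (Subgroup.square Rˣ).index from rfl, h]
  congr 1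
  obtain ⟨ρ, hρ, hρ'⟩ := exists_mod_two_hom R
  choose q hq using fun u : congrUnits R 2 => mem_congrUnits.1 u.2
  have hval : ∀ u : congrUnits R 2, ((u : Rˣ) : R) = 1 + 4 * q u := fun u => by
    linear_combination hq u
  have hq4 : ∀ x y : R, 4 * x = 4 * y → x = y := fun x y h =>
    two_mul_cancel (two_mul_cancel (by linear_combination h))
  let ψ : congrUnits R 2 →* Multiplicative (Fin (Module.finrank ℤ_[2] R) → ZMod 2) :=
    MonoidHom.mk' (fun u => Multiplicative.ofAdd (ρ (q u))) fun u v => by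
      rw [← ofAdd_add, ← map_add]
      congr 1
      rw [← sub_eq_zero, ← map_sub, hρ']
      refine ⟨2 * q u * q v, hq4 _ _ ?_⟩
      have := hval (u * v)
      rw [Subgroup.coe_mul, Units.val_mul, hval, hval] at this
      linear_combination -this
  rw [relIndex_of_hom ψ ?_ ?_]
  · rw [Nat.card_eq_fintype_card, Fintype.card_multiplicative]
    simp
  · intro y
    obtain ⟨r, hr⟩ := hρ y.toAdd
    have hunit := isUnit_one_add_two_mul (2 * r)
    refine ⟨⟨hunit.unit, mem_congrUnits.2 ⟨r, by simp; ring⟩⟩, ?_⟩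
    have : q ⟨hunit.unit, mem_congrUnits.2 ⟨r, by simp; ring⟩⟩ = r := by
      refine hq4 _ _ ?_
      have := hval ⟨hunit.unit, mem_congrUnits.2 ⟨r, by simp; ring⟩⟩
      simp only [IsUnit.unit_spec] at this
      linear_combination -this
    change Multiplicative.ofAdd (ρ (q _)) = y
    rw [this, hr]
    rfl
  · intro u
    change Multiplicative.ofAdd (ρ (q u)) = 1 ↔ _
    rw [ofAdd_eq_one, hρ', mem_congrUnits, hval]
    constructor
    · rintro ⟨r, hr⟩
      exact ⟨r, by rw [hr]; ring⟩
    · rintro ⟨r, hr⟩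
      exact ⟨r, hq4 _ _ (by linear_combination hr)⟩

end TwoAdic

section Roots

variable {K : Type*} [Field K]

/-- `f` has the distinct roots `e₁`, `e₂`, `e₃` in `L`. -/
structure SplitRoots (f : K[X]) {L : Type*} [Field L] [Algebra K L] (e₁ e₂ e₃ : L) : Prop where
  s1 : algebraMap K L (f.coeff 2) = -(e₁ + e₂ + e₃)
  s2 : algebraMap K L (f.coeff 1) = e₁ * e₂ + e₁ * e₃ + e₂ * e₃
  s3 : algebraMap K L (f.coeff 0) = -(e₁ * e₂ * e₃)
  ne12 : e₁ ≠ e₂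
  ne13 : e₁ ≠ e₃
  ne23 : e₂ ≠ e₃

theorem exists_splitRoots [CharZero K] {f : K[X]} (hf : IsMonicCubic f) :
    ∃ e₁ e₂ e₃ : AlgebraicClosure K, SplitRoots f e₁ e₂ e₃ := by
  set L := AlgebraicClosure K
  set g := f.map (algebraMap K L) with hg
  have hm : g.Monic := hf.monic.map _
  have hsp : g.Splits := IsAlgClosed.splits g
  have hcard : g.roots.card = 3 := by
    rw [← hsp.natDegree_eq_card_roots, hf.monic.natDegree_map, hf.natDegree_eq]
  obtain ⟨e₁, e₂, e₃, he⟩ := Multiset.card_eq_three.1 hcard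
  have hnd : g.roots.Nodup := nodup_roots
    ((PerfectField.separable_iff_squarefree.2 hf.squarefree).map)
  have hprod := hsp.eq_prod_roots_of_monic hm
  rw [he] at hnd hprod
  have h0 : ∀ i, algebraMap K L (f.coeff i) = g.coeff i := fun i => by rw [hg, coeff_map]
  have hexp : g = X ^ 3 + C (-(e₁ + e₂ + e₃)) * X ^ 2 + C (e₁ * e₂ + e₁ * e₃ + e₂ * e₃) * X +
      C (-(e₁ * e₂ * e₃)) := by
    rw [hprod]
    simp only [Multiset.insert_eq_cons, Multiset.map_cons, Multiset.map_singleton,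
      Multiset.prod_cons, Multiset.prod_singleton, map_neg, map_add, map_mul]
    ring
  simp only [Multiset.insert_eq_cons, Multiset.nodup_cons, Multiset.mem_cons,
    Multiset.mem_singleton, not_or, Multiset.nodup_singleton, and_true] at hnd
  refine ⟨e₁, e₂, e₃, ?_, ?_, ?_, hnd.1.1, hnd.1.2, hnd.2⟩
  · rw [h0, hexp]
    simp only [coeff_add, coeff_C_mul, coeff_X_pow, coeff_X, coeff_C]
    norm_num
  · rw [h0, hexp]
    simp only [coeff_add, coeff_C_mul, coeff_X_pow, coeff_X, coeff_C]
    norm_num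
  · rw [h0, hexp]
    simp only [coeff_add, coeff_C_mul, coeff_X_pow, coeff_X, coeff_C]
    norm_num

/-- The discriminant of the cubic polynomial `X³ + a X² + b X + c`. -/
def cubicDisc {R : Type*} [CommRing R] (a b c : R) : R :=
  a ^ 2 * b ^ 2 - 4 * b ^ 3 - 4 * a ^ 3 * c - 27 * c ^ 2 + 18 * a * b * c

theorem cubicDisc_bezout {R : Type*} [CommRing R] (a b c x : R) :
    9 * cubicDisc a b c = (-(6 * b - 2 * a ^ 2) ^ 2 -
      (3 * (6 * b - 2 * a ^ 2) * x + 2 * a * (6 * b - 2 * a ^ 2) - 3 * (9 * c - a * b)) *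
        (3 * x + a)) * (3 * x ^ 2 + 2 * a * x + b) +
      9 * (3 * (6 * b - 2 * a ^ 2) * x + 2 * a * (6 * b - 2 * a ^ 2) - 3 * (9 * c - a * b)) *
        (x ^ 3 + a * x ^ 2 + b * x + c) := by
  unfold cubicDisc
  ring

theorem SplitRoots.disc {f : K[X]} {L : Type*} [Field L] [Algebra K L] {e₁ e₂ e₃ : L}
    (h : SplitRoots f e₁ e₂ e₃) :
    algebraMap K L (cubicDisc (f.coeff 2) (f.coeff 1) (f.coeff 0)) =
      ((e₁ - e₂) * (e₁ - e₃) * (e₂ - e₃)) ^ 2 := by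
  simp only [cubicDisc, map_sub, map_add, map_mul, map_pow, map_ofNat, h.s1, h.s2, h.s3]
  ring

theorem cubicDisc_ne_zero [CharZero K] {f : K[X]} (hf : IsMonicCubic f) :
    cubicDisc (f.coeff 2) (f.coeff 1) (f.coeff 0) ≠ 0 := by
  obtain ⟨e₁, e₂, e₃, h⟩ := exists_splitRoots hf
  intro h0
  have := h.disc
  rw [h0, map_zero, eq_comm, pow_eq_zero_iff two_ne_zero, mul_eq_zero, mul_eq_zero,
    sub_eq_zero, sub_eq_zero, sub_eq_zero] at this
  rcases this with (h1 | h1) | h1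
  exacts [h.ne12 h1, h.ne13 h1, h.ne23 h1]

end Roots

section Integral

variable {O K : Type*} [CommRing O] [Field K] [Algebra O K]

theorem isIntegral_of_quadratic {A : Type*} [CommRing A] [Algebra O A] {z : A} {b c : O}
    (h : z ^ 2 + algebraMap O A b * z + algebraMap O A c = 0) : IsIntegral O z := by
  refine ⟨X ^ 2 + (C b * X + C c), monic_X_pow_add (n := 2) (by compute_degree!), ?_⟩
  simp only [eval₂_add, eval₂_mul, eval₂_X_pow, eval₂_C, eval₂_X]
  linear_combination h

variable [IsFractionRing O K] [IsDomain O] [IsIntegrallyClosed O]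

theorem exists_of_quadratic {z : K} {b c : O}
    (h : z ^ 2 + algebraMap O K b * z + algebraMap O K c = 0) : ∃ o, algebraMap O K o = z :=
  IsIntegrallyClosed.isIntegral_iff.1 (isIntegral_of_quadratic h)

theorem exists_of_sq {z : K} {c : O} (h : z ^ 2 = algebraMap O K c) :
    ∃ o, algebraMap O K o = z :=
  exists_of_quadratic (b := 0) (c := -c) (by rw [h]; simp)

end Integral

section Filtration

/-- The points `(x, y)` for which `1 / x` is integral and divisible by `4 ^ (j + 1)`, and the point
at infinity. -/
def InFil (O : Type*) {K : Type*} [CommRing O] [Field K] [Algebra O K] {f : K[X]} (j : ℕ) :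
    CurvePoint f → Prop
  | .zero => True
  | .some x _ _ => ∃ τ : O, x * algebraMap O K (4 ^ (j + 1) * τ) = 1

/-- `ζ = x / (2 ^ (j + 1) y)` is the value of the normalized local parameter at `P`. -/
def IsParam (O : Type*) {K : Type*} [CommRing O] [Field K] [Algebra O K] {f : K[X]} (j : ℕ) :
    CurvePoint f → O → Prop
  | .zero, ζ => ζ = 0
  | .some x y _, ζ => x ≠ 0 ∧ y * algebraMap O K (2 ^ (j + 1) * ζ) = x

variable {O K : Type*} [CommRing O] [IsDomain O] [ValuationRing O] [Field K] [CharZero K]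
  [Algebra O K] [IsFractionRing O K] [Algebra ℤ_[2] O] [Module.Finite ℤ_[2] O]
  [Module.Free ℤ_[2] O]

local notation "ι" => algebraMap O K

theorem exists_third {a b c : O} {j : ℕ} {x₁ x₂ x₃ : K} {τ₁ τ₂ : O}
    (h : (ι b - (x₁ * x₂ + x₁ * x₃ + x₂ * x₃)) ^ 2 =
      4 * (x₁ + x₂ + x₃ + ι a) * (x₁ * x₂ * x₃ + ι c))
    (h₁ : x₁ * ι (4 ^ (j + 1) * τ₁) = 1) (h₂ : x₂ * ι (4 ^ (j + 1) * τ₂) = 1) :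
    ∃ τ₃, x₃ * ι (4 ^ (j + 1) * τ₃) = 1 := by
  set p : O := 4 ^ (j + 1) with hp
  have hp4 : p = 4 * 4 ^ j := by rw [hp, pow_succ']
  set s := ι p * x₃ with hs
  set q : O := 4 ^ j with hq
  let c₀ : O := (b * (p * τ₁) * (p * τ₂) - 1) ^ 2 -
    4 * c * (p * τ₁) * (p * τ₂) * (p * τ₁ + p * τ₂ + a * (p * τ₁) * (p * τ₂))
  let d₁ : O := -2 * (b * (p * τ₁) * (p * τ₂) - 1) * (τ₁ + τ₂) -
    4 * (τ₁ + τ₂ + a * τ₁ * (p * τ₂)) - 4 * c * τ₁ * (p * τ₁) * (p * τ₂) ^ 2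
  let d₂ : O := (τ₁ - τ₂) ^ 2
  have hc₀ : IsUnit c₀ := by
    have : c₀ = 1 + 2 * (8 * b ^ 2 * q * τ₁ * (q * τ₂) * (p * τ₁) * (p * τ₂) -
        16 * b * q * τ₁ * q * τ₂ -
        2 * c * (p * τ₁) * (p * τ₂) * (p * τ₁ + p * τ₂ + a * (p * τ₁) * (p * τ₂))) := by
      simp only [c₀, hp4]; ring
    rw [this]
    exact isUnit_one_add_two_mul _
  have key : ι c₀ + ι d₁ * s + ι d₂ * s ^ 2 = 0 := by
    simp only [map_mul] at h₁ h₂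
    simp only [c₀, d₁, d₂, hs, map_sub, map_add, map_mul, map_pow, map_ofNat, map_one, map_neg]
    have g₁ : ∀ z, z * (x₁ * (ι p * ι τ₁)) = z := fun z => by rw [h₁, mul_one]
    have e₁ : x₁ ≠ 0 := left_ne_zero_of_mul (h₁ ▸ one_ne_zero)
    have e₂ : x₂ ≠ 0 := left_ne_zero_of_mul (h₂ ▸ one_ne_zero)
    have t₁ : ι p * ι τ₁ = 1 / x₁ := by field_simp; linear_combination h₁
    have t₂ : ι p * ι τ₂ = 1 / x₂ := by field_simp; linear_combination h₂
    have step : (ι b * (ι p * ι τ₁) * (ι p * ι τ₂) - 1) ^ 2 -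
        4 * ι c * (ι p * ι τ₁) * (ι p * ι τ₂) *
          (ι p * ι τ₁ + ι p * ι τ₂ + ι a * (ι p * ι τ₁) * (ι p * ι τ₂)) +
        (-2 * (ι b * (ι p * ι τ₁) * (ι p * ι τ₂) - 1) * (ι p * ι τ₁ + ι p * ι τ₂) -
          4 * (ι p * ι τ₁ + ι p * ι τ₂ + ι a * (ι p * ι τ₁) * (ι p * ι τ₂)) -
          4 * ι c * (ι p * ι τ₁) ^ 2 * (ι p * ι τ₂) ^ 2) * x₃ +
        (ι p * ι τ₁ - ι p * ι τ₂) ^ 2 * x₃ ^ 2 = 0 := by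
      rw [t₁, t₂]
      field_simp
      linear_combination h
    linear_combination step
  have hs0 : s ≠ 0 := by
    intro h0
    rw [h0] at key
    have : ι c₀ = 0 := by linear_combination key
    rw [map_eq_zero_iff _ (IsFractionRing.injective O K)] at this
    exact hc₀.ne_zero this
  obtain ⟨v, hv⟩ := hc₀.exists_right_inv
  obtain ⟨τ₃, hτ⟩ := exists_of_quadratic (O := O) (z := s⁻¹) (b := v * d₁) (c := v * d₂) (by
    have hv' : ι c₀ * ι v = 1 := by rw [← map_mul, hv, map_one]
    have hss : s⁻¹ * s = 1 := inv_mul_cancel₀ hs0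
    simp only [map_mul]
    linear_combination ι v * (s⁻¹) ^ 2 * key - (s⁻¹) ^ 2 * hv' - ι v * ι d₁ * s⁻¹ * hss -
      ι v * ι d₂ * (s⁻¹ * s + 1) * hss)
  refine ⟨τ₃, ?_⟩
  rw [map_mul, hτ]
  have : s * s⁻¹ = 1 := mul_inv_cancel₀ hs0
  linear_combination this

variable {F : O[X]}

open scoped Classical in
theorem InFil.third {j : ℕ} {P Q R : CurvePoint (F.map ι)} (h : P + Q + R = 0)
    (hP : InFil O j P) (hQ : InFil O j Q) : InFil O j R := by
  match P, Q, R with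
  | _, _, .zero => trivial
  | .zero, Q, R =>
    have : R = -Q := eq_neg_of_add_eq_zero_right (by rw [← h]; congr 1)
    rw [this]
    match Q with
    | .zero => trivial
    | .some x y h => exact hQ
  | .some x₁ y₁ h₁, .zero, R =>
    have : R = -(.some x₁ y₁ h₁) :=
      eq_neg_of_add_eq_zero_right (by
        rw [← h]; congr 1)
    rw [this]
    exact hP
  | .some x₁ y₁ h₁, .some x₂ y₂ h₂, .some x₃ y₃ h₃ =>
    obtain ⟨l, m, hl, -⟩ := exists_isLine h
    obtain ⟨τ₁, hτ₁⟩ := hP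
    obtain ⟨τ₂, hτ₂⟩ := hQ
    refine exists_third (a := F.coeff 2) (b := F.coeff 1) (c := F.coeff 0) ?_ hτ₁ hτ₂
    have e1 := hl.e1
    have e2 := hl.e2
    have e3 := hl.e3
    simp only [coeff_map] at e1 e2 e3
    rw [e1, e2, e3]
    ring

theorem InFil.neg {j : ℕ} {P : CurvePoint (F.map ι)} (hP : InFil O j P) : InFil O j (-P) :=
  match P, hP with
  | .zero, _ => trivial
  | .some _ _ _, h => h

open scoped Classical in
/-- The filtration of `E(K)` by the points near the point at infinity. -/
def fil (F : O[X]) (j : ℕ) : AddSubgroup (CurvePoint (F.map ι)) where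
  carrier := {P | InFil O j P}
  zero_mem' := trivial
  neg_mem' := InFil.neg
  add_mem' {P Q} hP hQ := by
    rw [← neg_neg (P + Q)]
    exact InFil.neg (InFil.third (add_neg_cancel (P + Q)) hP hQ)

theorem eval_map_eq (hf : IsMonicCubic (F.map ι)) (x : K) : (F.map ι).eval x =
    x ^ 3 + ι (F.coeff 2) * x ^ 2 + ι (F.coeff 1) * x + ι (F.coeff 0) := by
  rw [hf.eval_eq]
  simp only [coeff_map]

theorem exists_param (hf : IsMonicCubic (F.map ι)) {j : ℕ} {x y : K} (h : (cubicCurve (F.map ι)).toAffine.Nonsingular x y)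
    {τ : O} (hτ : x * ι (4 ^ (j + 1) * τ) = 1) :
    y ≠ 0 ∧ ∃ ζ : O, y * ι (2 ^ (j + 1) * ζ) = x ∧
      τ = ζ ^ 2 * (1 + F.coeff 2 * (4 ^ (j + 1) * τ) + F.coeff 1 * (4 ^ (j + 1) * τ) ^ 2 +
        F.coeff 0 * (4 ^ (j + 1) * τ) ^ 3) := by
  have hinj := IsFractionRing.injective O K
  have hy := eval_eq_sq hf h
  rw [eval_map_eq hf] at hy
  set t : O := 4 ^ (j + 1) * τ with ht
  set e : O := 1 + F.coeff 2 * t + F.coeff 1 * t ^ 2 + F.coeff 0 * t ^ 3 with he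
  have hx0 : x ≠ 0 := left_ne_zero_of_mul (hτ ▸ one_ne_zero)
  have heu : IsUnit e := by
    have : e = 1 + 2 * (2 * 4 ^ j * τ * (F.coeff 2 + F.coeff 1 * t + F.coeff 0 * t ^ 2)) := by
      rw [he, ht]; ring
    rw [this]; exact isUnit_one_add_two_mul _
  have hye : y ^ 2 * ι t = x ^ 2 * ι e := by
    simp only [he, map_add, map_mul, map_pow, map_one]
    linear_combination -ι t * hy +
      (x ^ 2 - ι (F.coeff 1) * x * ι t - ι (F.coeff 0) * ι t * (x * ι t + 1)) * hτ
  have hy0 : y ≠ 0 := by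
    rintro rfl
    have : x ^ 2 * ι e = 0 := by rw [← hye]; ring
    rcases mul_eq_zero.1 this with h1 | h1
    · exact hx0 (pow_eq_zero_iff two_ne_zero |>.1 h1)
    · exact heu.ne_zero ((map_eq_zero_iff _ hinj).1 h1)
  refine ⟨hy0, ?_⟩
  obtain ⟨v, hv⟩ := heu.exists_right_inv
  have hv' : ι e * ι v = 1 := by rw [← map_mul, hv, map_one]
  set p : K := ι (2 ^ (j + 1)) with hp
  have hpp : ι (4 ^ (j + 1)) = p ^ 2 := by
    rw [hp, ← map_pow, ← pow_mul, mul_comm, pow_mul]; norm_num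
  have hp0 : p ≠ 0 := by
    rw [hp, map_pow, map_ofNat]; exact pow_ne_zero _ two_ne_zero
  have hsq : (x / (p * y)) ^ 2 = ι (τ * v) := by
    rw [ht, map_mul, hpp] at hye
    rw [map_mul]
    field_simp
    linear_combination -ι v * hye - x ^ 2 * hv'
  obtain ⟨ζ, hζ⟩ := exists_of_sq hsq
  refine ⟨ζ, ?_, hinj ?_⟩
  · rw [map_mul, hζ, ← hp]; field_simp
  · rw [← hζ, ← map_pow] at hsq
    rw [map_mul, hsq, map_mul]
    linear_combination -ι τ * hv'

theorem param_of_mem (hf : IsMonicCubic (F.map ι)) {j : ℕ} {P : CurvePoint (F.map ι)} (hP : P ∈ fil F j) :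
    ∃ ζ : O, IsParam O j P ζ :=
  match P, hP with
  | .zero, _ => ⟨0, rfl⟩
  | .some x y h, ⟨τ, hτ⟩ => by
    obtain ⟨-, ζ, hζ, -⟩ := exists_param hf h hτ
    exact ⟨ζ, left_ne_zero_of_mul (hτ ▸ one_ne_zero), hζ⟩

theorem IsParam.unique {j : ℕ} {P : CurvePoint (F.map ι)} {ζ ζ' : O} (h : IsParam O j P ζ)
    (h' : IsParam O j P ζ') : ζ = ζ' :=
  match P, h, h' with
  | .zero, h, h' => h.trans h'.symm
  | .some x y _, ⟨hx, h⟩, ⟨_, h'⟩ => by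
    have hy : y ≠ 0 := by rintro rfl; exact hx (by rw [← h, zero_mul])
    have h1 := IsFractionRing.injective O K (mul_left_cancel₀ hy (h.trans h'.symm))
    refine mul_left_cancel₀ (pow_ne_zero (j + 1) ?_) h1
    intro h2
    have : ι 2 = 0 := by rw [h2, map_zero]
    rw [map_ofNat] at this
    exact two_ne_zero this

theorem IsParam.neg {j : ℕ} {P : CurvePoint (F.map ι)} {ζ : O} (h : IsParam O j P ζ) :
    IsParam O j (-P) (-ζ) :=
  match P, h with
  | .zero, h => by rw [show ζ = 0 from h, neg_zero]; rfl
  | .some x y _, ⟨hx, h⟩ => by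
    refine ⟨hx, ?_⟩
    rw [← h]
    simp [WeierstrassCurve.Affine.negY, cubicCurve]

open scoped Classical in
theorem IsParam.sum {j : ℕ} {P Q R : CurvePoint (F.map ι)} (h : P + Q + R = 0)
    (mP : P ∈ fil F j) (mQ : Q ∈ fil F j) {ζ₁ ζ₂ ζ₃ : O}
    (hP : IsParam O j P ζ₁) (hQ : IsParam O j Q ζ₂) (hR : IsParam O j R ζ₃) :
    (2 : O) ∣ ζ₁ + ζ₂ + ζ₃ := by
  have mR : R ∈ fil F j := InFil.third h mP mQ
  have aux : ∀ {P Q : CurvePoint (F.map ι)} {ζ₁ ζ₂ : O}, P + Q = 0 → IsParam O j P ζ₁ →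
      IsParam O j Q ζ₂ → ζ₁ + ζ₂ = 0 := by
    intro P Q ζ₁ ζ₂ h hP hQ
    rw [eq_neg_of_add_eq_zero_right h] at hQ
    rw [hQ.unique hP.neg, add_neg_cancel]
  match P, Q, R, h, mP, mQ, mR, hP, hQ, hR with
  | .zero, Q, R, h, _, _, _, hP, hQ, hR =>
    have := aux (by rw [← h]; congr 1) hQ hR
    rw [show ζ₁ = 0 from hP, zero_add, this]; exact dvd_zero _
  | P, .zero, R, h, _, _, _, hP, hQ, hR =>
    have := aux (by rw [← h]; congr 1; exact (add_zero P).symm) hP hR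
    rw [show ζ₂ = 0 from hQ, add_zero, this]; exact dvd_zero _
  | P, Q, .zero, h, _, _, _, hP, hQ, hR =>
    have := aux ((add_zero (P + Q)).symm.trans h) hP hQ
    rw [show ζ₃ = 0 from hR, add_zero, this]; exact dvd_zero _
  | .some x₁ y₁ h₁, .some x₂ y₂ h₂, .some x₃ y₃ h₃, h, ⟨τ₁, t₁⟩, ⟨τ₂, t₂⟩, ⟨τ₃, t₃⟩,
      ⟨x₁0, z₁⟩, ⟨x₂0, z₂⟩, ⟨x₃0, z₃⟩ =>
    obtain ⟨l, m, hl, e₁, e₂, e₃⟩ := exists_isLine h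
    have hS : x₁ * y₂ * y₃ + x₂ * y₁ * y₃ + x₃ * y₁ * y₂ =
        -3 * ι (F.coeff 0) * (x₁ + x₂ + x₃ + ι (F.coeff 2)) +
        ι (F.coeff 1) * (ι (F.coeff 1) - (x₁ * x₂ + x₁ * x₃ + x₂ * x₃)) -
        ι (F.coeff 2) * (x₁ * x₂ * x₃ + ι (F.coeff 0)) := by
      have e1 := hl.e1
      have e2 := hl.e2
      have e3 := hl.e3
      simp only [coeff_map] at e1 e2 e3
      rw [e₁, e₂, e₃]
      linear_combination m ^ 2 * e1 + 2 * l * m * e2 + 3 * l ^ 2 * e3 +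
        3 * ι (F.coeff 0) * e1 + ι (F.coeff 1) * e2 + ι (F.coeff 2) * e3
    set p : O := 2 ^ (j + 1) with hp
    have hpp : (4 : O) ^ (j + 1) = p ^ 2 := by
      rw [hp, ← pow_mul, mul_comm, pow_mul]; norm_num
    rw [hpp] at t₁ t₂ t₃
    have y₁0 : y₁ ≠ 0 := by rintro rfl; exact x₁0 (by rw [← z₁, zero_mul])
    have y₂0 : y₂ ≠ 0 := by rintro rfl; exact x₂0 (by rw [← z₂, zero_mul])
    have y₃0 : y₃ ≠ 0 := by rintro rfl; exact x₃0 (by rw [← z₃, zero_mul])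
    have w : ∀ {x y : K} {ζ τ : O}, x ≠ 0 → y * ι (p * ζ) = x → x * ι (p ^ 2 * τ) = 1 →
        y * ι (p ^ 3 * (ζ * τ)) = 1 := by
      intro x y ζ τ hx h h'
      rw [← h', ← h]
      simp only [map_mul, map_pow]
      ring
    have w₁ := w x₁0 z₁ t₁
    have w₂ := w x₂0 z₂ t₂
    have w₃ := w x₃0 z₃ t₃
    set a := F.coeff 2
    set b := F.coeff 1
    set c := F.coeff 0
    set r : O := -3 * c * (p ^ 4 * ζ₁ * (ζ₂ * τ₂) * (ζ₃ * τ₃) + p ^ 4 * ζ₂ * (ζ₁ * τ₁) * (ζ₃ * τ₃) +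
        p ^ 4 * ζ₃ * (ζ₁ * τ₁) * (ζ₂ * τ₂) + a * p ^ 6 * (ζ₁ * τ₁) * (ζ₂ * τ₂) * (ζ₃ * τ₃)) +
        b * (b * p ^ 6 * (ζ₁ * τ₁) * (ζ₂ * τ₂) * (ζ₃ * τ₃) - p ^ 2 * (ζ₁ * ζ₂ * (ζ₃ * τ₃) +
          ζ₁ * ζ₃ * (ζ₂ * τ₂) + ζ₂ * ζ₃ * (ζ₁ * τ₁))) -
        a * (ζ₁ * ζ₂ * ζ₃ + c * p ^ 6 * (ζ₁ * τ₁) * (ζ₂ * τ₂) * (ζ₃ * τ₃)) with hr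
    have hp0 : p ≠ 0 := by
      intro h2
      have : ι p = 0 := by rw [h2, map_zero]
      rw [hp, map_pow, map_ofNat] at this
      exact pow_ne_zero _ two_ne_zero this
    have hsum : ζ₁ + ζ₂ + ζ₃ = p ^ 2 * r := by
      refine mul_left_cancel₀ hp0 (IsFractionRing.injective O K ?_)
      have Z₁ : ι p * ι ζ₁ = x₁ / y₁ := by rw [← map_mul]; field_simp; linear_combination z₁
      have Z₂ : ι p * ι ζ₂ = x₂ / y₂ := by rw [← map_mul]; field_simp; linear_combination z₂
      have Z₃ : ι p * ι ζ₃ = x₃ / y₃ := by rw [← map_mul]; field_simp; linear_combination z₃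
      have W₁ : ι p ^ 3 * (ι ζ₁ * ι τ₁) = 1 / y₁ := by
        rw [← map_pow, ← map_mul, ← map_mul]; field_simp; linear_combination w₁
      have W₂ : ι p ^ 3 * (ι ζ₂ * ι τ₂) = 1 / y₂ := by
        rw [← map_pow, ← map_mul, ← map_mul]; field_simp; linear_combination w₂
      have W₃ : ι p ^ 3 * (ι ζ₃ * ι τ₃) = 1 / y₃ := by
        rw [← map_pow, ← map_mul, ← map_mul]; field_simp; linear_combination w₃
      have goal : ι p * ι ζ₁ + ι p * ι ζ₂ + ι p * ι ζ₃ =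
          -3 * ι c * ((ι p * ι ζ₁) * (ι p ^ 3 * (ι ζ₂ * ι τ₂)) * (ι p ^ 3 * (ι ζ₃ * ι τ₃)) +
            (ι p * ι ζ₂) * (ι p ^ 3 * (ι ζ₁ * ι τ₁)) * (ι p ^ 3 * (ι ζ₃ * ι τ₃)) +
            (ι p * ι ζ₃) * (ι p ^ 3 * (ι ζ₁ * ι τ₁)) * (ι p ^ 3 * (ι ζ₂ * ι τ₂)) +
            ι a * (ι p ^ 3 * (ι ζ₁ * ι τ₁)) * (ι p ^ 3 * (ι ζ₂ * ι τ₂)) *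
              (ι p ^ 3 * (ι ζ₃ * ι τ₃))) +
          ι b * (ι b * (ι p ^ 3 * (ι ζ₁ * ι τ₁)) * (ι p ^ 3 * (ι ζ₂ * ι τ₂)) *
              (ι p ^ 3 * (ι ζ₃ * ι τ₃)) -
            ((ι p * ι ζ₁) * (ι p * ι ζ₂) * (ι p ^ 3 * (ι ζ₃ * ι τ₃)) +
             (ι p * ι ζ₁) * (ι p * ι ζ₃) * (ι p ^ 3 * (ι ζ₂ * ι τ₂)) +
             (ι p * ι ζ₂) * (ι p * ι ζ₃) * (ι p ^ 3 * (ι ζ₁ * ι τ₁)))) -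
          ι a * ((ι p * ι ζ₁) * (ι p * ι ζ₂) * (ι p * ι ζ₃) +
            ι c * (ι p ^ 3 * (ι ζ₁ * ι τ₁)) * (ι p ^ 3 * (ι ζ₂ * ι τ₂)) *
              (ι p ^ 3 * (ι ζ₃ * ι τ₃))) := by
        rw [Z₁, Z₂, Z₃, W₁, W₂, W₃]
        field_simp
        linear_combination hS
      rw [hr]
      simp only [map_sub, map_add, map_mul, map_pow, map_ofNat, map_neg]
      linear_combination goal
    rw [hsum, hp]
    exact (Dvd.intro_left (2 ^ j * 2 ^ (j + 1)) (by ring)).mul_right _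

end Filtration

section FiltrationIndex

variable {O K : Type*} [CommRing O] [IsDomain O] [ValuationRing O] [Field K] [CharZero K]
  [Algebra O K] [IsFractionRing O K] [Algebra ℤ_[2] O] [Module.Finite ℤ_[2] O]
  [Module.Free ℤ_[2] O]

local notation "ι" => algebraMap O K

variable {F : O[X]}

theorem map_ne_zero_of_ne {o : O} (h : o ≠ 0) : ι o ≠ 0 := fun h' =>
  h ((map_eq_zero_iff _ (IsFractionRing.injective O K)).1 h')

theorem two_ne_zero_of_isFractionRing (O K : Type*) [CommRing O] [Field K] [CharZero K]
    [Algebra O K] : (2 : O) ≠ 0 := fun h =>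
  two_ne_zero (α := K) (by rw [← map_ofNat (algebraMap O K) 2, h, map_zero])

theorem exists_point_of_param (hf : IsMonicCubic (F.map ι)) (j : ℕ) {ζ : O} (hζ : ζ ≠ 0) :
    ∃ (x y : K) (h : (cubicCurve (F.map ι)).toAffine.Nonsingular x y), y ≠ 0 ∧
      InFil O j (.some x y h : CurvePoint (F.map ι)) ∧
      IsParam O j (.some x y h : CurvePoint (F.map ι)) ζ := by
  set p : O := 2 ^ (j + 1) with hp
  have hp0 : p ≠ 0 := pow_ne_zero _ (two_ne_zero_of_isFractionRing O K)
  set q' : O := 4 ^ j * ζ ^ 2 with hq'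
  have hpq : (p * ζ) ^ 2 = 4 * q' := by
    rw [hp, hq', mul_pow, ← pow_mul, mul_comm (j + 1), pow_mul, pow_succ']; norm_num; ring
  set a := F.coeff 2 with ha
  set b := F.coeff 1 with hb
  set c := F.coeff 0 with hc
  obtain ⟨Y, hY⟩ := exists_fixed_point (-(q' * (a + b * (4 * q') + c * (4 * q') ^ 2)))
    (-(C q' * (C a * (4 * X + 8 * X ^ 2) + 2 * C b * C (4 * q') * X)) - 4 * X ^ 2 - 8 * X ^ 3)
  simp only [eval_sub, eval_neg, eval_mul, eval_add, eval_C, eval_X, eval_pow,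
    eval_ofNat] at hY
  have hXu := isUnit_one_add_two_mul (2 * Y)
  set x' : O := 1 + 2 * (2 * Y) with hx'
  have hX : x' ^ 2 = x' ^ 3 + a * (4 * q') * x' ^ 2 + b * (4 * q') ^ 2 * x' + c * (4 * q') ^ 3 := by
    rw [hx']
    linear_combination -4 * hY
  obtain ⟨v, hv⟩ := hXu.exists_right_inv
  have hP0 : ι (p * ζ) ≠ 0 := map_ne_zero_of_ne (mul_ne_zero hp0 hζ)
  have hx0 : ι x' ≠ 0 := map_ne_zero_of_ne hXu.ne_zero
  have hpq' : ι (p * ζ) ^ 2 = 4 * ι q' := by rw [← map_pow, hpq, map_mul, map_ofNat]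
  have hXK : ι x' ^ 2 = ι x' ^ 3 + ι a * (ι (p * ζ) ^ 2) * ι x' ^ 2 +
      ι b * (ι (p * ζ) ^ 2) ^ 2 * ι x' + ι c * (ι (p * ζ) ^ 2) ^ 3 := by
    rw [hpq']
    simpa only [map_add, map_mul, map_pow, map_ofNat] using congrArg ι hX
  have hev : (F.map ι).eval (ι x' / ι (p * ζ) ^ 2) = (ι x' / ι (p * ζ) ^ 3) ^ 2 := by
    rw [eval_map_eq hf]
    field_simp
    linear_combination -hXK
  refine ⟨_, _, nonsingular_of_eval hf hev, div_ne_zero hx0 (pow_ne_zero _ hP0), ?_, ?_, ?_⟩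
  · refine ⟨ζ ^ 2 * v, ?_⟩
    have h4 : (4 : O) ^ (j + 1) = p ^ 2 := by
      rw [hp, ← pow_mul, mul_comm, pow_mul]; norm_num
    have : (4 : O) ^ (j + 1) * (ζ ^ 2 * v) = (p * ζ) ^ 2 * v := by rw [h4]; ring
    rw [this, map_mul ι ((p * ζ) ^ 2) v, map_pow ι (p * ζ) 2, ← mul_assoc,
      div_mul_cancel₀ _ (pow_ne_zero _ hP0), ← map_mul, hv, map_one]
  · exact div_ne_zero hx0 (pow_ne_zero _ hP0)
  · field_simp
    rfl

open scoped Classical in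
theorem mem_fil_succ_iff (hf : IsMonicCubic (F.map ι)) {j : ℕ} {P : CurvePoint (F.map ι)}
    (hP : P ∈ fil F j) {ζ : O} (hζ : IsParam O j P ζ) : P ∈ fil F (j + 1) ↔ (2 : O) ∣ ζ := by
  match P, hP, hζ with
  | .zero, _, hζ =>
    rw [show ζ = 0 from hζ]
    exact ⟨fun _ => dvd_zero _, fun _ => trivial⟩
  | .some x y h, ⟨τ, hτ⟩, hζ =>
    obtain ⟨-, ζ', hζ', e⟩ := exists_param hf h hτ
    have hx0 : x ≠ 0 := left_ne_zero_of_mul (hτ ▸ one_ne_zero)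
    have hu : ζ = ζ' :=
      hζ.unique (show IsParam O j (.some x y h : CurvePoint (F.map ι)) ζ' from ⟨hx0, hζ'⟩)
    subst hu
    constructor
    · rintro ⟨τ', hτ'⟩
      obtain ⟨-, ζ', hζ'', -⟩ := exists_param hf h hτ'
      refine ⟨ζ', hζ.unique (show IsParam O j (.some x y h : CurvePoint (F.map ι)) _ from
        ⟨hx0, ?_⟩)⟩
      rw [← hζ'', pow_succ _ (j + 1), mul_assoc]
    · rintro ⟨ζ', rfl⟩
      refine ⟨ζ' ^ 2 * (1 + F.coeff 2 * (4 ^ (j + 1) * τ) + F.coeff 1 * (4 ^ (j + 1) * τ) ^ 2 +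
        F.coeff 0 * (4 ^ (j + 1) * τ) ^ 3), ?_⟩
      rw [← hτ]
      congr 2
      conv_rhs => rw [e]
      ring

theorem y_ne_zero_of_mem (hf : IsMonicCubic (F.map ι)) {j : ℕ} {x y : K}
    {h : (cubicCurve (F.map ι)).toAffine.Nonsingular x y}
    (hP : (.some x y h : CurvePoint (F.map ι)) ∈ fil F j) : y ≠ 0 := by
  obtain ⟨τ, hτ⟩ := hP
  exact (exists_param hf h hτ).1

open scoped Classical in
/-- The local parameter modulo `2` as a homomorphism. -/
theorem exists_param_hom (hf : IsMonicCubic (F.map ι)) (j : ℕ) :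
    ∃ ψ : fil (K := K) F j →+ (Fin (Module.finrank ℤ_[2] O) → ZMod 2),
      Function.Surjective ψ ∧ ∀ P, ψ P = 0 ↔ (P : CurvePoint (F.map ι)) ∈ fil F (j + 1) := by
  obtain ⟨ρ, hρ, hρ'⟩ := exists_mod_two_hom O
  choose ζ hζ using fun P : fil (K := K) F j => param_of_mem hf P.2
  have hadd : ∀ P Q : fil (K := K) F j, ρ (ζ (P + Q)) = ρ (ζ P) + ρ (ζ Q) := by
    intro P Q
    rw [← map_add, ← sub_eq_zero, ← map_sub, hρ']
    have h := IsParam.sum (add_neg_cancel ((P : CurvePoint (F.map ι)) + Q)) P.2 Q.2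
      (hζ P) (hζ Q) (hζ (P + Q)).neg
    rw [← dvd_neg]
    convert h using 1
    ring
  refine ⟨AddMonoidHom.mk' (fun P => ρ (ζ P)) hadd, ?_, fun P => ?_⟩
  · intro z
    obtain ⟨o, ho⟩ := hρ z
    by_cases h0 : o = 0
    · refine ⟨0, ?_⟩
      rw [map_zero, ← ho, h0, map_zero]
    · obtain ⟨x, y, h, -, hP, hP'⟩ := exists_point_of_param hf j h0
      refine ⟨⟨.some x y h, hP⟩, ?_⟩
      change ρ (ζ _) = z
      rw [(hζ ⟨.some x y h, hP⟩).unique hP', ho]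
  · change ρ (ζ P) = 0 ↔ _
    rw [hρ', mem_fil_succ_iff hf P.2 (hζ P)]

open scoped Classical in
theorem relIndex_fil (hf : IsMonicCubic (F.map ι)) (j : ℕ) :
    (fil (K := K) F (j + 1)).relIndex (fil F j) = 2 ^ Module.finrank ℤ_[2] O := by
  obtain ⟨ψ, h1, h2⟩ := exists_param_hom (K := K) hf j
  rw [relIndex_of_addHom ψ h1 h2, Nat.card_eq_fintype_card]
  simp

open scoped Classical in
theorem fil_succ_le (j : ℕ) : fil (K := K) F (j + 1) ≤ fil F j := by
  rintro P hP
  match P, hP with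
  | .zero, _ => trivial
  | .some x y h, ⟨τ, hτ⟩ => exact ⟨4 * τ, by rw [← hτ, pow_succ _ (j + 1), mul_assoc]⟩

/-- The image of `p` in `K[T]/(f(T))` has integral coordinates. -/
theorem exists_coord_of_integral (hf : IsMonicCubic (F.map ι)) (p : O[X]) :
    ∃ u v w : O, AdjoinRoot.mk (F.map ι) (p.map ι) = coord (F.map ι) (ι u) (ι v) (ι w) := by
  have hinj := IsFractionRing.injective O K
  have hm : F.Monic := monic_of_injective hinj hf.monic
  have hd : F.natDegree = 3 := by rw [← hf.natDegree_eq, natDegree_map_eq_of_injective hinj]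
  have hd' : (p %ₘ F).natDegree < 3 := by
    rw [← hd]
    exact natDegree_modByMonic_lt p hm fun h => by
      rw [h, natDegree_one] at hd; omega
  refine ⟨(p %ₘ F).coeff 0, (p %ₘ F).coeff 1, (p %ₘ F).coeff 2, ?_⟩
  have h1 : p %ₘ F = C ((p %ₘ F).coeff 0) + C ((p %ₘ F).coeff 1) * X +
      C ((p %ₘ F).coeff 2) * X ^ 2 := by
    conv_lhs => rw [(p %ₘ F).as_sum_range_C_mul_X_pow' hd']
    simp [Finset.sum_range_succ]
  have h2 := congrArg (Polynomial.map ι) h1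
  simp only [Polynomial.map_add, Polynomial.map_mul, Polynomial.map_pow, map_C, map_X] at h2
  rw [coord, ← h2, AdjoinRoot.mk_eq_mk]
  refine ⟨(p /ₘ F).map ι, ?_⟩
  rw [← Polynomial.map_sub, ← Polynomial.map_mul]
  congr 1
  linear_combination -(modByMonic_add_div p F)

/-- Square roots of `1 - 4 ρ T`. -/
theorem exists_sqrt (hf : IsMonicCubic (F.map ι)) (ρ : O) : ∃ a r₁ r₂ : O,
    (1 + 2 * algebraMap K _ (ι (2 * ρ)) * coord (F.map ι) (ι a) (ι (-1 - 2 * ρ * r₁))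
      (ι (-(2 * ρ * r₂)))) ^ 2 =
    1 - 4 * algebraMap K _ (ι (2 * ρ)) * AdjoinRoot.root (F.map ι) := by
  have hinj := IsFractionRing.injective O K
  have hm : F.Monic := monic_of_injective hinj hf.monic
  have := hm.free_adjoinRoot
  have := hm.finite_adjoinRoot
  have : Module.Free ℤ_[2] (AdjoinRoot F) := Module.Free.trans (S := O)
  have : Module.Finite ℤ_[2] (AdjoinRoot F) := Module.Finite.trans O _
  obtain ⟨η, hη⟩ := exists_fixed_point (-AdjoinRoot.root F)
    (-(C (AdjoinRoot.of F ρ) * X ^ 2))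
  simp only [eval_neg, eval_mul, eval_C, eval_pow, eval_X] at hη
  obtain ⟨p, rfl⟩ := AdjoinRoot.mk_surjective η
  have hmk : ∀ q : O[X], AdjoinRoot.map ι F (F.map ι) dvd_rfl (AdjoinRoot.mk F q) =
      AdjoinRoot.mk (F.map ι) (q.map ι) := fun q => by
    rw [AdjoinRoot.map, AdjoinRoot.lift_mk, ← eval₂_map]
    exact AdjoinRoot.aeval_eq _
  have hη' := congrArg (AdjoinRoot.map ι F (F.map ι) dvd_rfl) hη
  obtain ⟨r₀, r₁, r₂, hr⟩ := exists_coord_of_integral hf (p ^ 2)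
  have e : AdjoinRoot.mk (F.map ι) (p.map ι) =
      coord (F.map ι) (ι (-(2 * ρ * r₀))) (ι (-1 - 2 * ρ * r₁)) (ι (-(2 * ρ * r₂))) := by
    rw [← hmk, hη]
    rw [← map_pow, map_add, map_neg, AdjoinRoot.map_root, map_mul, map_neg, map_mul, hmk,
      AdjoinRoot.map_of, hr, coord_eq, coord_eq]
    simp only [map_ofNat, map_mul, map_sub, map_neg, map_one, AdjoinRoot.algebraMap_eq]
    ring
  refine ⟨-(2 * ρ * r₀), r₁, r₂, ?_⟩
  rw [← e]
  rw [hmk, map_add, map_neg, AdjoinRoot.map_root, map_mul, map_neg, map_mul, map_pow, hmk,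
    AdjoinRoot.map_of, map_ofNat] at hη'
  rw [map_mul ι, map_ofNat, map_mul (algebraMap K _), map_ofNat, AdjoinRoot.algebraMap_eq]
  linear_combination 8 * AdjoinRoot.of (F.map ι) (ι ρ) * hη'

open scoped Classical in
theorem map_fil (hf : IsMonicCubic (F.map ι)) (j : ℕ) :
    (fil (K := K) F (j + 1)).map (nsmulAddMonoidHom 2) = fil F (j + 2) := by
  apply le_antisymm
  · rintro - ⟨P, hP, rfl⟩
    obtain ⟨ψ, h1, h2⟩ := exists_param_hom (K := K) hf (j + 1)
    have : ψ (⟨P, hP⟩ + ⟨P, hP⟩) = 0 := by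
      rw [map_add]
      ext i
      exact CharTwo.add_self_eq_zero _
    have h3 := (h2 _).1 this
    rw [nsmulAddMonoidHom_apply, two_nsmul]
    exact h3
  · intro Q hQ
    match Q, hQ with
    | .zero, _ => exact zero_mem _
    | .some x₀ y₀ h₀, ⟨τ, hτ⟩ =>
      have hinj := IsFractionRing.injective O K
      set t : O := 4 ^ (j + 2 + 1) * τ with ht
      have ht8 : t = 8 * (8 * 4 ^ j * τ) := by rw [ht]; ring
      obtain ⟨y', hy'⟩ := exists_sq_of_eight (8 * 4 ^ j * τ *
        (F.coeff 2 + F.coeff 1 * t + F.coeff 0 * t ^ 2))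
      set e : O := 1 + 2 * y' with he
      have hx0 : x₀ ≠ 0 := left_ne_zero_of_mul (hτ ▸ one_ne_zero)
      have hy := eval_eq_sq hf h₀
      rw [eval_map_eq hf] at hy
      have he0 : ι e ≠ 0 := map_ne_zero_of_ne (isUnit_one_add_two_mul y').ne_zero
      have he2 : 1 + F.coeff 2 * t + F.coeff 1 * t ^ 2 + F.coeff 0 * t ^ 3 = e ^ 2 := by
        rw [← hy', ht8]; ring
      have he2' : 1 + ι (F.coeff 2) * ι t + ι (F.coeff 1) * ι t ^ 2 + ι (F.coeff 0) * ι t ^ 3 =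
          ι e ^ 2 := by
        simpa only [map_add, map_mul, map_pow, map_one] using congrArg ι he2
      have htx : ι t = 1 / x₀ := by field_simp; linear_combination hτ
      set s : K := y₀ / (x₀ * ι e) with hs
      have hs2 : s ^ 2 = x₀ := by
        rw [htx] at he2'
        rw [hs]
        field_simp
        field_simp at he2'
        linear_combination -hy + he2'
      have hs0 : s ≠ 0 := by rintro h; rw [h] at hs2; exact hx0 (by rw [← hs2]; ring)
      obtain ⟨a, r₁, r₂, hr⟩ := exists_sqrt hf (2 * 4 ^ (j + 1) * τ)
      set ρ : O := 2 * (2 * 4 ^ (j + 1) * τ) with hρ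
      have htρ : t = 4 * ρ := by rw [ht, hρ]; ring
      set b : O := -1 - ρ * r₁ with hb
      set c : O := -(ρ * r₂) with hc
      have key : coord (F.map ι) (s * (1 + 2 * ι ρ * ι a)) (s * (2 * ι ρ * ι b))
          (s * (2 * ι ρ * ι c)) ^ 2 = AdjoinRoot.mk (F.map ι) (C x₀ - X) := by
        have e1 : coord (F.map ι) (s * (1 + 2 * ι ρ * ι a)) (s * (2 * ι ρ * ι b))
          (s * (2 * ι ρ * ι c)) = algebraMap K _ s *
            (1 + 2 * algebraMap K _ (ι ρ) * coord (F.map ι) (ι a) (ι b) (ι c)) := by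
          rw [coord_eq, coord_eq]
          simp only [map_mul, map_add, map_one, map_ofNat]
          ring
        have e2 : algebraMap K (AdjoinRoot (F.map ι)) x₀ * algebraMap K _ (ι t) = 1 := by
          rw [← map_mul, hτ, map_one]
        rw [e1, mul_pow, hr, ← map_pow, hs2, map_sub, AdjoinRoot.mk_C, AdjoinRoot.mk_X,
          ← AdjoinRoot.algebraMap_eq]
        rw [htρ, map_mul, map_ofNat, map_mul, map_ofNat] at e2
        linear_combination (-AdjoinRoot.root (F.map ι)) * e2
      obtain ⟨hw, x, y, h₁, hx, hPQ⟩ := exists_half hf h₀ key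
      have hρ0 : ι ρ ≠ 0 := fun h => hw (by rw [h]; ring)
      simp only [coeff_map] at hx
      have hx' : x * ι c = ι b - ι (F.coeff 2) * ι c :=
        mul_left_cancel₀ (mul_ne_zero hs0 (mul_ne_zero two_ne_zero hρ0))
          (by linear_combination hx)
      have hu := isUnit_one_add_two_mul ((2 * 4 ^ (j + 1) * τ) * (r₁ - F.coeff 2 * r₂))
      obtain ⟨v, hv⟩ := hu.exists_right_inv
      refine ⟨.some x y h₁, ⟨τ * r₂ * v, ?_⟩, ?_⟩
      · have hv' : (1 + ι ρ * (ι r₁ - ι (F.coeff 2) * ι r₂)) * ι v = 1 := by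
          have := congrArg ι hv
          rw [← mul_assoc, ← hρ] at this
          simpa only [map_add, map_mul, map_sub, map_one] using this
        have e3 : (4 : O) ^ (j + 1 + 1) * (τ * r₂ * v) = ρ * r₂ * v := by
          rw [hρ]; ring
        rw [e3, map_mul ι, map_mul ι]
        rw [hb, hc] at hx'
        simp only [map_sub ι, map_neg ι, map_mul ι ρ, map_one ι] at hx'
        linear_combination hv' - ι v * hx'
      · rw [nsmulAddMonoidHom_apply, two_nsmul]
        exact hPQ

end FiltrationIndex

section FiniteIndex

variable {O K : Type*} [CommRing O] [IsDomain O] [ValuationRing O] [Field K] [CharZero K]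
  [Algebra O K] [IsFractionRing O K] [Algebra ℤ_[2] O] [Module.Finite ℤ_[2] O]
  [Module.Free ℤ_[2] O]

local notation "ι" => algebraMap O K

variable {F : O[X]}

theorem exists_or_exists_mul (x : K) (q : O) (hq : q ≠ 0) :
    (∃ o, ι o = x * ι q) ∨ ∃ o, x * ι (q * o) = 1 := by
  have hq' := map_ne_zero_of_ne (K := K) hq
  rcases ValuationRing.isInteger_or_isInteger O (x * ι q) with ⟨o, ho⟩ | ⟨o, ho⟩
  · exact Or.inl ⟨o, ho⟩
  · by_cases hx : x = 0
    · exact Or.inl ⟨0, by rw [hx, map_zero, zero_mul]⟩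
    · refine Or.inr ⟨o, ?_⟩
      rw [map_mul, ho]
      field_simp

theorem exists_scaled (hf : IsMonicCubic (F.map ι)) {j : ℕ} {x y : K}
    {h : (cubicCurve (F.map ι)).toAffine.Nonsingular x y}
    (hP : (.some x y h : CurvePoint (F.map ι)) ∉ fil F j) :
    ∃ X Y : O, ι X = x * ι 2 ^ (2 * (j + 1)) ∧ ι Y = y * ι 2 ^ (3 * (j + 1)) := by
  have h2 := two_ne_zero_of_isFractionRing O K
  have h4 : (4 : O) ^ (j + 1) = 2 ^ (2 * (j + 1)) := by rw [pow_mul]; norm_num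
  rcases exists_or_exists_mul x ((2 : O) ^ (2 * (j + 1))) (pow_ne_zero _ h2) with
    ⟨X, hX⟩ | ⟨o, ho⟩
  · rw [map_pow] at hX
    have hy := eval_eq_sq hf h
    rw [eval_map_eq hf] at hy
    set p : O := 2 ^ (j + 1) with hp
    have hp2 : (2 : O) ^ (2 * (j + 1)) = p ^ 2 := by rw [hp]; ring
    obtain ⟨Y, hY⟩ := exists_of_sq (O := O) (z := y * ι 2 ^ (3 * (j + 1)))
      (c := X ^ 3 + F.coeff 2 * p ^ 2 * X ^ 2 + F.coeff 1 * p ^ 4 * X + F.coeff 0 * p ^ 6) (by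
        simp only [map_add, map_mul, map_pow, hX, hp]
        linear_combination -ι 2 ^ (6 * (j + 1)) * hy)
    exact ⟨X, Y, hX, hY⟩
  · refine absurd ⟨o, ?_⟩ hP
    rw [h4]
    exact ho

open scoped Classical in
theorem sub_mem_fil (hf : IsMonicCubic (F.map ι)) {j M : ℕ} {x y x' y' : K}
    {h : (cubicCurve (F.map ι)).toAffine.Nonsingular x y}
    {h' : (cubicCurve (F.map ι)).toAffine.Nonsingular x' y'} {X Y X' Y' : O}
    (hX : ι X = x * ι 2 ^ (2 * (j + 1))) (hY : ι Y = y * ι 2 ^ (3 * (j + 1)))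
    (hX' : ι X' = x' * ι 2 ^ (2 * (j + 1))) (hY' : ι Y' = y' * ι 2 ^ (3 * (j + 1)))
    (dX : (2 : O) ^ M ∣ X - X') (dY : (2 : O) ^ M ∣ Y - Y')
    (hM : ¬ (2 : O) ^ M ∣ 36 * (2 ^ (12 * (j + 1)) *
      cubicDisc (F.coeff 2) (F.coeff 1) (F.coeff 0))) :
    (.some x' y' h' - .some x y h : CurvePoint (F.map ι)) ∈ fil F j := by
  by_contra hR
  have hinj := IsFractionRing.injective O K
  obtain ⟨R, hRdef⟩ : ∃ R : CurvePoint (F.map ι), R = .some x' y' h' - .some x y h := ⟨_, rfl⟩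
  rw [← hRdef] at hR
  match R, hR, hRdef with
  | .zero, hR, _ => exact hR trivial
  | .some x₃ y₃ h₃, hR, hRdef =>
    obtain ⟨X₃, Y₃, hX₃, -⟩ := exists_scaled hf hR
    have hsum : (.some x y h + -.some x' y' h' + .some x₃ y₃ h₃ : CurvePoint (F.map ι)) = 0 := by
      rw [hRdef]; abel
    rw [WeierstrassCurve.Affine.Point.neg_some] at hsum
    obtain ⟨l, m, hl, e₁, e₂, -⟩ := exists_isLine hsum
    have hneg : (cubicCurve (F.map ι)).toAffine.negY x' y' = -y' := by
      simp [WeierstrassCurve.Affine.negY, cubicCurve]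
    rw [hneg] at e₂
    set p : O := 2 ^ (j + 1) with hp
    have hp1 : ι p = ι 2 ^ (j + 1) := by rw [hp, map_pow]
    rw [pow_mul', ← hp1] at hX hY hX' hY' hX₃
    obtain ⟨h1, h2, h3⟩ := hl
    simp only [coeff_map] at h1 h2 h3
    obtain ⟨L, hL⟩ := exists_of_sq (O := O) (z := l * ι p) (c := X + X' + X₃ + F.coeff 2 * p ^ 2)
      (by
        simp only [map_add, map_mul, map_pow, hX, hX', hX₃]
        linear_combination -ι p ^ 2 * h1)
    have k1 : Y + Y' = L * (X - X') := hinj (by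
      simp only [map_add, map_sub, map_mul, hX, hX', hY, hY', hL]
      linear_combination ι p ^ 3 * (e₁ - e₂))
    have hder : 3 * x ^ 2 + 2 * ι (F.coeff 2) * x + ι (F.coeff 1) - 2 * l * y =
        (x - x') * (x - x₃) := by
      linear_combination 2 * x * h1 - h2 - 2 * l * e₁
    have k2 : 3 * X ^ 2 + 2 * (F.coeff 2 * p ^ 2) * X + F.coeff 1 * p ^ 4 =
        2 * L * Y + (X - X') * (X - X₃) := hinj (by
      simp only [map_add, map_sub, map_mul, map_pow, map_ofNat, hX, hX', hX₃, hY, hL]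
      linear_combination ι p ^ 4 * hder)
    have hy := eval_eq_sq hf h
    rw [eval_map_eq hf] at hy
    have k3 : X ^ 3 + F.coeff 2 * p ^ 2 * X ^ 2 + F.coeff 1 * p ^ 4 * X + F.coeff 0 * p ^ 6 =
        Y ^ 2 := hinj (by
      simp only [map_add, map_mul, map_pow, hX, hY]
      linear_combination ι p ^ 6 * hy)
    have d1 : (2 : O) ^ M ∣ 2 * Y := by
      have : 2 * Y = L * (X - X') + (Y - Y') := by rw [← k1]; ring
      rw [this]
      exact dvd_add (dX.mul_left _) dY
    have d2 : (2 : O) ^ M ∣ 3 * X ^ 2 + 2 * (F.coeff 2 * p ^ 2) * X + F.coeff 1 * p ^ 4 := by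
      rw [k2]
      refine dvd_add ?_ (dX.mul_right _)
      rw [mul_right_comm]
      exact d1.mul_right _
    have d3 : (2 : O) ^ M ∣ 4 * Y ^ 2 := by
      rw [show 4 * Y ^ 2 = 2 * Y * (2 * Y) by ring]
      exact d1.mul_right _
    refine hM ?_
    have hb := cubicDisc_bezout (F.coeff 2 * p ^ 2) (F.coeff 1 * p ^ 4) (F.coeff 0 * p ^ 6) X
    have hsc : cubicDisc (F.coeff 2 * p ^ 2) (F.coeff 1 * p ^ 4) (F.coeff 0 * p ^ 6) =
        2 ^ (12 * (j + 1)) * cubicDisc (F.coeff 2) (F.coeff 1) (F.coeff 0) := by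
      rw [pow_mul', ← hp]; unfold cubicDisc; ring
    rw [← hsc, show (36 : O) = 4 * 9 by norm_num, mul_assoc, hb, k3, mul_add]
    refine dvd_add ((d2.mul_left _).mul_left _) ?_
    rw [mul_left_comm]
    exact d3.mul_left _

open scoped Classical in
theorem index_fil_ne_zero (hf : IsMonicCubic (F.map ι)) (j : ℕ) :
    (fil (K := K) F j).index ≠ 0 := by
  have hinj := IsFractionRing.injective O K
  have h2 := two_ne_zero_of_isFractionRing O K
  have hchar : ∀ n : ℕ, n ≠ 0 → (n : O) ≠ 0 := fun n hn h0 => by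
    have := congrArg ι h0
    rw [map_natCast, map_zero] at this
    exact hn (by exact_mod_cast this)
  obtain ⟨M, hM⟩ : ∃ M, ¬ (2 : O) ^ M ∣ 36 * (2 ^ (12 * (j + 1)) *
      cubicDisc (F.coeff 2) (F.coeff 1) (F.coeff 0)) := by
    by_contra! hcon
    have h0 := eq_zero_of_two_pow_dvd hcon
    have h36 : (36 : O) ≠ 0 := by exact_mod_cast hchar 36 (by norm_num)
    rcases mul_eq_zero.1 h0 with h0 | h0
    · exact h36 h0
    rcases mul_eq_zero.1 h0 with h0 | h0
    · exact pow_ne_zero _ h2 h0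
    · refine cubicDisc_ne_zero hf ?_
      have := congrArg ι h0
      simp only [coeff_map]
      rw [← map_zero ι, ← h0]
      simp only [cubicDisc, map_sub, map_add, map_mul, map_pow, map_ofNat]
  have := finite_quotient_two_pow O M
  have hex : ∀ P : CurvePoint (F.map ι), P ∉ fil F j → ∃ (X Y : O) (x y : K)
      (h : (cubicCurve (F.map ι)).toAffine.Nonsingular x y), P = .some x y h ∧
        ι X = x * ι 2 ^ (2 * (j + 1)) ∧ ι Y = y * ι 2 ^ (3 * (j + 1)) := fun P hP =>
    match P, hP with
    | .zero, hP => (hP trivial).elim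
    | .some x y h, hP => by
      obtain ⟨X, Y, hX, hY⟩ := exists_scaled hf hP
      exact ⟨X, Y, x, y, h, rfl, hX, hY⟩
  choose! X Y hXY using hex
  let Φ : CurvePoint (F.map ι) →
      Option ((O ⧸ Ideal.span {(2 : O) ^ M}) × (O ⧸ Ideal.span {(2 : O) ^ M})) := fun P =>
    if P ∈ fil F j then none else some (Ideal.Quotient.mk _ (X P), Ideal.Quotient.mk _ (Y P))
  have hΦ : ∀ P Q, Φ P = Φ Q → Q - P ∈ fil F j := by
    intro P Q hPQ
    simp only [Φ] at hPQ
    split_ifs at hPQ with hP hQ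
    · exact sub_mem hQ hP
    · simp only [Option.some.injEq, Prod.mk.injEq, Ideal.Quotient.eq,
        Ideal.mem_span_singleton] at hPQ
      obtain ⟨x, y, h, e, hX, hY⟩ := hXY P hP
      obtain ⟨x', y', h', e', hX', hY'⟩ := hXY Q ‹_›
      have := sub_mem_fil (h := h) (h' := h') hf hX hY hX' hY' hPQ.1 hPQ.2 hM
      rwa [← e, ← e'] at this
  have : Finite (CurvePoint (F.map ι) ⧸ fil (K := K) F j) := by
    refine Finite.of_injective (fun c => Φ (Quotient.out c)) fun c d hcd => ?_
    have h1 := hΦ _ _ hcd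
    rw [← QuotientAddGroup.out_eq' c, ← QuotientAddGroup.out_eq' d, QuotientAddGroup.eq,
      neg_add_eq_sub]
    exact h1
  rw [AddSubgroup.index]
  exact Nat.card_pos.ne'

open scoped Classical in
/-- The number of classes of `E(K)` modulo `2 E(K)`. -/
theorem card_range_kummerHom (hf : IsMonicCubic (F.map ι)) :
    Nat.card (kummerHom hf).range = 2 ^ Module.finrank ℤ_[2] O *
      Nat.card (nsmulAddMonoidHom 2 : CurvePoint (F.map ι) →+ CurvePoint (F.map ι)).ker := by
  have h1 : (kummerHom hf).ker =
      (nsmulAddMonoidHom 2 : CurvePoint (F.map ι) →+ CurvePoint (F.map ι)).range := by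
    ext P
    rw [AddMonoidHom.mem_ker, AddMonoidHom.mem_range]
    refine (kummerMap_eq_one_iff hf).trans ?_
    simp only [nsmulAddMonoidHom_apply, two_nsmul]
  rw [← AddSubgroup.index_ker, h1, index_addRange_eq _ (fil F 1) (index_fil_ne_zero hf 1),
    map_fil hf 0]
  · congr 1
    exact relIndex_fil hf 1
  · rw [eq_bot_iff]
    rintro P ⟨hP, hP'⟩
    match P, hP, hP' with
    | .zero, _, _ => exact rfl
    | .some x y h, hP, hP' =>
      have hy := y_ne_zero_of_mem hf hP
      have h2 : (.some x y h + .some x y h : CurvePoint (F.map ι)) = 0 := by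
        rw [← two_nsmul]
        exact hP'
      have h3 := eq_neg_of_add_eq_zero_left h2
      rw [WeierstrassCurve.Affine.Point.neg_some,
        WeierstrassCurve.Affine.Point.some.injEq] at h3
      refine absurd ?_ hy
      have h4 := h3.2
      simp only [WeierstrassCurve.Affine.negY, cubicCurve] at h4
      refine (mul_eq_zero.1 (show 2 * y = 0 from ?_)).resolve_left two_ne_zero
      linear_combination h4
  · rw [map_fil hf 0]
    exact fil_succ_le 1

end FiniteIndex

section Splitting

variable {K L : Type*} [Field K] [Field L] [Algebra K L] {f : K[X]} {e₁ e₂ e₃ : L}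

theorem SplitRoots.aeval_eq_zero (h : SplitRoots f e₁ e₂ e₃) (hf : IsMonicCubic f) (i : Fin 3) :
    aeval (![e₁, e₂, e₃] i) f = 0 := by
  have key : ∀ x : L, aeval x f = x ^ 3 + algebraMap K L (f.coeff 2) * x ^ 2 +
      algebraMap K L (f.coeff 1) * x + algebraMap K L (f.coeff 0) := fun x => by
    conv_lhs => rw [cubic_eq hf]
    simp
  rw [key, h.s1, h.s2, h.s3]
  fin_cases i <;> simp <;> ring

/-- The evaluation `K[T]/(f(T)) → L` at a root of `f`. -/
def SplitRoots.hom (h : SplitRoots f e₁ e₂ e₃) (hf : IsMonicCubic f) (i : Fin 3) :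
    AdjoinRoot f →ₐ[K] L :=
  AdjoinRoot.liftAlgHom f (Algebra.ofId K L) (![e₁, e₂, e₃] i) (h.aeval_eq_zero hf i)

variable (h : SplitRoots f e₁ e₂ e₃) (hf : IsMonicCubic f)

theorem SplitRoots.hom_mk (i : Fin 3) (p : K[X]) :
    h.hom hf i (AdjoinRoot.mk f p) = aeval (![e₁, e₂, e₃] i) p := by
  exact AdjoinRoot.liftAlgHom_mk ..

theorem SplitRoots.hom_root (i : Fin 3) :
    h.hom hf i (AdjoinRoot.root f) = ![e₁, e₂, e₃] i := by
  rw [← AdjoinRoot.mk_X, h.hom_mk, aeval_X]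

theorem SplitRoots.hom_coord (i : Fin 3) (u v w : K) :
    h.hom hf i (coord f u v w) = algebraMap K L u + algebraMap K L v * ![e₁, e₂, e₃] i +
      algebraMap K L w * ![e₁, e₂, e₃] i ^ 2 := by
  rw [coord, h.hom_mk]
  simp

theorem SplitRoots.eq_zero_of_forall (h : SplitRoots f e₁ e₂ e₃) {u v w : L}
    (H : ∀ i, u + v * ![e₁, e₂, e₃] i + w * ![e₁, e₂, e₃] i ^ 2 = 0) :
    u = 0 ∧ v = 0 ∧ w = 0 := by
  have h1 := H 0
  have h2 := H 1
  have h3 := H 2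
  simp only [Matrix.cons_val] at h1 h2 h3
  have h12 : v + w * (e₁ + e₂) = 0 :=
    mul_left_cancel₀ (sub_ne_zero.2 h.ne12) (by linear_combination h1 - h2)
  have h13 : v + w * (e₁ + e₃) = 0 :=
    mul_left_cancel₀ (sub_ne_zero.2 h.ne13) (by linear_combination h1 - h3)
  have hw : w = 0 :=
    mul_left_cancel₀ (sub_ne_zero.2 h.ne23) (by linear_combination h12 - h13)
  have hv : v = 0 := by linear_combination h12 - (e₁ + e₂) * hw
  exact ⟨by linear_combination h1 - e₁ * hv - e₁ ^ 2 * hw, hv, hw⟩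

theorem SplitRoots.hom_ext {a b : AdjoinRoot f} (H : ∀ i, h.hom hf i a = h.hom hf i b) :
    a = b := by
  obtain ⟨u, v, w, hc⟩ := exists_coord hf (a - b)
  obtain ⟨hu, hv, hw⟩ := h.eq_zero_of_forall (u := algebraMap K L u) (v := algebraMap K L v)
    (w := algebraMap K L w) fun i => by
      rw [← h.hom_coord hf, ← hc, map_sub, H, sub_self]
  rw [map_eq_zero] at hu hv hw
  rw [← sub_eq_zero, hc, hu, hv, hw, coord_eq]
  simp

theorem SplitRoots.injective (h : SplitRoots f e₁ e₂ e₃) :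
    Function.Injective ![e₁, e₂, e₃] := by
  intro i j hij
  have h1 := h.ne12
  have h2 := h.ne13
  have h3 := h.ne23
  fin_cases i <;> fin_cases j <;> simp_all

theorem SplitRoots.norm_eq (a : AdjoinRoot f) :
    algebraMap K L (Algebra.norm K a) = ∏ i, h.hom hf i a := by
  classical
  let b : Module.Basis (Fin 3) K (AdjoinRoot f) :=
    (AdjoinRoot.powerBasis' hf.monic).basis.reindex (finCongr hf.natDegree_eq)
  have hb : ∀ i, b i = AdjoinRoot.root f ^ (i : ℕ) := fun i => by
    simp only [b, Module.Basis.reindex_apply, PowerBasis.coe_basis]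
    rfl
  set V : Matrix (Fin 3) (Fin 3) L := Matrix.of fun k i => h.hom hf k (b i) with hV
  have hV' : V = Matrix.vandermonde ![e₁, e₂, e₃] := by
    ext k i
    rw [hV, Matrix.of_apply, hb, map_pow, h.hom_root, Matrix.vandermonde_apply]
  have hdet : V.det ≠ 0 := by
    rw [hV', Matrix.det_vandermonde_ne_zero_iff]
    exact h.injective
  have key : V * (Algebra.leftMulMatrix b a).map (algebraMap K L) =
      Matrix.diagonal (fun k => h.hom hf k a) * V := by
    ext k j
    rw [Matrix.diagonal_mul, Matrix.mul_apply, hV, Matrix.of_apply, ← map_mul,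
      ← b.sum_repr (a * b j), map_sum]
    refine Finset.sum_congr rfl fun i _ => ?_
    rw [map_smul, Matrix.map_apply, Algebra.leftMulMatrix_eq_repr_mul, Matrix.of_apply,
      Algebra.smul_def, mul_comm]
  have := congrArg Matrix.det key
  rw [Matrix.det_mul, Matrix.det_mul, Matrix.det_diagonal, mul_comm] at this
  rw [Algebra.norm_eq_matrix_det b, RingHom.map_det]
  exact mul_right_cancel₀ hdet this

theorem SplitRoots.norm_eq' (a : AdjoinRoot f) : algebraMap K L (Algebra.norm K a) =
    h.hom hf 0 a * h.hom hf 1 a * h.hom hf 2 a := by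
  rw [h.norm_eq hf, Fin.prod_univ_three]

theorem SplitRoots.isUnit_iff (h : SplitRoots f e₁ e₂ e₃) (hf : IsMonicCubic f)
    (a : AdjoinRoot f) : IsUnit a ↔ Algebra.norm K a ≠ 0 := by
  have := hf.monic.finite_adjoinRoot
  have := hf.monic.free_adjoinRoot
  refine ⟨fun ha => (ha.map (Algebra.norm K)).ne_zero, fun ha => ?_⟩
  have hb : Function.Injective (LinearMap.mulLeft K a) := by
    rw [← LinearMap.ker_eq_bot, LinearMap.ker_eq_bot']
    intro b hb
    refine h.hom_ext hf fun i => ?_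
    have hi : h.hom hf i a ≠ 0 := fun hi => ha <| by
      rw [← map_eq_zero (algebraMap K L), h.norm_eq hf]
      exact Finset.prod_eq_zero (Finset.mem_univ i) hi
    have := congrArg (h.hom hf i) hb
    rw [LinearMap.mulLeft_apply, map_mul, map_zero] at this
    rw [map_zero]
    exact (mul_eq_zero.1 this).resolve_left hi
  obtain ⟨b, hb⟩ := (LinearMap.injective_iff_surjective.1 hb) 1
  exact IsUnit.of_mul_eq_one b hb

end Splitting

section Reduced

variable {K : Type*} [Field K] [CharZero K] {f : K[X]}

theorem isReduced_adjoinRoot (hf : IsMonicCubic f) : IsReduced (AdjoinRoot f) := by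
  obtain ⟨e₁, e₂, e₃, h⟩ := exists_splitRoots hf
  refine ⟨fun a ⟨n, hn⟩ => h.hom_ext hf fun i => ?_⟩
  have := congrArg (h.hom hf i) hn
  rw [map_pow, map_zero] at this
  rw [map_zero]
  exact eq_zero_of_pow_eq_zero this

theorem isArtinianRing_adjoinRoot (hf : IsMonicCubic f) : IsArtinianRing (AdjoinRoot f) := by
  have := hf.monic.finite_adjoinRoot
  exact IsArtinianRing.of_finite K _

theorem norm_sub_root (hf : IsMonicCubic f) (x : K) :
    Algebra.norm K (AdjoinRoot.mk f (C x - X)) = f.eval x := by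
  obtain ⟨e₁, e₂, e₃, h⟩ := exists_splitRoots hf
  refine (algebraMap K (AlgebraicClosure K)).injective ?_
  rw [h.norm_eq' hf, h.hom_mk, h.hom_mk, h.hom_mk, hf.eval_eq]
  simp only [map_add, map_mul, map_pow, h.s1, h.s2, h.s3, map_sub, aeval_C, aeval_X,
    Matrix.cons_val]
  ring

theorem norm_algebraMap (hf : IsMonicCubic f) (x : K) :
    Algebra.norm K (algebraMap K (AdjoinRoot f) x) = x ^ 3 := by
  have := hf.monic.free_adjoinRoot
  rw [Algebra.norm_algebraMap, (AdjoinRoot.powerBasis' hf.monic).finrank,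
    AdjoinRoot.powerBasis'_dim, hf.natDegree_eq]

end Reduced

section IntegersA

variable {O K : Type*} [CommRing O] [IsDomain O] [ValuationRing O] [Field K] [CharZero K]
  [Algebra O K] [IsFractionRing O K]

local notation "ι" => algebraMap O K

variable {F : O[X]}

section Hom

variable {L : Type*} [Field L] [Algebra K L] [Algebra O L] [IsScalarTower O K L] {e₁ e₂ e₃ : L}
  (h : SplitRoots (F.map (algebraMap O K)) e₁ e₂ e₃)
  (hf : IsMonicCubic (F.map (algebraMap O K)))

theorem SplitRoots.isIntegral_hom {a : AdjoinRoot (F.map ι)} (ha : IsIntegral O a) (i : Fin 3) :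
    IsIntegral O (h.hom hf i a) :=
  ha.map ((h.hom hf i).restrictScalars O)

theorem SplitRoots.isIntegral_of_hom {a : AdjoinRoot (F.map ι)}
    (ha : ∀ i, IsIntegral O (h.hom hf i a)) : IsIntegral O a := by
  choose p hp hp' using ha
  refine ⟨∏ i, p i, monic_prod_of_monic _ _ fun i _ => hp i, ?_⟩
  refine h.hom_ext hf fun i => ?_
  have h1 : h.hom hf i (eval₂ (algebraMap O _) a (∏ i, p i)) =
      eval₂ (algebraMap O L) (h.hom hf i a) (∏ i, p i) := by
    rw [← aeval_def, ← aeval_def]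
    exact (aeval_algHom_apply ((h.hom hf i).restrictScalars O) a _).symm
  rw [h1, map_zero, eval₂_finsetProd]
  exact Finset.prod_eq_zero (Finset.mem_univ i) (hp' i)

theorem monic_of_map (hf : IsMonicCubic (F.map ι)) : F.Monic :=
  monic_of_injective (IsFractionRing.injective O K) hf.monic

theorem isIntegral_root (hf : IsMonicCubic (F.map ι)) :
    IsIntegral O (AdjoinRoot.root (F.map ι)) := by
  refine ⟨F, monic_of_map hf, ?_⟩
  rw [IsScalarTower.algebraMap_eq O K (AdjoinRoot (F.map ι)), ← eval₂_map]
  exact AdjoinRoot.eval₂_root _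

theorem exists_of_isIntegral_algebraMap {x : K} (hx : IsIntegral O (algebraMap K L x)) :
    ∃ o, ι o = x :=
  IsIntegrallyClosed.isIntegral_iff.1
    ((isIntegral_algHom_iff (IsScalarTower.toAlgHom O K L) (algebraMap K L).injective).1 hx)

/-- The discriminant multiplies the integral elements into `O[T]`. -/
theorem SplitRoots.exists_disc_mul (h : SplitRoots (F.map ι) e₁ e₂ e₃)
    (hf : IsMonicCubic (F.map ι)) {a : AdjoinRoot (F.map ι)} (ha : IsIntegral O a) :
    ∃ u v w : O, cubicDisc (F.coeff 2) (F.coeff 1) (F.coeff 0) • a =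
      coord (F.map ι) (ι u) (ι v) (ι w) := by
  obtain ⟨u, v, w, rfl⟩ := exists_coord hf a
  have hd := h.disc
  set D := cubicDisc (F.coeff 2) (F.coeff 1) (F.coeff 0) with hD
  have hD' : cubicDisc ((F.map ι).coeff 2) ((F.map ι).coeff 1) ((F.map ι).coeff 0) = ι D := by
    simp only [hD, cubicDisc, coeff_map, map_sub, map_add, map_mul, map_pow, map_ofNat]
  rw [hD'] at hd
  have hi := h.isIntegral_hom hf ha
  simp only [h.hom_coord] at hi
  have hr := h.isIntegral_hom hf (isIntegral_root hf)
  simp only [h.hom_root] at hr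
  have i1 := hi 0
  have i2 := hi 1
  have i3 := hi 2
  have r1 := hr 0
  have r2 := hr 1
  have r3 := hr 2
  simp only [Matrix.cons_val] at i1 i2 i3 r1 r2 r3
  have s := ((r1.sub r2).mul (r1.sub r3)).mul (r2.sub r3)
  have key : ∀ {x y : L}, IsIntegral O x → x = y → IsIntegral O y := fun hx e => e ▸ hx
  obtain ⟨w', hw⟩ := exists_of_isIntegral_algebraMap (O := O) (L := L) (x := ι D * w) (by
    rw [map_mul, hd]
    exact key (s.mul (((i1.mul (r2.sub r3)).sub (i2.mul (r1.sub r3))).add (i3.mul (r1.sub r2)))) (by ring))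
  obtain ⟨v', hv⟩ := exists_of_isIntegral_algebraMap (O := O) (L := L) (x := ι D * v) (by
    rw [map_mul, hd]
    exact key (s.mul (((i2.mul ((r1.sub r3).mul (r1.add r3))).sub
      (i1.mul ((r2.sub r3).mul (r2.add r3)))).sub (i3.mul ((r1.sub r2).mul (r1.add r2))))) (by ring))
  obtain ⟨u', hu⟩ := exists_of_isIntegral_algebraMap (O := O) (L := L) (x := ι D * u) (by
    rw [map_mul, hd]
    exact key (s.mul (((i1.mul ((r2.sub r3).mul (r2.mul r3))).sub
      (i2.mul ((r1.sub r3).mul (r1.mul r3)))).add (i3.mul ((r1.sub r2).mul (r1.mul r2))))) (by ring))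
  refine ⟨u', v', w', ?_⟩
  rw [hu, hv, hw, coord_eq, coord_eq, Algebra.smul_def, IsScalarTower.algebraMap_apply O K]
  simp only [map_mul]
  ring

end Hom

theorem isIntegral_norm (hf : IsMonicCubic (F.map ι)) {a : AdjoinRoot (F.map ι)}
    (ha : IsIntegral O a) : ∃ o, ι o = Algebra.norm K a := by
  obtain ⟨e₁, e₂, e₃, h⟩ := exists_splitRoots hf
  refine exists_of_isIntegral_algebraMap (L := AlgebraicClosure K) ?_
  rw [h.norm_eq hf]
  exact IsIntegral.prod _ fun i _ => h.isIntegral_hom hf ha i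

variable [Algebra ℤ_[2] O] [Module.Finite ℤ_[2] O] [Module.Free ℤ_[2] O] [Algebra ℤ_[2] K]
  [IsScalarTower ℤ_[2] O K]

/-- The inclusion `O[T]/(f(T)) → A_O`. -/
def ofCoord (hf : IsMonicCubic (F.map ι)) : (Fin 3 → O) →ₗ[O] integersA O (F.map ι) :=
  Fintype.linearCombination O fun i : Fin 3 =>
    (⟨AdjoinRoot.root (F.map ι) ^ (i : ℕ), (isIntegral_root hf).pow _⟩ : integersA O (F.map ι))

theorem ofCoord_coe (hf : IsMonicCubic (F.map ι)) (u : Fin 3 → O) :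
    (ofCoord hf u : AdjoinRoot (F.map ι)) = coord (F.map ι) (ι (u 0)) (ι (u 1)) (ι (u 2)) := by
  rw [ofCoord, Fintype.linearCombination_apply, Fin.sum_univ_three, coord_eq]
  have key : ∀ (o : O) (z : integersA O (F.map ι)),
      ((o • z : integersA O (F.map ι)) : AdjoinRoot (F.map ι)) =
        algebraMap K _ (ι o) * (z : AdjoinRoot (F.map ι)) := fun o z => by
    rw [← IsScalarTower.algebraMap_apply, ← Algebra.smul_def]
    rfl
  simp only [AddMemClass.coe_add, key]
  simp

theorem ofCoord_injective (hf : IsMonicCubic (F.map ι)) : Function.Injective (ofCoord hf) := by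
  intro u v huv
  have h1 := congrArg (fun z : integersA O (F.map ι) => (z : AdjoinRoot (F.map ι))) huv
  simp only [ofCoord_coe] at h1
  obtain ⟨h0, h1, h2⟩ := coord_injective hf h1
  have hinj := IsFractionRing.injective O K
  ext i
  fin_cases i
  · exact hinj h0
  · exact hinj h1
  · exact hinj h2

theorem exists_toCoord (hf : IsMonicCubic (F.map ι)) :
    ∃ Ψ : integersA O (F.map ι) →ₗ[O] (Fin 3 → O), Function.Injective Ψ := by
  obtain ⟨e₁, e₂, e₃, h⟩ := exists_splitRoots hf
  set D := cubicDisc (F.coeff 2) (F.coeff 1) (F.coeff 0) with hD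
  have hD0 : ι D ≠ 0 := by
    have := cubicDisc_ne_zero hf
    simp only [coeff_map] at this
    simpa only [hD, cubicDisc, map_sub, map_add, map_mul, map_pow, map_ofNat] using this
  let m : integersA O (F.map ι) →ₗ[O] integersA O (F.map ι) := LinearMap.lsmul O _ D
  have hm : ∀ a, m a ∈ LinearMap.range (ofCoord hf) := fun a => by
    obtain ⟨u, v, w, hc⟩ := h.exists_disc_mul hf a.2
    exact ⟨![u, v, w], Subtype.ext (by rw [ofCoord_coe]; exact hc.symm)⟩
  refine ⟨(LinearEquiv.ofInjective _ (ofCoord_injective hf)).symm.toLinearMap ∘ₗ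
    m.codRestrict _ hm, fun a b hab => ?_⟩
  replace hab := (LinearEquiv.ofInjective _ (ofCoord_injective hf)).symm.injective hab
  have h1 : D • (a : AdjoinRoot (F.map ι)) = D • (b : AdjoinRoot (F.map ι)) :=
    congrArg (fun z : LinearMap.range (ofCoord hf) =>
      ((z : integersA O (F.map ι)) : AdjoinRoot (F.map ι))) hab
  rw [← IsScalarTower.algebraMap_smul K D, ← IsScalarTower.algebraMap_smul K D] at h1
  exact Subtype.ext (smul_right_injective _ hD0 h1)

theorem finite_integersA (hf : IsMonicCubic (F.map ι)) :
    Module.Finite ℤ_[2] (integersA O (F.map ι)) := by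
  obtain ⟨Ψ, hΨ⟩ := exists_toCoord hf
  have : Module.Finite ℤ_[2] (Fin 3 → O) := inferInstance
  exact Module.Finite.of_injective (Ψ.restrictScalars ℤ_[2]) hΨ

theorem free_integersA (hf : IsMonicCubic (F.map ι)) :
    Module.Free ℤ_[2] (integersA O (F.map ι)) := by
  obtain ⟨Ψ, hΨ⟩ := exists_toCoord hf
  have := finite_integersA hf
  have : Module.IsTorsionFree ℤ_[2] (integersA O (F.map ι)) :=
    hΨ.moduleIsTorsionFree _ (fun r x => (Ψ.restrictScalars ℤ_[2]).map_smul r x)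
  exact Module.free_of_finite_type_torsion_free'

theorem finrank_integersA (hf : IsMonicCubic (F.map ι)) :
    Module.finrank ℤ_[2] (integersA O (F.map ι)) = 3 * Module.finrank ℤ_[2] O := by
  obtain ⟨Ψ, hΨ⟩ := exists_toCoord hf
  have := finite_integersA hf
  have h3 : Module.finrank ℤ_[2] (Fin 3 → O) = 3 * Module.finrank ℤ_[2] O := by
    rw [Module.finrank_pi_fintype]
    simp
  rw [← h3]
  exact le_antisymm
    (LinearMap.finrank_le_finrank_of_injective (f := Ψ.restrictScalars ℤ_[2]) hΨ)
    (LinearMap.finrank_le_finrank_of_injective (f := (ofCoord hf).restrictScalars ℤ_[2])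
      (ofCoord_injective hf))

end IntegersA

section Idempotents

variable {K : Type*} [Field K] [CharZero K] {f : K[X]}

open scoped Classical in
theorem add_self_eq_zero_iff {x y : K} {h : (cubicCurve f).toAffine.Nonsingular x y} :
    (.some x y h + .some x y h : CurvePoint f) = 0 ↔ y = 0 := by
  have hneg : (cubicCurve f).toAffine.negY x y = -y := by
    simp [WeierstrassCurve.Affine.negY, cubicCurve]
  rw [add_eq_zero_iff_eq_neg, WeierstrassCurve.Affine.Point.neg_some,
    WeierstrassCurve.Affine.Point.some.injEq, hneg]
  constructor
  · rintro ⟨-, h2⟩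
    refine (mul_eq_zero.1 (show 2 * y = 0 from ?_)).resolve_left two_ne_zero
    linear_combination h2
  · rintro rfl
    exact ⟨rfl, by rw [neg_zero]⟩

/-- The idempotent attached to a point of order two. -/
def pointIdem (f : K[X]) : CurvePoint f → AdjoinRoot f
  | .zero => 0
  | .some x _ _ => rootIdem f x

open scoped Classical in
/-- The points killed by two. -/
abbrev twoTorsion (f : K[X]) : AddSubgroup (CurvePoint f) := (nsmulAddMonoidHom 2).ker

open scoped Classical in
theorem mem_twoTorsion {x y : K} {h : (cubicCurve f).toAffine.Nonsingular x y} :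
    (.some x y h : CurvePoint f) ∈ twoTorsion f ↔ y = 0 := by
  rw [AddMonoidHom.mem_ker, nsmulAddMonoidHom_apply, two_nsmul, add_self_eq_zero_iff]

variable {L : Type*} [Field L] [Algebra K L] {e₁ e₂ e₃ : L}

theorem SplitRoots.hom_rootIdem_of_eq (h : SplitRoots f e₁ e₂ e₃) (hf : IsMonicCubic f) {c : K}
    (hc : f.eval c = 0) {i : Fin 3} (hi : ![e₁, e₂, e₃] i = algebraMap K L c) :
    h.hom hf i (rootIdem f c) = 1 := by
  rw [rootIdem, h.hom_mk, hi, aeval_algebraMap_apply, ← map_one (algebraMap K L)]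
  congr 1
  simp [inv_mul_cancel₀ (eval_cofactor_ne_zero hf hc)]

theorem SplitRoots.hom_rootIdem_of_ne (h : SplitRoots f e₁ e₂ e₃) (hf : IsMonicCubic f) {c : K}
    (hc : f.eval c = 0) {i : Fin 3} (hi : ![e₁, e₂, e₃] i ≠ algebraMap K L c) :
    h.hom hf i (rootIdem f c) = 0 := by
  have := congrArg (h.hom hf i) (rootIdem_mul hc X)
  rw [map_mul, map_mul, h.hom_mk, aeval_X, eval_X, AlgHom.commutes] at this
  refine (mul_eq_zero.1 (?_ : (![e₁, e₂, e₃] i - algebraMap K L c) * _ = 0)).resolve_left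
    (sub_ne_zero.2 hi)
  linear_combination this

theorem SplitRoots.exists_eq_rootIdem (h : SplitRoots f e₁ e₂ e₃) (hf : IsMonicCubic f)
    {a : AdjoinRoot f} {i : Fin 3} (ha : ∀ k, h.hom hf k a = if k = i then 1 else 0) :
    ∃ c, f.eval c = 0 ∧ a = rootIdem f c := by
  obtain ⟨u, v, w, hu⟩ := exists_coord hf a
  obtain ⟨u', v', w', hu'⟩ := exists_coord hf (AdjoinRoot.root f * a)
  obtain ⟨hu, hv, hw⟩ := h.eq_zero_of_forall
    (u := algebraMap K L u' - ![e₁, e₂, e₃] i * algebraMap K L u)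
    (v := algebraMap K L v' - ![e₁, e₂, e₃] i * algebraMap K L v)
    (w := algebraMap K L w' - ![e₁, e₂, e₃] i * algebraMap K L w) fun k => by
      have h1 := congrArg (h.hom hf k) hu
      have h2 := congrArg (h.hom hf k) hu'
      rw [map_mul, h.hom_root, h.hom_coord] at h2
      rw [h.hom_coord] at h1
      have h3 : ![e₁, e₂, e₃] k * h.hom hf k a = ![e₁, e₂, e₃] i * h.hom hf k a := by
        rw [ha]
        split_ifs with hki
        · rw [hki]
        · rw [mul_zero, mul_zero]
      linear_combination -h2 + h3 + ![e₁, e₂, e₃] i * h1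
  obtain ⟨c, hc⟩ : ∃ c : K, algebraMap K L c = ![e₁, e₂, e₃] i := by
    have aux : ∀ {p q : K}, p ≠ 0 → algebraMap K L q - ![e₁, e₂, e₃] i * algebraMap K L p = 0 →
        ∃ c : K, algebraMap K L c = ![e₁, e₂, e₃] i := fun {p q} hp hq => by
      refine ⟨q / p, ?_⟩
      have : algebraMap K L p ≠ 0 := (_root_.map_ne_zero _).2 hp
      rw [map_div₀]
      field_simp
      linear_combination hq
    by_cases h1 : u = 0
    · by_cases h2 : v = 0
      · by_cases h3 : w = 0
        · have := ha i
          rw [if_pos rfl, ‹a = _›, h1, h2, h3, h.hom_coord] at this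
          simp at this
        · exact aux h3 hw
      · exact aux h2 hv
    · exact aux h1 hu
  have hroot : f.eval c = 0 := by
    refine (algebraMap K L).injective ?_
    rw [map_zero, ← h.aeval_eq_zero hf i, ← hc, aeval_algebraMap_apply]
    rfl
  refine ⟨c, hroot, h.hom_ext hf fun k => ?_⟩
  rw [ha]
  split_ifs with hki
  · rw [h.hom_rootIdem_of_eq hf hroot (by rw [hki, hc])]
  · rw [h.hom_rootIdem_of_ne hf hroot]
    rw [hc]
    exact fun h' => hki (h.injective h')

theorem pointIdem_mul_self (hf : IsMonicCubic f) {P : CurvePoint f} (hP : P ∈ twoTorsion f) :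
    pointIdem f P * pointIdem f P = pointIdem f P := by
  match P, hP with
  | .zero, _ => exact mul_zero 0
  | .some x y h, hP =>
    obtain rfl := mem_twoTorsion.1 hP
    exact rootIdem_sq hf (by rw [eval_eq_sq hf h, zero_pow two_ne_zero])

theorem eval_of_mem_twoTorsion (hf : IsMonicCubic f) {x y : K}
    {h : (cubicCurve f).toAffine.Nonsingular x y}
    (hP : (.some x y h : CurvePoint f) ∈ twoTorsion f) : f.eval x = 0 := by
  obtain rfl := mem_twoTorsion.1 hP
  rw [eval_eq_sq hf h, zero_pow two_ne_zero]

theorem SplitRoots.hom_pointIdem (h : SplitRoots f e₁ e₂ e₃) (hf : IsMonicCubic f)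
    {P : CurvePoint f} (hP : P ∈ twoTorsion f) :
    ∃ i : Fin 3, ∀ k, k ≠ i → h.hom hf k (pointIdem f P) = 0 := by
  match P, hP with
  | .zero, _ => exact ⟨0, fun k _ => map_zero _⟩
  | .some x y hxy, hP =>
    have hx := eval_of_mem_twoTorsion hf hP
    by_cases hi : ∃ i : Fin 3, ![e₁, e₂, e₃] i = algebraMap K L x
    · obtain ⟨i, hi⟩ := hi
      refine ⟨i, fun k hk => h.hom_rootIdem_of_ne hf hx ?_⟩
      rw [← hi]
      exact fun h' => hk (h.injective h')
    · push Not at hi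
      exact ⟨0, fun k _ => h.hom_rootIdem_of_ne hf hx (hi k)⟩

theorem pointIdem_injOn (hf : IsMonicCubic f) :
    Set.InjOn (pointIdem f) (twoTorsion f : Set (CurvePoint f)) := by
  have hne : ∀ {x : K}, f.eval x = 0 → rootIdem f x ≠ 0 := fun {x} hx h0 => by
    rw [rootIdem, AdjoinRoot.mk_eq_zero] at h0
    have := eval_dvd (x := x) h0
    rw [hx, zero_dvd_iff] at this
    simp [inv_mul_cancel₀ (eval_cofactor_ne_zero hf hx)] at this
  intro P hP Q hQ hPQ
  match P, Q, hP, hQ with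
  | .zero, .zero, _, _ => rfl
  | .zero, .some x y hx, _, hQ => exact absurd hPQ.symm (hne (eval_of_mem_twoTorsion hf hQ))
  | .some x y hx, .zero, hP, _ => exact absurd hPQ (hne (eval_of_mem_twoTorsion hf hP))
  | .some x y hx, .some x' y' hx', hP, hQ =>
    have h1 := eval_of_mem_twoTorsion hf hP
    have h2 := eval_of_mem_twoTorsion hf hQ
    obtain rfl := mem_twoTorsion.1 hP
    obtain rfl := mem_twoTorsion.1 hQ
    have e1 := rootIdem_mul h1 X
    have e2 := rootIdem_mul h2 X
    change rootIdem f x = rootIdem f x' at hPQ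
    rw [← hPQ, e1, eval_X, eval_X] at e2
    have h3 : algebraMap K (AdjoinRoot f) (x - x') * rootIdem f x = 0 := by
      rw [map_sub]
      linear_combination e2
    by_cases hxx : x = x'
    · subst hxx
      rfl
    · refine absurd ?_ (hne h1)
      have : IsUnit (algebraMap K (AdjoinRoot f) (x - x')) :=
        (isUnit_iff_ne_zero.2 (sub_ne_zero.2 hxx)).map _
      exact (this.mul_right_eq_zero).1 h3

theorem exists_sign {x : Fin 3 → L} (hx : ∀ i, x i = 1 ∨ x i = -1) :
    ∃ s : ℤˣ, (∀ k, x k = (s : ℤ)) ∨ ∃ i, ∀ k, x k = (s : ℤ) * if k = i then -1 else 1 := by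
  rcases hx 0 with h0 | h0 <;> rcases hx 1 with h1 | h1 <;> rcases hx 2 with h2 | h2
  · exact ⟨1, Or.inl fun k => by fin_cases k <;> simp [h0, h1, h2]⟩
  · exact ⟨1, Or.inr ⟨2, fun k => by fin_cases k <;> simp [h0, h1, h2]⟩⟩
  · exact ⟨1, Or.inr ⟨1, fun k => by fin_cases k <;> simp [h0, h1, h2]⟩⟩
  · exact ⟨-1, Or.inr ⟨0, fun k => by fin_cases k <;> simp [h0, h1, h2]⟩⟩
  · exact ⟨1, Or.inr ⟨0, fun k => by fin_cases k <;> simp [h0, h1, h2]⟩⟩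
  · exact ⟨-1, Or.inr ⟨1, fun k => by fin_cases k <;> simp [h0, h1, h2]⟩⟩
  · exact ⟨-1, Or.inr ⟨2, fun k => by fin_cases k <;> simp [h0, h1, h2]⟩⟩
  · exact ⟨-1, Or.inl fun k => by fin_cases k <;> simp [h0, h1, h2]⟩

theorem card_square_eq_one (hf : IsMonicCubic f) :
    Nat.card {a : AdjoinRoot f // a ^ 2 = 1} = 2 * Nat.card (twoTorsion f) := by
  obtain ⟨e₁, e₂, e₃, h⟩ := exists_splitRoots hf
  have hs : ∀ s : ℤˣ, (((s : ℤ) : AdjoinRoot f)) ^ 2 = 1 := fun s => by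
    rcases Int.units_eq_one_or s with rfl | rfl <;> simp
  have h2 : ∀ {a b : AdjoinRoot f}, 2 * a = 2 * b → a = b := fun {a b} hab => by
    have hu : IsUnit (2 : AdjoinRoot f) := by
      rw [← map_ofNat (algebraMap K (AdjoinRoot f))]
      exact (isUnit_iff_ne_zero.2 two_ne_zero).map _
    exact hu.mul_left_cancel hab
  let Ψ : ℤˣ × twoTorsion f → {a : AdjoinRoot f // a ^ 2 = 1} := fun p =>
    ⟨((p.1 : ℤ) : AdjoinRoot f) * (1 - 2 * pointIdem f p.2), by
      rw [mul_pow, hs, one_mul]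
      linear_combination 4 * pointIdem_mul_self hf p.2.2⟩
  have hcomp : ∀ i (s : ℤˣ), h.hom hf i ((s : ℤ) : AdjoinRoot f) = (s : ℤ) := fun i s =>
    map_intCast _ _
  have hbij : Function.Bijective Ψ := by
    constructor
    · rintro ⟨s, P⟩ ⟨s', Q⟩ hPQ
      have h1 : ((s : ℤ) : AdjoinRoot f) * (1 - 2 * pointIdem f P) =
        ((s' : ℤ) : AdjoinRoot f) * (1 - 2 * pointIdem f Q) := congrArg Subtype.val hPQ
      obtain ⟨i, hi⟩ := h.hom_pointIdem hf P.2
      obtain ⟨j, hj⟩ := h.hom_pointIdem hf Q.2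
      obtain ⟨k, hki, hkj⟩ : ∃ k : Fin 3, k ≠ i ∧ k ≠ j := by
        clear hi hj
        revert i j
        decide
      have h3 := congrArg (h.hom hf k) h1
      rw [map_mul, map_mul, map_sub, map_sub, map_mul, map_mul, hi k hki, hj k hkj, hcomp,
        hcomp, mul_zero, sub_zero, map_one, mul_one, mul_one] at h3
      have hss : s = s' := Units.ext (by exact_mod_cast h3)
      subst hss
      have h4 : pointIdem f P = pointIdem f Q := by
        refine h2 ?_
        have h5 := congrArg (fun z => ((s : ℤ) : AdjoinRoot f) * z) h1
        simp only [← mul_assoc] at h5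
        rw [← pow_two, hs] at h5
        linear_combination -h5
      rw [Subtype.ext (pointIdem_injOn hf P.2 Q.2 h4)]
    · rintro ⟨a, ha⟩
      obtain ⟨s, hs1 | ⟨i, hi⟩⟩ := exists_sign (x := fun k => h.hom hf k a) fun k => by
        have := congrArg (h.hom hf k) ha
        rw [map_pow, map_one] at this
        exact mul_self_eq_one_iff.1 (by rw [← pow_two, this])
      · refine ⟨⟨s, 0⟩, Subtype.ext (h.hom_ext hf fun k => ?_)⟩
        rw [hs1 k]
        change h.hom hf k (((s : ℤ) : AdjoinRoot f) * (1 - 2 * 0)) = _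
        rw [mul_zero, sub_zero, mul_one, hcomp]
      · obtain ⟨c, hc, hc'⟩ := h.exists_eq_rootIdem hf (i := i)
          (a := algebraMap K _ (1 / 2) * (1 - ((s : ℤ) : AdjoinRoot f) * a)) fun k => by
            have h5 := congrArg (h.hom hf k) (hs s)
            rw [map_pow, hcomp, map_one] at h5
            rw [map_mul, AlgHom.commutes, map_sub, map_one, map_mul, hcomp, hi k, ← mul_assoc,
              ← pow_two, h5, map_div₀, map_one, map_ofNat]
            split_ifs <;> norm_num
        have hns := nonsingular_of_eval hf (x := c) (y := 0) (by rw [hc, zero_pow two_ne_zero])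
        refine ⟨⟨s, ⟨.some c 0 hns, mem_twoTorsion.2 rfl⟩⟩, Subtype.ext ?_⟩
        change ((s : ℤ) : AdjoinRoot f) * (1 - 2 * rootIdem f c) = a
        rw [← hc']
        have h6 : 2 * algebraMap K (AdjoinRoot f) (1 / 2) = 1 := by
          rw [← map_ofNat (algebraMap K (AdjoinRoot f)), ← map_mul, mul_one_div_cancel two_ne_zero,
            map_one]
        linear_combination (-((s : ℤ) : AdjoinRoot f) * (1 - ((s : ℤ) : AdjoinRoot f) * a)) * h6 +
          a * hs s
  rw [← Nat.card_congr (Equiv.ofBijective Ψ hbij), Nat.card_prod]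
  congr 1
  rw [Nat.card_eq_fintype_card]
  rfl

end Idempotents

section Count

variable {O K : Type*} [CommRing O] [IsDomain O] [ValuationRing O] [Field K] [CharZero K]
  [Algebra O K] [IsFractionRing O K] [Algebra ℤ_[2] O] [Module.Finite ℤ_[2] O]
  [Module.Free ℤ_[2] O] [Algebra ℤ_[2] K] [IsScalarTower ℤ_[2] O K]

local notation "ι" => algebraMap O K

variable {F : O[X]}

theorem card_ker_pow_integersA (hf : IsMonicCubic (F.map ι)) :
    Nat.card (powMonoidHom 2 : (integersA O (F.map ι))ˣ →* (integersA O (F.map ι))ˣ).ker =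
      2 * Nat.card (twoTorsion (F.map ι)) := by
  rw [← card_square_eq_one hf]
  refine Nat.card_congr (Equiv.ofBijective (fun u => ⟨((u : (integersA O (F.map ι))ˣ) :
    integersA O (F.map ι)), ?_⟩) ⟨?_, ?_⟩)
  · have h1 := congrArg (fun z : (integersA O (F.map ι))ˣ =>
      ((z : integersA O (F.map ι)) : AdjoinRoot (F.map ι))) (MonoidHom.mem_ker.1 u.2)
    simpa using h1
  · intro u v huv
    exact Subtype.ext (Units.ext (Subtype.ext (congrArg
      (fun z : {a : AdjoinRoot (F.map ι) // a ^ 2 = 1} => (z : AdjoinRoot (F.map ι))) huv)))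
  · rintro ⟨a, ha⟩
    let a' : integersA O (F.map ι) :=
      ⟨a, IsIntegral.of_pow (n := 2) two_pos (by rw [ha]; exact isIntegral_one)⟩
    have h1 : a' * a' = 1 := Subtype.ext ((pow_two a).symm.trans ha)
    refine ⟨⟨⟨a', a', h1, h1⟩, MonoidHom.mem_ker.2 (Units.ext ((pow_two a').trans h1))⟩, rfl⟩

theorem card_unitsModSquares_base (h2 : (2 : O) ≠ 0) : Nat.card (UnitsModSquares O) =
    2 ^ Module.finrank ℤ_[2] O * 2 := by
  rw [card_unitsModSquares]
  congr 1
  have hne : (1 : Oˣ) ≠ -1 := fun h => by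
    have h1 := congrArg (fun u : Oˣ => (u : O)) h
    simp only [Units.val_one, Units.val_neg] at h1
    exact h2 (by linear_combination h1)
  rw [Nat.card_eq_two_iff]
  refine ⟨1, ⟨-1, by simp⟩, fun h => hne (congrArg Subtype.val h), ?_⟩
  rw [Set.eq_univ_iff_forall]
  rintro ⟨u, hu⟩
  have h1 : (u : O) ^ 2 = 1 := by
    simpa using congrArg (fun z : Oˣ => (z : O)) (MonoidHom.mem_ker.1 hu)
  rcases mul_self_eq_one_iff.1 ((pow_two (u : O)).symm.trans h1) with h | h
  · exact Or.inl (Subtype.ext (Units.ext h))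
  · exact Or.inr (Subtype.ext (Units.ext h))

theorem index_squareNormUnits (hf : IsMonicCubic (F.map ι)) :
    (squareNormUnits O (F.map ι)).index = Nat.card (UnitsModSquares O) := by
  set ν : (integersA O (F.map ι))ˣ →* UnitsModSquares K := sqClass.comp
    ((Units.map (Algebra.norm K : AdjoinRoot (F.map ι) →* K)).comp
      (Units.map ((integersA O (F.map ι)).val : integersA O (F.map ι) →* AdjoinRoot (F.map ι))))
    with hν
  have h1 : squareNormUnits O (F.map ι) = ν.ker := by
    ext u
    rw [hν, MonoidHom.mem_ker, squareNormUnits, Subgroup.mem_comap]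
    exact (QuotientGroup.eq_one_iff _).symm
  set κ : UnitsModSquares O →* UnitsModSquares K := UnitsModSquares.map ι with hκ
  have hinj : Function.Injective κ := by
    rw [injective_iff_map_eq_one]
    intro c hc
    obtain ⟨u, rfl⟩ := sqClass_surjective c
    have hc' : sqClass (Units.map (ι : O →* K) u) = 1 := hc
    obtain ⟨z, hz⟩ := sqClass_eq_one_iff.1 hc'
    obtain ⟨o, ho⟩ := exists_of_sq (O := O) (z := z) (c := u) hz.symm
    refine sqClass_eq_one_iff.2 ⟨o, IsFractionRing.injective O K ?_⟩
    rw [map_pow, ho]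
    exact hz
  have hrange : ν.range = κ.range := by
    apply le_antisymm
    · rintro - ⟨u, rfl⟩
      obtain ⟨o, ho⟩ := isIntegral_norm hf (u : integersA O (F.map ι)).2
      obtain ⟨o', ho'⟩ := isIntegral_norm hf ((u⁻¹ : (integersA O (F.map ι))ˣ) :
        integersA O (F.map ι)).2
      have hoo : o * o' = 1 := by
        refine IsFractionRing.injective O K ?_
        rw [map_mul, ho, ho', ← map_mul, map_one, 
          ← map_one (Algebra.norm K : AdjoinRoot (F.map ι) →* K)]
        congr 1
        exact congrArg Subtype.val u.mul_inv
      refine ⟨sqClass ⟨o, o', hoo, by rw [mul_comm, hoo]⟩, ?_⟩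
      change sqClass _ = sqClass _
      congr 1
      exact Units.ext ho
    · rintro - ⟨c, rfl⟩
      obtain ⟨u, rfl⟩ := sqClass_surjective c
      refine ⟨Units.map (algebraMap O (integersA O (F.map ι))) u, ?_⟩
      change sqClass _ = sqClass _
      refine sqClass_eq_of_eq (h := Units.map (ι : O →* K) u) ?_
      change Algebra.norm K (algebraMap O (AdjoinRoot (F.map ι)) u) = ι u * ι u ^ 2
      rw [IsScalarTower.algebraMap_apply O K, norm_algebraMap hf]
      ring
  rw [h1, Subgroup.index_ker, hrange]
  exact (Nat.card_congr (MonoidHom.ofInjective hinj).toEquiv).symm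

theorem card_squareNormClasses (hf : IsMonicCubic (F.map ι)) :
    Nat.card (squareNormClasses O (F.map ι)) =
      2 ^ (2 * Module.finrank ℤ_[2] O) * Nat.card (twoTorsion (F.map ι)) := by
  have := finite_integersA hf
  have := free_integersA hf
  have h1 := Subgroup.card_mul_index (squareNormClasses O (F.map ι))
  have h2 : (squareNormClasses O (F.map ι)).index = (squareNormUnits O (F.map ι)).index := by
    refine Subgroup.index_map_eq _ sqClass_surjective ?_
    intro u hu
    obtain ⟨h, hh⟩ := sqClass_eq_one_iff.1 (MonoidHom.mem_ker.1 hu)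
    have hu' : IsUnit h := (isUnit_pow_iff two_ne_zero).1 (hh ▸ u.isUnit)
    have : u = hu'.unit * hu'.unit := Units.ext (by simp [hh, pow_two])
    rw [this]
    exact ⟨_, map_mul _ _ _⟩
  rw [h2, index_squareNormUnits hf, card_unitsModSquares_base (two_ne_zero_of_isFractionRing O K),
    card_unitsModSquares,
    card_ker_pow_integersA hf, finrank_integersA hf] at h1
  have hpos : 0 < 2 ^ Module.finrank ℤ_[2] O * 2 := by positivity
  refine Nat.eq_of_mul_eq_mul_right hpos (h1.trans ?_)
  ring

end Count

/-- `z` is a unit of the integral closure of `O`. -/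
def IsIntUnit (O : Type*) {B : Type*} [CommRing O] [CommRing B] [Algebra O B] (z : B) : Prop :=
  IsIntegral O z ∧ ∃ z', z * z' = 1 ∧ IsIntegral O z'

/-- The integral closure of `O` in `B` behaves like a valuation ring. -/
def IsValuative (O B : Type*) [CommRing O] [CommRing B] [Algebra O B] : Prop :=
  ∀ z : B, IsIntegral O z ∨ ∃ z', z * z' = 1 ∧ IsIntegral O z'

section IntUnit

variable {O B : Type*} [CommRing O] [CommRing B] [Algebra O B]

theorem IsIntUnit.mul {z w : B} (hz : IsIntUnit O z) (hw : IsIntUnit O w) :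
    IsIntUnit O (z * w) := by
  obtain ⟨hz, z', e, hz'⟩ := hz
  obtain ⟨hw, w', e', hw'⟩ := hw
  exact ⟨hz.mul hw, z' * w', by linear_combination w * w' * e + e', hz'.mul hw'⟩

theorem IsIntUnit.of_mul_eq {z w : B} (hz : IsIntegral O z) (hw : IsIntegral O w)
    (h : IsIntUnit O (z * w)) : IsIntUnit O z := by
  obtain ⟨-, z', e, hz'⟩ := h
  exact ⟨hz, w * z', by rw [← mul_assoc, e], hw.mul hz'⟩

theorem IsIntUnit.neg {z : B} (hz : IsIntUnit O z) : IsIntUnit O (-z) := by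
  obtain ⟨hz, z', e, hz'⟩ := hz
  exact ⟨hz.neg, -z', by rw [neg_mul_neg, e], hz'.neg⟩

theorem isIntUnit_algebraMap {o : O} (ho : IsUnit o) : IsIntUnit O (algebraMap O B o) := by
  obtain ⟨o', h⟩ := ho.exists_right_inv
  exact ⟨isIntegral_algebraMap, algebraMap O B o', by rw [← map_mul, h, map_one],
    isIntegral_algebraMap⟩

theorem IsIntUnit.add (hB : IsValuative O B) {z w : B} (hz : IsIntegral O z)
    (hw : IsIntegral O w) (h : IsIntUnit O (z + w)) (hz0 : z ≠ 0 → IsUnit z) :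
    IsIntUnit O z ∨ IsIntUnit O w := by
  obtain ⟨-, e', he, he'⟩ := h
  by_cases h0 : z = 0
  · exact Or.inr ⟨hw, e', by rw [← he, h0, zero_add], he'⟩
  obtain ⟨z', hz'⟩ := (hz0 h0).exists_right_inv
  rcases hB (w * z') with hs | ⟨s, hs, hsi⟩
  · exact Or.inl ⟨hz, (1 + w * z') * e', by linear_combination w * e' * hz' + he,
      (isIntegral_one.add hs).mul he'⟩
  · refine Or.inr ⟨hw, (1 + s) * e', ?_, (isIntegral_one.add hsi).mul he'⟩
    have h1 : w * s = z := by linear_combination z * hs - w * s * hz'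
    linear_combination e' * h1 + he

theorem isIntUnit_integersA {K : Type*} [Field K] [Algebra O K] {f : K[X]} {a : AdjoinRoot f}
    (ha : IsIntUnit O a) :
    ∃ u : (integersA O f)ˣ, ((u : integersA O f) : AdjoinRoot f) = a := by
  obtain ⟨ha, a', e, ha'⟩ := ha
  exact ⟨⟨⟨a, ha⟩, ⟨a', ha'⟩, Subtype.ext e, Subtype.ext ((mul_comm _ _).trans e)⟩, rfl⟩

end IntUnit

section Valuative

variable {O K : Type*} [CommRing O] [Field K] [Algebra ℚ_[2] K] [FiniteDimensional ℚ_[2] K]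
  [Algebra O K] [Algebra ℤ_[2] O] [Algebra ℤ_[2] K] [IsScalarTower ℤ_[2] O K]
  [IsScalarTower ℤ_[2] ℚ_[2] K]

theorem isValuative_of_isField {B : Type*} [CommRing B] (hB : IsField B) [Algebra K B]
    [Module.Finite K B] [Algebra O B] [IsScalarTower O K B] : IsValuative O B := by
  let : Field B := hB.toField
  let : Algebra ℚ_[2] B := Algebra.compHom B (algebraMap ℚ_[2] K)
  let : Algebra ℤ_[2] B := Algebra.compHom B (algebraMap ℤ_[2] K)
  have t1 : IsScalarTower ℚ_[2] K B := IsScalarTower.of_algebraMap_eq fun _ => rfl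
  have t2 : IsScalarTower ℤ_[2] K B := IsScalarTower.of_algebraMap_eq fun _ => rfl
  have t3 : IsScalarTower ℤ_[2] ℚ_[2] B := IsScalarTower.of_algebraMap_eq fun x => by
    rw [IsScalarTower.algebraMap_apply ℤ_[2] K B, IsScalarTower.algebraMap_apply ℤ_[2] ℚ_[2] K,
      ← IsScalarTower.algebraMap_apply ℚ_[2] K B]
  have t4 : IsScalarTower ℤ_[2] O B := IsScalarTower.of_algebraMap_eq fun x => by
    rw [IsScalarTower.algebraMap_apply ℤ_[2] K B, IsScalarTower.algebraMap_apply O K B,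
      ← IsScalarTower.algebraMap_apply ℤ_[2] O K]
  have : FiniteDimensional ℚ_[2] B := FiniteDimensional.trans ℚ_[2] K B
  intro z
  rcases ValuationRing.isInteger_or_isInteger (integralClosure ℤ_[2] B) z with ⟨o, ho⟩ | ⟨o, ho⟩
  · exact Or.inl (ho ▸ (o.2.tower_top : IsIntegral O (o : B)))
  · by_cases hz : z = 0
    · exact Or.inl (hz ▸ isIntegral_zero)
    · exact Or.inr ⟨z⁻¹, mul_inv_cancel₀ hz, ho ▸ (o.2.tower_top : IsIntegral O (o : B))⟩

end Valuative

section Components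

variable {O K : Type*} [CommRing O] [IsDomain O] [ValuationRing O] [Field K] [CharZero K]
  [Algebra O K] [IsFractionRing O K]

local notation "ι" => algebraMap O K

variable {F : O[X]}

theorem isIntegral_of_quotient (hf : IsMonicCubic (F.map ι)) {a : AdjoinRoot (F.map ι)}
    (ha : ∀ m : MaximalSpectrum (AdjoinRoot (F.map ι)),
      IsIntegral O (Ideal.Quotient.mk m.asIdeal a)) : IsIntegral O a := by
  obtain ⟨e₁, e₂, e₃, h⟩ := exists_splitRoots hf
  have := isArtinianRing_adjoinRoot hf
  refine h.isIntegral_of_hom hf fun i => ?_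
  have hp : (RingHom.ker (h.hom hf i)).IsPrime := RingHom.ker_isPrime _
  have hm : (RingHom.ker (h.hom hf i)).IsMaximal := IsArtinianRing.isMaximal_of_isPrime _
  exact (ha ⟨_, hm⟩).map (Ideal.Quotient.liftₐ (RingHom.ker (h.hom hf i))
    ((h.hom hf i).restrictScalars O) fun _ hx => hx)

theorem exists_of_quotient (hf : IsMonicCubic (F.map ι))
    (x : ∀ m : MaximalSpectrum (AdjoinRoot (F.map ι)), AdjoinRoot (F.map ι) ⧸ m.asIdeal) :
    ∃ a, ∀ m, Ideal.Quotient.mk m.asIdeal a = x m := by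
  have := isArtinianRing_adjoinRoot hf
  have := isReduced_adjoinRoot hf
  obtain ⟨a, ha⟩ := (IsArtinianRing.equivPi (AdjoinRoot (F.map ι))).surjective x
  exact ⟨a, fun m => by rw [← ha]; rfl⟩

theorem eq_of_quotient (hf : IsMonicCubic (F.map ι)) {a b : AdjoinRoot (F.map ι)}
    (h : ∀ m : MaximalSpectrum (AdjoinRoot (F.map ι)),
      Ideal.Quotient.mk m.asIdeal a = Ideal.Quotient.mk m.asIdeal b) : a = b := by
  have := isArtinianRing_adjoinRoot hf
  have := isReduced_adjoinRoot hf
  exact (IsArtinianRing.equivPi (AdjoinRoot (F.map ι))).injective (funext h)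

theorem exists_isIntUnit_mul_sq (hf : IsMonicCubic (F.map ι)) (a : AdjoinRoot (F.map ι))
    (H : ∀ m : MaximalSpectrum (AdjoinRoot (F.map ι)), ∃ v h : AdjoinRoot (F.map ι) ⧸ m.asIdeal,
      Ideal.Quotient.mk m.asIdeal a = v * h ^ 2 ∧ IsIntUnit O v) :
    ∃ u h : AdjoinRoot (F.map ι), a = u * h ^ 2 ∧ IsIntUnit O u := by
  choose v h e hv v' e' hv' using H
  obtain ⟨u, hu⟩ := exists_of_quotient hf v
  obtain ⟨u', hu'⟩ := exists_of_quotient hf v'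
  obtain ⟨b, hb⟩ := exists_of_quotient hf h
  refine ⟨u, b, eq_of_quotient hf fun m => ?_, isIntegral_of_quotient hf fun m => ?_, u',
    eq_of_quotient hf fun m => ?_, isIntegral_of_quotient hf fun m => ?_⟩
  · rw [map_mul, map_pow, hu, hb, e]
  · rw [hu]; exact hv m
  · rw [map_mul, hu, hu', e', map_one]
  · rw [hu']; exact hv' m

theorem isIntUnit_of_norm (hf : IsMonicCubic (F.map ι)) {a : AdjoinRoot (F.map ι)}
    (ha : IsIntegral O a) {o : O} (ho : IsUnit o) (hn : Algebra.norm K a = ι o) :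
    IsIntUnit O a := by
  obtain ⟨e₁, e₂, e₃, h⟩ := exists_splitRoots hf
  obtain ⟨o', hoo⟩ := ho.exists_right_inv
  have hu : IsUnit a := (h.isUnit_iff hf a).2 fun h0 => by
    have h1 : ι (o * o') = 0 := by rw [map_mul, ← hn, h0, zero_mul]
    rw [hoo, map_one] at h1
    exact one_ne_zero h1
  obtain ⟨a', haa⟩ := hu.exists_right_inv
  refine ⟨ha, a', haa, h.isIntegral_of_hom hf fun i => ?_⟩
  have hi := h.isIntegral_hom hf ha
  have e1 : algebraMap K (AlgebraicClosure K) (ι o) * algebraMap K (AlgebraicClosure K) (ι o') =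
      1 := by
    rw [← map_mul, ← map_mul, hoo, map_one, map_one]
  rw [← hn, h.norm_eq' hf] at e1
  have e2 := congrArg (h.hom hf i) haa
  rw [map_mul, map_one] at e2
  have ho' : IsIntegral O (algebraMap K (AlgebraicClosure K) (ι o')) := by
    rw [← IsScalarTower.algebraMap_apply]
    exact isIntegral_algebraMap
  have key : ∀ {x y : AlgebraicClosure K}, IsIntegral O x → x = y → IsIntegral O y :=
    fun hx e => e ▸ hx
  have aux : ∀ {p p' q r s : AlgebraicClosure K}, p * q * r * s = 1 → p * p' = 1 →
      q * r * s = p' := fun {p p' q r s} h1 h2 => by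
    linear_combination p' * h1 - q * r * s * h2
  obtain rfl | rfl | rfl : i = 0 ∨ i = 1 ∨ i = 2 := by fin_cases i <;> simp
  · exact key (((hi 1).mul (hi 2)).mul ho') (aux e1 e2)
  · exact key (((hi 0).mul (hi 2)).mul ho') (aux (by linear_combination e1) e2)
  · exact key (((hi 0).mul (hi 1)).mul ho') (aux (by linear_combination e1) e2)

theorem isValuative_quotient [Algebra ℚ_[2] K] [FiniteDimensional ℚ_[2] K] [Algebra ℤ_[2] O]
    [Algebra ℤ_[2] K] [IsScalarTower ℤ_[2] O K] [IsScalarTower ℤ_[2] ℚ_[2] K]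
    (hf : IsMonicCubic (F.map ι)) (m : MaximalSpectrum (AdjoinRoot (F.map ι))) :
    IsValuative O (AdjoinRoot (F.map ι) ⧸ m.asIdeal) := by
  have := hf.monic.finite_adjoinRoot
  have := m.isMaximal
  exact isValuative_of_isField (K := K)
    ((Ideal.Quotient.maximal_ideal_iff_isField_quotient _).1 m.isMaximal)

theorem isUnit_quotient {A : Type*} [CommRing A] (m : MaximalSpectrum A) {z : A ⧸ m.asIdeal}
    (hz : z ≠ 0) : IsUnit z := by
  obtain ⟨w, hw⟩ := ((Ideal.Quotient.maximal_ideal_iff_isField_quotient _).1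
    m.isMaximal).mul_inv_cancel hz
  exact IsUnit.of_mul_eq_one w hw

end Components

theorem mem_square_iff {B : Type*} [CommRing B] {u : Bˣ} :
    u ∈ Subgroup.square Bˣ ↔ ∃ h : B, (u : B) = h ^ 2 :=
  (QuotientGroup.eq_one_iff u).symm.trans sqClass_eq_one_iff

theorem IsIntUnit.symm {O B : Type*} [CommRing O] [CommRing B] [Algebra O B] {z z' : B}
    (e : z * z' = 1) (h : IsIntUnit O z) : IsIntUnit O z' := by
  obtain ⟨hz, w, e', hw⟩ := h
  have : w = z' := by linear_combination z' * e' - w * e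
  subst this
  exact ⟨hw, z, by rw [mul_comm, e], hz⟩

section Upper

variable {O K : Type*} [CommRing O] [IsDomain O] [ValuationRing O] [Field K] [CharZero K]
  [Algebra O K] [IsFractionRing O K] [Algebra ℤ_[2] O] [Module.Finite ℤ_[2] O]
  [Module.Free ℤ_[2] O]

local notation "ι" => algebraMap O K

variable {F : O[X]}

/-- The classes of square norm as a subgroup of `A_K^× / (A_K^×)²`. -/
abbrev unitClasses (O : Type*) [CommRing O] {K : Type*} [Field K] [Algebra O K] (f : K[X]) :
    Subgroup (UnitsModSquares (AdjoinRoot f)) :=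
  (squareNormClasses O f).map (inclusionA O f)

theorem kummerMap_mem_of_eq (hf : IsMonicCubic (F.map ι)) {x y : K}
    {h : (cubicCurve (F.map ι)).toAffine.Nonsingular x y} (hy : y ≠ 0)
    (H : ∃ u g : AdjoinRoot (F.map ι), AdjoinRoot.mk (F.map ι) (C x - X) = u * g ^ 2 ∧
      IsIntUnit O u) :
    kummerMap hf (.some x y h) ∈ unitClasses O (F.map ι) := by
  obtain ⟨u, g, e, hu⟩ := H
  obtain ⟨U, rfl⟩ := isIntUnit_integersA hu
  have hn := congrArg (Algebra.norm K) e
  rw [norm_sub_root hf, eval_eq_sq hf h, map_mul, map_pow] at hn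
  have hg : Algebra.norm K g ≠ 0 := by
    intro h0
    rw [h0] at hn
    exact hy (pow_eq_zero_iff two_ne_zero |>.1 (by rw [hn]; ring))
  refine ⟨sqClass U, ⟨U, ?_, rfl⟩, ?_⟩
  · refine mem_square_iff.2 ⟨y / Algebra.norm K g, ?_⟩
    change Algebra.norm K ((U : integersA O (F.map ι)) : AdjoinRoot (F.map ι)) = _
    field_simp
    rw [hn]
  · change sqClass _ = _
    symm
    refine (kummerMap_eq_iff hf _ _).2
      ⟨((U : integersA O (F.map ι)) : AdjoinRoot (F.map ι)) * g, ?_⟩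
    rw [kummerPoly_of_ne hy, e]
    change _ * ((U : integersA O (F.map ι)) : AdjoinRoot (F.map ι)) = _
    ring

open scoped Classical in
theorem kummerMap_mem_of_forall (hf : IsMonicCubic (F.map ι))
    {W : Subgroup (UnitsModSquares (AdjoinRoot (F.map ι)))}
    (H : ∀ (x y : K) (h : (cubicCurve (F.map ι)).toAffine.Nonsingular x y), y ≠ 0 →
      kummerMap hf (.some x y h) ∈ W) (P : CurvePoint (F.map ι)) : kummerMap hf P ∈ W := by
  match P with
  | .zero => exact kummerMap_zero hf ▸ one_mem _
  | .some x y h =>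
    by_cases hy : y = 0
    · obtain ⟨x₁, y₁, h₁, hy₁, -⟩ := exists_point_of_param hf 0 (one_ne_zero (α := O))
      obtain ⟨Q, hQ⟩ : ∃ Q : CurvePoint (F.map ι), Q = .some x y h + .some x₁ y₁ h₁ := ⟨_, rfl⟩
      have h2 : Q + Q ≠ 0 := by
        have : Q + Q = .some x₁ y₁ h₁ + .some x₁ y₁ h₁ +
            (.some x y h + .some x y h : CurvePoint (F.map ι)) := by rw [hQ]; abel
        rw [this, add_self_eq_zero_iff.2 hy, add_zero]
        exact fun h0 => hy₁ (add_self_eq_zero_iff.1 h0)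
      have hmem : kummerMap hf Q ∈ W := by
        match Q, h2 with
        | .zero, h2 => exact absurd (add_zero _) h2
        | .some x₂ y₂ h₂, h2 => exact H _ _ _ fun h0 => h2 (add_self_eq_zero_iff.2 h0)
      have hadd := (kummerHom hf).map_add (.some x y h) (.some x₁ y₁ h₁)
      rw [← hQ] at hadd
      have hadd' : kummerMap hf Q = kummerMap hf (.some x y h) * kummerMap hf (.some x₁ y₁ h₁) :=
        hadd
      rw [← mul_mem_cancel_right (H x₁ y₁ h₁ hy₁), ← hadd']
      exact hmem
    · exact H x y h hy

theorem isUnit_one_add_of_not {τ s : O} (hτ : ¬ IsUnit τ) : IsUnit (1 + τ * s) := by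
  by_contra h
  refine (IsLocalRing.nonunits_add (a := 1 + τ * s) (b := -(τ * s)) h ?_) ?_
  · exact fun h' => hτ (isUnit_of_mul_isUnit_left ((IsUnit.neg_iff _).1 h'))
  · rw [add_neg_cancel_right]
    exact isUnit_one

theorem exists_isIntUnit_of_not_integral (hf : IsMonicCubic (F.map ι)) {x y : K}
    (h : (cubicCurve (F.map ι)).toAffine.Nonsingular x y) {τ : O} (hx : x * ι τ = 1)
    (hτ : ¬ IsUnit τ) : ∃ u g : AdjoinRoot (F.map ι),
      AdjoinRoot.mk (F.map ι) (C x - X) = u * g ^ 2 ∧ IsIntUnit O u := by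
  set T := AdjoinRoot.root (F.map ι) with hT
  have hu := isUnit_one_add_of_not (s := F.coeff 2 + F.coeff 1 * τ + F.coeff 0 * τ ^ 2) hτ
  set e : O := 1 + τ * (F.coeff 2 + F.coeff 1 * τ + F.coeff 0 * τ ^ 2) with he
  obtain ⟨e', hee⟩ := hu.exists_right_inv
  have hev := eval_eq_sq hf h
  have he2 : y ^ 2 * ι τ ^ 3 = ι e := by
    rw [← hev, eval_map_eq hf, he]
    simp only [map_add, map_mul, map_pow, map_one]
    linear_combination (x ^ 2 * ι τ ^ 2 + x * ι τ + 1 + ι (F.coeff 2) * ι τ * (x * ι τ + 1) +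
      ι (F.coeff 1) * ι τ ^ 2) * hx
  have hv : IsIntUnit O (1 - algebraMap K _ (ι τ) * T) := by
    refine isIntUnit_of_norm hf ?_ hu ?_
    · refine isIntegral_one.sub (IsIntegral.mul ?_ (isIntegral_root hf))
      rw [← IsScalarTower.algebraMap_apply]
      exact isIntegral_algebraMap
    · have h1 : 1 - algebraMap K _ (ι τ) * T =
          algebraMap K _ (ι τ) * AdjoinRoot.mk (F.map ι) (C x - X) := by
        have := congrArg (algebraMap K (AdjoinRoot (F.map ι))) hx
        rw [map_mul, map_one] at this
        rw [map_sub, AdjoinRoot.mk_C, AdjoinRoot.mk_X, ← AdjoinRoot.algebraMap_eq]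
        linear_combination -this
      rw [h1, map_mul, norm_algebraMap hf, norm_sub_root hf, hev, ← he2]
      ring
  refine ⟨algebraMap K _ (ι e') * (1 - algebraMap K _ (ι τ) * T), algebraMap K _ (y * ι τ), ?_,
    IsIntUnit.mul ?_ hv⟩
  · have h2 : ι e' * (y * ι τ) ^ 2 = x := by
      have := congrArg ι hee
      rw [map_mul, map_one] at this
      linear_combination (ι e' * x) * he2 + x * this - ι e' * y ^ 2 * ι τ ^ 2 * hx
    have h3 : ι e' * (y * ι τ) ^ 2 * ι τ = 1 := by rw [h2, hx]
    have h2' := congrArg (algebraMap K (AdjoinRoot (F.map ι))) h2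
    have h3' := congrArg (algebraMap K (AdjoinRoot (F.map ι))) h3
    simp only [map_mul, map_pow, map_one] at h2' h3'
    rw [map_sub, AdjoinRoot.mk_C, AdjoinRoot.mk_X, ← AdjoinRoot.algebraMap_eq, map_mul]
    linear_combination -h2' + T * h3'
  · rw [← IsScalarTower.algebraMap_apply]
    exact isIntUnit_algebraMap (IsUnit.of_mul_eq_one e (by rw [mul_comm, hee]))

theorem integral_or_not_integral (x : K) :
    (∃ o, ι o = x) ∨ ∃ τ : O, x * ι τ = 1 ∧ ¬ IsUnit τ := by
  rcases exists_or_exists_mul x (1 : O) one_ne_zero with ⟨o, ho⟩ | ⟨o, ho⟩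
  · exact Or.inl ⟨o, by rw [ho, map_one, mul_one]⟩
  · rw [one_mul] at ho
    by_cases hu : IsUnit o
    · obtain ⟨o', hoo⟩ := hu.exists_right_inv
      refine Or.inl ⟨o', ?_⟩
      have := congrArg ι hoo
      rw [map_mul, map_one] at this
      linear_combination -ι o' * ho + x * this
    · exact Or.inr ⟨o, ho, hu⟩

theorem algebraMap_eq_algebraMap (o : O) :
    algebraMap K (AdjoinRoot (F.map ι)) (ι o) = algebraMap O _ o :=
  (IsScalarTower.algebraMap_apply O K _ o).symm

theorem root_cubic (hf : IsMonicCubic (F.map ι)) :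
    AdjoinRoot.root (F.map ι) ^ 3 + algebraMap O _ (F.coeff 2) * AdjoinRoot.root (F.map ι) ^ 2 +
      algebraMap O _ (F.coeff 1) * AdjoinRoot.root (F.map ι) + algebraMap O _ (F.coeff 0) = 0 := by
  have h1 := congrArg (AdjoinRoot.mk (F.map ι)) (cubic_eq hf)
  rw [AdjoinRoot.mk_self] at h1
  simp only [map_add, map_mul, map_pow, AdjoinRoot.mk_C, AdjoinRoot.mk_X, coeff_map] at h1
  exact h1.symm

theorem sub_root_mul (hf : IsMonicCubic (F.map ι)) {x y : O}
    (h : (F.map ι).eval (ι x) = ι y ^ 2) :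
    (algebraMap O _ x - AdjoinRoot.root (F.map ι)) * (AdjoinRoot.root (F.map ι) ^ 2 +
      algebraMap O _ (x + F.coeff 2) * AdjoinRoot.root (F.map ι) +
      algebraMap O _ (x ^ 2 + F.coeff 2 * x + F.coeff 1)) =
    algebraMap O (AdjoinRoot (F.map ι)) y ^ 2 := by
  rw [eval_map_eq hf] at h
  have hx := congrArg (algebraMap K (AdjoinRoot (F.map ι))) h
  simp only [map_add, map_mul, map_pow, algebraMap_eq_algebraMap] at hx ⊢
  linear_combination -root_cubic hf + hx

variable [Algebra ℚ_[2] K] [FiniteDimensional ℚ_[2] K] [Algebra ℤ_[2] K] [IsScalarTower ℤ_[2] O K]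
  [IsScalarTower ℤ_[2] ℚ_[2] K]

theorem exists_isIntUnit_of_isField (hf : IsMonicCubic (F.map ι))
    (hA : IsField (AdjoinRoot (F.map ι))) {x y : K}
    (h : (cubicCurve (F.map ι)).toAffine.Nonsingular x y) (hy : y ≠ 0) :
    ∃ u g : AdjoinRoot (F.map ι),
      AdjoinRoot.mk (F.map ι) (C x - X) = u * g ^ 2 ∧ IsIntUnit O u := by
  have := hf.monic.finite_adjoinRoot
  set a := AdjoinRoot.mk (F.map ι) (C x - X) with ha
  have hn : Algebra.norm K a = y ^ 2 := by rw [norm_sub_root hf, eval_eq_sq hf h]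
  obtain ⟨a', haa⟩ : ∃ a', a * a' = 1 := by
    have := (isUnit_kummerPoly hf (.some x y h)).exists_right_inv
    rwa [kummerPoly_of_ne hy] at this
  have hyy : algebraMap K (AdjoinRoot (F.map ι)) y * algebraMap K _ y⁻¹ = 1 := by
    rw [← map_mul, mul_inv_cancel₀ hy, map_one]
  have hnz : Algebra.norm K (a ^ 3 * algebraMap K _ y⁻¹ ^ 2) = 1 := by
    rw [map_mul, map_pow, map_pow, norm_algebraMap hf, hn]
    field_simp
  refine ⟨a ^ 3 * algebraMap K _ y⁻¹ ^ 2, algebraMap K _ y * a', ?_, ?_⟩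
  · linear_combination (-a ^ 3 * a' ^ 2 * (algebraMap K _ y * algebraMap K _ y⁻¹ + 1)) * hyy -
      a * (a * a' + 1) * haa
  · rcases isValuative_of_isField (O := O) (K := K) hA (a ^ 3 * algebraMap K _ y⁻¹ ^ 2) with
      hz | ⟨z', e, hz⟩
    · exact isIntUnit_of_norm hf hz isUnit_one (by rw [hnz, map_one])
    · have hnz' := congrArg (Algebra.norm K) e
      rw [map_mul, hnz, one_mul, map_one] at hnz'
      exact (isIntUnit_of_norm hf hz isUnit_one (by rw [hnz', map_one])).symm
        (by rw [mul_comm, e])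

theorem isUnit_deriv_or (hf : IsMonicCubic (F.map ι))
    (hA : Algebra.adjoin O {AdjoinRoot.root (F.map ι)} = integersA O (F.map ι)) {x y : O}
    (h : (F.map ι).eval (ι x) = ι y ^ 2) (hy : y ≠ 0) :
    IsUnit (3 * x ^ 2 + 2 * F.coeff 2 * x + F.coeff 1) ∨ IsUnit y := by
  set T := AdjoinRoot.root (F.map ι) with hT
  set d := 3 * x ^ 2 + 2 * F.coeff 2 * x + F.coeff 1 with hd
  by_contra! hcon
  obtain ⟨π, hπ, ⟨d', hd'⟩, ⟨y', hy'⟩⟩ : ∃ π : O, ¬ IsUnit π ∧ π ∣ d ∧ π ∣ y := by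
    rcases ValuationRing.dvd_total d y with h | h
    · exact ⟨d, hcon.1, dvd_rfl, h⟩
    · exact ⟨y, hcon.2, h, dvd_rfl⟩
  have hπ0 : ι π ≠ 0 := map_ne_zero_of_ne (by rintro rfl; exact hy (by rw [hy', zero_mul]))
  set q : AdjoinRoot (F.map ι) := T ^ 2 + algebraMap O _ (x + F.coeff 2) * T +
    algebraMap O _ (x ^ 2 + F.coeff 2 * x + F.coeff 1) with hq
  have e1 : (T - algebraMap O _ x) * q = -algebraMap O _ y ^ 2 := by
    linear_combination -sub_root_mul hf h
  have e2 : q = algebraMap O _ d +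
      (T - algebraMap O _ x) * (T + algebraMap O _ (2 * x + F.coeff 2)) := by
    rw [hq, hd]
    simp only [map_add, map_mul, map_pow, map_ofNat]
    ring
  have hπi : algebraMap O (AdjoinRoot (F.map ι)) π * algebraMap K _ (ι π)⁻¹ = 1 := by
    rw [← algebraMap_eq_algebraMap, ← map_mul, mul_inv_cancel₀ hπ0, map_one]
  set θ := algebraMap K _ (ι π)⁻¹ * q with hθ
  have hTi := isIntegral_root hf
  have hint : IsIntegral O θ := by
    let T' : integersA O (F.map ι) := ⟨T, hTi⟩
    have : IsIntegral (integersA O (F.map ι)) θ := by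
      refine isIntegral_of_quadratic (b := -algebraMap O _ d')
        (c := algebraMap O _ y' ^ 2 * (T' + algebraMap O _ (2 * x + F.coeff 2))) ?_
      change θ ^ 2 + (-algebraMap O _ d') * θ +
        algebraMap O _ y' ^ 2 * (T + algebraMap O _ (2 * x + F.coeff 2)) = 0
      have e3 := congrArg (algebraMap O (AdjoinRoot (F.map ι))) hd'
      have e4 := congrArg (algebraMap O (AdjoinRoot (F.map ι))) hy'
      rw [map_mul] at e3 e4
      set p := algebraMap O (AdjoinRoot (F.map ι)) π
      set p' := algebraMap K (AdjoinRoot (F.map ι)) (ι π)⁻¹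
      set r := T + algebraMap O _ (2 * x + F.coeff 2)
      set D' := algebraMap O (AdjoinRoot (F.map ι)) d'
      set Y' := algebraMap O (AdjoinRoot (F.map ι)) y'
      rw [hθ]
      have e5 : q ^ 2 = q * (p * D') - (p * Y') ^ 2 * r := by
        rw [← e3, ← e4]
        linear_combination q * e2 + r * e1
      linear_combination p' ^ 2 * e5 + (p' * q * D' - Y' ^ 2 * r * (p * p' + 1)) * hπi
    exact isIntegral_trans θ this
  have hmem : θ ∈ Algebra.adjoin O {T} := by rw [hA]; exact hint
  rw [Algebra.adjoin_singleton_eq_range_aeval] at hmem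
  obtain ⟨p, hp⟩ := hmem
  obtain ⟨u, v, w, hc⟩ := exists_coord_of_integral hf p
  have hp' : aeval T p = AdjoinRoot.mk (F.map ι) (p.map ι) := by
    rw [← AdjoinRoot.aeval_eq, aeval_map_algebraMap]
  have hθ' : θ = coord (F.map ι) ((ι π)⁻¹ * ι (x ^ 2 + F.coeff 2 * x + F.coeff 1))
      ((ι π)⁻¹ * ι (x + F.coeff 2)) (ι π)⁻¹ := by
    rw [hθ, hq, coord_eq, map_mul, map_mul, algebraMap_eq_algebraMap,
      algebraMap_eq_algebraMap]
    ring
  have hp'' : aeval T p = θ := hp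
  rw [hp', hc, hθ'] at hp''
  obtain ⟨-, -, h3⟩ := coord_injective hf hp''
  refine hπ (IsUnit.of_mul_eq_one w (IsFractionRing.injective O K ?_))
  rw [map_mul, h3, mul_inv_cancel₀ hπ0, map_one]

theorem exists_isIntUnit_of_adjoin (hf : IsMonicCubic (F.map ι))
    (hA : Algebra.adjoin O {AdjoinRoot.root (F.map ι)} = integersA O (F.map ι)) {x y : K}
    (h : (cubicCurve (F.map ι)).toAffine.Nonsingular x y) (hy : y ≠ 0) :
    ∃ u g : AdjoinRoot (F.map ι),
      AdjoinRoot.mk (F.map ι) (C x - X) = u * g ^ 2 ∧ IsIntUnit O u := by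
  rcases integral_or_not_integral (O := O) x with ⟨x, rfl⟩ | ⟨τ, hτ, hτ'⟩
  swap
  · exact exists_isIntUnit_of_not_integral hf h hτ hτ'
  have hev := eval_eq_sq hf h
  obtain ⟨y, rfl⟩ : ∃ o, ι o = y := by
    refine exists_of_sq (O := O) (c := x ^ 3 + F.coeff 2 * x ^ 2 + F.coeff 1 * x + F.coeff 0) ?_
    rw [← hev, eval_map_eq hf]
    simp only [map_add, map_mul, map_pow]
  set T := AdjoinRoot.root (F.map ι) with hT
  have ea : AdjoinRoot.mk (F.map ι) (C (ι x) - X) = algebraMap O _ x - T := by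
    rw [map_sub, AdjoinRoot.mk_C, AdjoinRoot.mk_X, ← AdjoinRoot.algebraMap_eq,
      ← IsScalarTower.algebraMap_apply]
  have hTi := isIntegral_root hf
  have hai : IsIntegral O (algebraMap O _ x - T) := isIntegral_algebraMap.sub hTi
  have hy0 : y ≠ 0 := by rintro rfl; exact hy (map_zero _)
  rcases isUnit_deriv_or hf hA hev hy0 with hu | hu
  swap
  · refine ⟨_, 1, by rw [one_pow, mul_one], ?_⟩
    refine isIntUnit_of_norm hf (by rw [ea]; exact hai) (hu.pow 2) ?_
    rw [norm_sub_root hf, hev, map_pow]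
  set d := 3 * x ^ 2 + 2 * F.coeff 2 * x + F.coeff 1 with hd
  set q : AdjoinRoot (F.map ι) := T ^ 2 + algebraMap O _ (x + F.coeff 2) * T +
    algebraMap O _ (x ^ 2 + F.coeff 2 * x + F.coeff 1) with hq
  have e1 : (algebraMap O _ x - T) * q = algebraMap O _ y ^ 2 := sub_root_mul hf hev
  have e2 : algebraMap O _ d =
      q + (algebraMap O _ x - T) * (T + algebraMap O _ (2 * x + F.coeff 2)) := by
    rw [hq, hd]
    simp only [map_add, map_mul, map_pow, map_ofNat]
    ring
  have hri : IsIntegral O (T + algebraMap O _ (2 * x + F.coeff 2)) :=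
    hTi.add isIntegral_algebraMap
  have hqi : IsIntegral O q :=
    ((hTi.pow 2).add (isIntegral_algebraMap.mul hTi)).add isIntegral_algebraMap
  rw [ea]
  refine exists_isIntUnit_mul_sq hf _ fun m => ?_
  let φ := Ideal.Quotient.mkₐ O m.asIdeal
  have hφ : ∀ {z}, IsIntegral O z → IsIntegral O (Ideal.Quotient.mk m.asIdeal z) :=
    fun hz => hz.map φ
  have e1' := congrArg (Ideal.Quotient.mk m.asIdeal) e1
  have e2' := congrArg (Ideal.Quotient.mk m.asIdeal) e2
  rw [map_mul, map_pow] at e1'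
  rw [map_add (Ideal.Quotient.mk m.asIdeal), map_mul (Ideal.Quotient.mk m.asIdeal)] at e2'
  have hdu : IsIntUnit O (Ideal.Quotient.mk m.asIdeal (algebraMap O _ d)) :=
    isIntUnit_algebraMap hu
  rw [e2'] at hdu
  rcases hdu.add (isValuative_quotient hf m) (hφ hqi) ((hφ hai).mul (hφ hri))
    (fun h => isUnit_quotient m h) with ⟨-, q', hqq, hq'⟩ | hX
  · refine ⟨q', Ideal.Quotient.mk m.asIdeal (algebraMap O _ y), ?_,
      ⟨hq', _, by rw [mul_comm]; exact hqq, hφ hqi⟩⟩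
    linear_combination q' * e1' - (Ideal.Quotient.mk m.asIdeal) (algebraMap O _ x - T) * hqq
  · exact ⟨_, 1, by rw [one_pow, mul_one], hX.of_mul_eq (hφ hai) (hφ hri)⟩

end Upper

section Residue

variable (R : Type*) [CommRing R] [Algebra ℤ_[2] R] [Module.Finite ℤ_[2] R] [Module.Free ℤ_[2] R]
  [IsLocalRing R]

theorem two_mem_maximalIdeal : (2 : R) ∈ IsLocalRing.maximalIdeal R := by
  intro h2
  obtain ⟨v, hv⟩ := h2.exists_right_inv
  refine one_ne_zero (α := R) (eq_zero_of_two_pow_dvd fun n => ⟨v ^ n, ?_⟩)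
  rw [← mul_pow, hv, one_pow]

variable {R} in
theorem mem_radical_two {x : R} (hx : x ∈ IsLocalRing.maximalIdeal R) :
    x ∈ (Ideal.span {(2 : R)}).radical := by
  have : Finite (R ⧸ Ideal.span {(2 : R)}) := by
    simpa using finite_quotient_two_pow R 1
  obtain ⟨i, j, hij, h⟩ := Finite.exists_ne_map_eq_of_infinite
    (fun n : ℕ => Ideal.Quotient.mk (Ideal.span {(2 : R)}) (x ^ n))
  have aux : ∀ i j : ℕ, i < j → Ideal.Quotient.mk (Ideal.span {(2 : R)}) (x ^ i) =
      Ideal.Quotient.mk (Ideal.span {(2 : R)}) (x ^ j) →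
      x ∈ (Ideal.span {(2 : R)}).radical := by
    intro i j hij h
    rw [Ideal.Quotient.eq] at h
    refine ⟨i, ?_⟩
    have hu : IsUnit (1 - x ^ (j - i)) := by
      by_contra hn
      have h1 : x ^ (j - i) ∈ IsLocalRing.maximalIdeal R :=
        Ideal.pow_mem_of_mem _ hx _ (Nat.sub_pos_of_lt hij)
      have := Ideal.add_mem _ ((IsLocalRing.mem_maximalIdeal _).2 hn) h1
      rw [sub_add_cancel] at this
      exact (IsLocalRing.mem_maximalIdeal _).1 this isUnit_one
    obtain ⟨v, hv⟩ := hu.exists_right_inv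
    have e : x ^ i = (x ^ i - x ^ j) * v := by
      have : x ^ j = x ^ i * x ^ (j - i) := by rw [← pow_add, Nat.add_sub_cancel' hij.le]
      rw [this]
      linear_combination -x ^ i * hv
    rw [e]
    exact Ideal.mul_mem_right _ _ h
  rcases lt_or_gt_of_ne hij with h' | h'
  · exact aux i j h' h
  · exact aux j i h' h.symm

theorem charP_residueField : CharP (IsLocalRing.ResidueField R) 2 := by
  refine CharTwo.of_one_ne_zero_of_two_eq_zero one_ne_zero ?_
  rw [← map_ofNat (IsLocalRing.residue R), IsLocalRing.residue_eq_zero_iff]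
  exact two_mem_maximalIdeal R

theorem finite_residueField : Finite (IsLocalRing.ResidueField R) := by
  have : Finite (R ⧸ Ideal.span {(2 : R)}) := by
    simpa using finite_quotient_two_pow R 1
  refine Finite.of_surjective (Ideal.Quotient.lift (Ideal.span {(2 : R)}) (IsLocalRing.residue R)
    fun a ha => ?_) (Ideal.Quotient.lift_surjective_of_surjective _ _
      IsLocalRing.residue_surjective)
  rw [IsLocalRing.residue_eq_zero_iff]
  exact (Ideal.span_singleton_le_iff_mem _).2 (two_mem_maximalIdeal R) ha

variable {R} in
theorem exists_sub_sq_mem (a : R) : ∃ b : R, a - b ^ 2 ∈ IsLocalRing.maximalIdeal R := by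
  have := charP_residueField R
  have := finite_residueField R
  obtain ⟨c, hc⟩ := FiniteField.isSquare_of_char_two
    (ringChar.eq_iff.2 inferInstance) (IsLocalRing.residue R a)
  obtain ⟨b, rfl⟩ := IsLocalRing.residue_surjective c
  refine ⟨b, (IsLocalRing.residue_eq_zero_iff _).1 ?_⟩
  rw [map_sub, map_pow, hc, pow_two, sub_self]

/-- The map `x ↦ x² + x` on the residue field. -/
theorem exists_artinSchreier : ∃ H : AddSubgroup (IsLocalRing.ResidueField R), H.index = 2 ∧
    ∀ a : R, IsLocalRing.residue R a ∈ H ↔ ∃ θ, θ ^ 2 + θ = a := by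
  have := charP_residueField R
  have := finite_residueField R
  let w : IsLocalRing.ResidueField R →+ IsLocalRing.ResidueField R :=
    AddMonoidHom.mk' (fun x => x ^ 2 + x) fun x y => by
      rw [CharTwo.add_sq]; abel
  refine ⟨w.range, ?_, fun a => ⟨?_, ?_⟩⟩
  · have h1 : Nat.card w.ker = 2 := by
      rw [Nat.card_eq_two_iff]
      refine ⟨0, ⟨1, ?_⟩, fun h => zero_ne_one (congrArg Subtype.val h), ?_⟩
      · change (1 : IsLocalRing.ResidueField R) ^ 2 + 1 = 0
        rw [one_pow, CharTwo.add_self_eq_zero]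
      · rw [Set.eq_univ_iff_forall]
        rintro ⟨x, hx⟩
        have hx' : x * (x + 1) = 0 := by
          have : x ^ 2 + x = 0 := hx
          linear_combination this
        rcases mul_eq_zero.1 hx' with h | h
        · exact Or.inl (Subtype.ext h)
        · exact Or.inr (Subtype.ext (CharTwo.add_eq_zero.1 h))
    have h2 := AddSubgroup.card_mul_index w.range
    have h3 := AddSubgroup.card_mul_index w.ker
    rw [AddSubgroup.index_ker, h1] at h3
    rw [← h3, mul_comm 2] at h2
    exact Nat.eq_of_mul_eq_mul_left Nat.card_pos h2
  · rintro ⟨x, hx⟩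
    obtain ⟨η, rfl⟩ := IsLocalRing.residue_surjective x
    have hm : a - (η ^ 2 + η) ∈ IsLocalRing.maximalIdeal R := by
      rw [← IsLocalRing.residue_eq_zero_iff, map_sub, ← hx, map_add, map_pow]
      exact sub_self _
    obtain ⟨n, hn⟩ := mem_radical_two hm
    exact exists_sq_add_self ⟨n, Ideal.mem_span_singleton.1 hn⟩
  · rintro ⟨θ, rfl⟩
    exact ⟨IsLocalRing.residue R θ, by rw [map_add, map_pow]; rfl⟩

theorem exists_not_artinSchreier : ∃ d : R, ∀ θ, θ ^ 2 + θ ≠ d := by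
  obtain ⟨H, hH, h⟩ := exists_artinSchreier R
  by_contra! hcon
  have : H = ⊤ := by
    rw [eq_top_iff]
    intro x _
    obtain ⟨a, rfl⟩ := IsLocalRing.residue_surjective x
    exact (h a).2 (hcon a)
  rw [this, AddSubgroup.index_top] at hH
  omega

variable {R} in
theorem artinSchreier_or (a b : R) : (∃ θ, θ ^ 2 + θ = a) ∨ (∃ θ, θ ^ 2 + θ = b) ∨
    ∃ θ, θ ^ 2 + θ = a + b + 4 * a * b := by
  obtain ⟨H, hH, h⟩ := exists_artinSchreier R
  have h2 := two_mem_maximalIdeal R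
  rw [← IsLocalRing.residue_eq_zero_iff] at h2
  have e : IsLocalRing.residue R (a + b + 4 * a * b) =
      IsLocalRing.residue R a + IsLocalRing.residue R b := by
    rw [show a + b + 4 * a * b = a + b + 2 * (2 * a * b) by ring, map_add, map_add, map_mul, h2,
      zero_mul, add_zero]
  rw [← h, ← h, ← h, e, AddSubgroup.add_mem_iff_of_index_two hH]
  tauto

end Residue

section Image

variable {K : Type*} [Field K] [CharZero K] {f : K[X]}

open scoped Classical in
/-- The image of the Kummer map. -/
def kummerImage (hf : IsMonicCubic f) : Subgroup (UnitsModSquares (AdjoinRoot f)) :=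
  AddSubgroup.toSubgroup' (kummerHom hf).range

open scoped Classical in
theorem coe_kummerImage (hf : IsMonicCubic f) :
    (kummerImage hf : Set (UnitsModSquares (AdjoinRoot f))) = Set.range (kummerMap hf) := by
  ext c
  exact Iff.rfl

theorem mem_kummerImage {hf : IsMonicCubic f} {c : UnitsModSquares (AdjoinRoot f)} :
    c ∈ kummerImage hf ↔ ∃ P, kummerMap hf P = c := Iff.rfl

open scoped Classical in
theorem card_kummerImage (hf : IsMonicCubic f) :
    Nat.card (kummerImage hf) = Nat.card (kummerHom hf).range := rfl

end Image

section Four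

variable {O K : Type*} [CommRing O] [IsDomain O] [ValuationRing O] [Field K] [CharZero K]
  [Algebra O K] [IsFractionRing O K] [Algebra ℤ_[2] O] [Module.Finite ℤ_[2] O]
  [Module.Free ℤ_[2] O] [Algebra ℤ_[2] K] [IsScalarTower ℤ_[2] O K]

local notation "ι" => algebraMap O K

variable {F : O[X]}

/-- The class of `T` in the ring of integers. -/
def rootInt (hf : IsMonicCubic (F.map (algebraMap O K))) :
    integersA O (F.map (algebraMap O K)) :=
  ⟨AdjoinRoot.root _, isIntegral_root hf⟩

theorem exists_kummerMap_eq (hf : IsMonicCubic (F.map ι)) (σ : O) :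
    ∃ (P : CurvePoint (F.map ι)) (w : integersA O (F.map ι)) (U : (integersA O (F.map ι))ˣ),
      (U : integersA O (F.map ι)) =
        1 + 4 * ((algebraMap O _ (F.coeff 2) + rootInt hf) * algebraMap O _ σ ^ 2 + 2 * w) ∧
      kummerMap hf P = inclusionA O _ (sqClass U) := by
  by_cases hσ : σ = 0
  · refine ⟨0, 0, 1, ?_, by rw [kummerMap_zero, map_one, map_one]⟩
    rw [hσ, map_zero, Units.val_one]
    ring
  have := finite_integersA hf
  have := free_integersA hf
  obtain ⟨x, y, h, hy, ⟨τ, hτ⟩, hp⟩ := exists_point_of_param hf 0 hσ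
  obtain ⟨-, ζ, hζ, e1⟩ := exists_param hf h hτ
  have hx0 : x ≠ 0 := left_ne_zero_of_mul (hτ ▸ one_ne_zero)
  obtain rfl : σ = ζ :=
    hp.unique (show IsParam O 0 (.some x y h : CurvePoint (F.map ι)) ζ from ⟨hx0, hζ⟩)
  set t : O := 4 ^ (0 + 1) * τ with ht
  set e : O := 1 + F.coeff 2 * t + F.coeff 1 * t ^ 2 + F.coeff 0 * t ^ 3 with he
  have ht' : t = 4 * (σ ^ 2 * e) := by rw [ht, e1]; ring
  set k : O := σ ^ 2 * e * (F.coeff 2 + F.coeff 1 * t + F.coeff 0 * t ^ 2) with hk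
  have hek : e = 1 + 4 * k := by
    rw [hk]
    linear_combination he + (F.coeff 2 + F.coeff 1 * t + F.coeff 0 * t ^ 2) * ht'
  let r : O →+* integersA O (F.map ι) := algebraMap O _
  set T := rootInt hf with hT
  let w : integersA O (F.map ι) := r (2 * σ ^ 2 * k * F.coeff 2 +
    2 * σ ^ 4 * e ^ 2 * (F.coeff 1 + F.coeff 0 * t)) - r (σ ^ 2 * (1 + 4 * k + 8 * k ^ 2)) * T
  let W : integersA O (F.map ι) := 1 + 4 * ((r (F.coeff 2) + T) * r σ ^ 2 + 2 * w)
  have hW : W = r e * (1 - r t * T) := by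
    have hek' : r e = 1 + 4 * r k := by
      simpa only [map_add, map_mul, map_one, map_ofNat] using congrArg r hek
    have ht'' : r t = 4 * (r σ ^ 2 * r e) := by
      simpa only [map_mul, map_pow, map_ofNat] using congrArg r ht'
    have hk' : r k = r σ ^ 2 * r e * (r (F.coeff 2) + r (F.coeff 1) * r t +
        r (F.coeff 0) * r t ^ 2) := by
      simpa only [map_add, map_mul, map_pow] using congrArg r hk
    simp only [W, w]
    simp only [map_add, map_mul, map_pow, map_one, map_ofNat]
    linear_combination (-1 - 4 * r σ ^ 2 * r (F.coeff 2) + 4 * r σ ^ 2 * T *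
      (r e + 1 + 4 * r k)) * hek' - 4 * hk' + (r e * T - 4 * r σ ^ 2 * r e *
      (r (F.coeff 1) + r (F.coeff 0) * r t)) * ht''
  have hWu : IsUnit W := by
    have := isUnit_one_add_two_mul (2 * ((r (F.coeff 2) + T) * r σ ^ 2 + 2 * w))
    convert this using 1
    simp only [W]
    ring
  refine ⟨.some x y h, w, hWu.unit, rfl, ?_⟩
  change _ = sqClass _
  refine (kummerMap_eq_iff hf _ _).2 ⟨algebraMap K _ (2 * ι σ * x) * (W : AdjoinRoot (F.map ι)), ?_⟩
  rw [kummerPoly_of_ne hy]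
  change _ * (W : AdjoinRoot (F.map ι)) = _
  suffices hmk : AdjoinRoot.mk (F.map ι) (C x - X) =
      algebraMap K _ (2 * ι σ * x) ^ 2 * (W : AdjoinRoot (F.map ι)) by
    rw [hmk]
    ring
  have hW' : (W : AdjoinRoot (F.map ι)) =
      algebraMap K _ (ι e) * (1 - algebraMap K _ (ι t) * AdjoinRoot.root (F.map ι)) :=
    congrArg Subtype.val hW
  have e2 : (2 * ι σ * x) ^ 2 * ι e = x := by
    have := congrArg ι ht'
    simp only [map_mul, map_pow, map_ofNat] at this
    linear_combination x * hτ - x ^ 2 * this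
  have e3 := congrArg (algebraMap K (AdjoinRoot (F.map ι))) e2
  have e4 := congrArg (algebraMap K (AdjoinRoot (F.map ι))) hτ
  rw [map_mul, map_pow] at e3
  rw [map_mul, map_one] at e4
  rw [hW', map_sub, AdjoinRoot.mk_C, AdjoinRoot.mk_X, ← AdjoinRoot.algebraMap_eq]
  linear_combination AdjoinRoot.root (F.map ι) * e4 -
    (1 - algebraMap K _ (ι t) * AdjoinRoot.root (F.map ι)) * e3

theorem sqClass_mem_of_radical (hf : IsMonicCubic (F.map ι)) (U : (integersA O (F.map ι))ˣ)
    {g : integersA O (F.map ι)} (hU : (U : integersA O (F.map ι)) = 1 + 4 * g)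
    (η : integersA O (F.map ι)) (σ : O)
    (h : g - (η ^ 2 + η) - (algebraMap O _ (F.coeff 2) + rootInt hf) * algebraMap O _ σ ^ 2 ∈
      (Ideal.span {(2 : integersA O (F.map ι))}).radical) :
    inclusionA O _ (sqClass U) ∈ kummerImage hf := by
  have := finite_integersA hf
  have := free_integersA hf
  obtain ⟨P, w, V, hV, hP⟩ := exists_kummerMap_eq hf σ
  set v := (algebraMap O (integersA O (F.map ι)) (F.coeff 2) + rootInt hf) * algebraMap O _ σ ^ 2
  have h2 : ∀ z, 2 * z ∈ (Ideal.span {(2 : integersA O (F.map ι))}).radical := fun z =>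
    Ideal.le_radical (Ideal.mul_mem_right _ _ (Ideal.mem_span_singleton_self _))
  have h3 : g + (v + 2 * w) + 4 * g * (v + 2 * w) - (η ^ 2 + η) ∈
      (Ideal.span {(2 : integersA O (F.map ι))}).radical := by
    convert Ideal.add_mem _ h (h2 (v + w + 2 * g * (v + 2 * w))) using 1
    ring
  obtain ⟨n, hn⟩ := h3
  obtain ⟨θ, hθ⟩ := exists_sq_add_self ⟨n, Ideal.mem_span_singleton.1 hn⟩
  have hUV : sqClass U = sqClass V := by
    refine sqClass_eq_iff.2 ⟨1 + 2 * θ, ?_⟩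
    rw [hU, hV]
    linear_combination -4 * hθ
  exact mem_kummerImage.2 ⟨P, by rw [hP, hUV]⟩

theorem sqClass_mem_of_unitsFour (hf : IsMonicCubic (F.map ι))
    (H : ∀ (U : (integersA O (F.map ι))ˣ) (g : integersA O (F.map ι)),
      (U : integersA O (F.map ι)) = 1 + 4 * g → U ∈ squareNormUnits O (F.map ι) →
      inclusionA O _ (sqClass U) ∈ kummerImage hf)
    {u : (integersA O (F.map ι))ˣ} (hu : u ∈ unitsFour O (F.map ι)) :
    inclusionA O _ (sqClass u) ∈ kummerImage hf := by
  have := finite_integersA hf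
  have := free_integersA hf
  obtain ⟨⟨b, hb⟩, hn⟩ := hu
  obtain ⟨c, hc⟩ := Ideal.mem_span_singleton.1 hb
  have hb' : IsUnit b := by
    have h1 : IsUnit (1 + 2 * (-2 * c * (u⁻¹ : (integersA O (F.map ι))ˣ) :
        integersA O (F.map ι))) := isUnit_one_add_two_mul _
    have h2 : b * (b * (u⁻¹ : (integersA O (F.map ι))ˣ)) =
        1 + 2 * (-2 * c * (u⁻¹ : (integersA O (F.map ι))ˣ) : integersA O (F.map ι)) := by
      have := u.mul_inv
      linear_combination this - ((u⁻¹ : (integersA O (F.map ι))ˣ) : integersA O (F.map ι)) * hc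
    exact isUnit_of_mul_isUnit_left (h2 ▸ h1)
  obtain ⟨β, rfl⟩ := hb'
  have hcl : sqClass u = sqClass (u * (β⁻¹) ^ 2) :=
    (sqClass_eq_of_eq (h := β⁻¹) (by push_cast; ring)).symm
  rw [hcl]
  refine H _ (c * ((β⁻¹ : (integersA O (F.map ι))ˣ) : integersA O (F.map ι)) ^ 2) ?_ ?_
  · push_cast
    have := β.mul_inv
    linear_combination ((β⁻¹ : (integersA O (F.map ι))ˣ) : integersA O (F.map ι)) ^ 2 * hc +
      ((β : integersA O (F.map ι)) * ((β⁻¹ : (integersA O (F.map ι))ˣ) :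
        integersA O (F.map ι)) + 1) * this
  · refine mul_mem hn ?_
    rw [squareNormUnits, Subgroup.mem_comap, map_pow, pow_two]
    exact ⟨_, rfl⟩

theorem exists_norm_eq_sq {f : K[X]} {U : (integersA O f)ˣ} (hU : U ∈ squareNormUnits O f) :
    ∃ h, Algebra.norm K ((U : integersA O f) : AdjoinRoot f) = h ^ 2 :=
  mem_square_iff.1 hU

/-- If `1 + 4 c` is a square in `K`, then `c = θ² + θ`. -/
theorem exists_artinSchreier_of_sq {c : O} {h : K} (hc : ι (1 + 4 * c) = h ^ 2) :
    ∃ θ : O, θ ^ 2 + θ = c := by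
  obtain ⟨θ, hθ⟩ := exists_of_quadratic (O := O) (z := (h - 1) / 2) (b := 1) (c := -c) (by
    simp only [map_add, map_mul, map_one, map_ofNat, map_neg] at hc ⊢
    linear_combination -hc / 4)
  refine ⟨θ, IsFractionRing.injective O K ?_⟩
  simp only [map_add, map_mul, map_one, map_ofNat] at hc
  rw [map_add, map_pow, hθ]
  linear_combination -hc / 4

variable [Algebra ℚ_[2] K] [FiniteDimensional ℚ_[2] K] [IsScalarTower ℤ_[2] ℚ_[2] K]

theorem isLocalRing_integersA {f : K[X]} (hf : IsMonicCubic f)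
    (hA : IsField (AdjoinRoot f)) : IsLocalRing (integersA O f) := by
  have := hf.monic.finite_adjoinRoot
  have : Nontrivial (AdjoinRoot f) := hA.nontrivial
  have hv := isValuative_of_isField (O := O) (K := K) hA
  refine IsLocalRing.of_isUnit_or_isUnit_of_isUnit_add fun a b hab => ?_
  have key : ∀ z : integersA O f, IsIntUnit O (z : AdjoinRoot f) → IsUnit z := fun z hz => by
    obtain ⟨u, hu⟩ := isIntUnit_integersA hz
    exact ⟨u, Subtype.ext hu⟩
  have hab' : IsIntUnit O ((a : AdjoinRoot f) + b) := by
    obtain ⟨c, hc⟩ := hab.exists_right_inv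
    exact ⟨(a + b).2, c, congrArg Subtype.val hc, c.2⟩
  rcases hab'.add hv a.2 b.2 (fun h => by
    obtain ⟨c, hc⟩ := hA.mul_inv_cancel h
    exact IsUnit.of_mul_eq_one c hc) with h | h
  · exact Or.inl (key a h)
  · exact Or.inr (key b h)

theorem sqClass_mem_of_isField (hf : IsMonicCubic (F.map ι))
    (hA : IsField (AdjoinRoot (F.map ι))) (U : (integersA O (F.map ι))ˣ)
    {g : integersA O (F.map ι)} (hU : (U : integersA O (F.map ι)) = 1 + 4 * g)
    (hn : U ∈ squareNormUnits O (F.map ι)) : inclusionA O _ (sqClass U) ∈ kummerImage hf := by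
  have := finite_integersA hf
  have := free_integersA hf
  have := isLocalRing_integersA (O := O) hf hA
  obtain ⟨d, hd⟩ := exists_not_artinSchreier O
  have hsq : ∀ h : K, ι (1 + 4 * d) ≠ h ^ 2 := by
    intro h hh
    obtain ⟨θ, hθ⟩ := exists_artinSchreier_of_sq hh
    exact hd θ hθ
  have hd0 : ι (1 + 4 * d) ≠ 0 := fun h => hsq 0 (by rw [h]; ring)
  have hnd : ∀ w : AdjoinRoot (F.map ι), algebraMap K _ (ι (1 + 4 * d)) ≠ w ^ 2 := by
    intro w hw
    have := congrArg (Algebra.norm K) hw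
    rw [norm_algebraMap hf, map_pow] at this
    refine hsq (Algebra.norm K w / ι (1 + 4 * d)) ?_
    field_simp
    linear_combination this
  have h4 : algebraMap K _ (ι (1 + 4 * d)) =
      1 + 4 * ((algebraMap O (integersA O (F.map ι)) d : integersA O (F.map ι)) :
        AdjoinRoot (F.map ι)) := by
    rw [algebraMap_eq_algebraMap, map_add, map_one, map_mul, map_ofNat]
    rfl
  have hU' := congrArg (fun z : integersA O (F.map ι) => (z : AdjoinRoot (F.map ι))) hU
  rcases artinSchreier_or g (algebraMap O _ d) with ⟨θ, hθ⟩ | ⟨θ, hθ⟩ | ⟨θ, hθ⟩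
  · have : sqClass U = 1 := sqClass_eq_one_iff.2 ⟨1 + 2 * θ, by
      rw [hU]
      linear_combination -4 * hθ⟩
    rw [this, map_one]
    exact one_mem _
  · refine absurd ?_ (hnd (1 + 2 * θ))
    have hθ' := congrArg (fun z : integersA O (F.map ι) => (z : AdjoinRoot (F.map ι))) hθ
    simp only [AddMemClass.coe_add, SubmonoidClass.coe_pow] at hθ'
    rw [h4]
    linear_combination -4 * hθ'
  · exfalso
    obtain ⟨h, hh⟩ := exists_norm_eq_sq hn
    have e1 : (U : integersA O (F.map ι)) * (1 + 4 * algebraMap O _ d) = (1 + 2 * θ) ^ 2 := by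
      rw [hU]
      linear_combination -4 * hθ
    have e2 := congrArg (fun z : integersA O (F.map ι) => Algebra.norm K (z : AdjoinRoot (F.map ι)))
      e1
    have e3 : (((1 + 4 * algebraMap O _ d : integersA O (F.map ι)) : integersA O (F.map ι)) :
        AdjoinRoot (F.map ι)) = algebraMap K _ (ι (1 + 4 * d)) := by
      rw [h4]; rfl
    simp only [MulMemClass.coe_mul, SubmonoidClass.coe_pow] at e2
    rw [e3, map_mul, norm_algebraMap hf, hh, map_pow] at e2
    by_cases h0 : h = 0
    · rw [h0] at hh
      obtain ⟨e₁, e₂, e₃, hs⟩ := exists_splitRoots hf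
      exact (hs.isUnit_iff hf _).1 (U.isUnit.map (integersA O (F.map ι)).val)
        (by rw [← zero_pow two_ne_zero]; exact hh)
    · refine hsq (Algebra.norm K ((1 + 2 * θ : integersA O (F.map ι)) : AdjoinRoot (F.map ι)) /
        (h * ι (1 + 4 * d))) ?_
      field_simp
      linear_combination e2

end Four

section FourMonogenic

variable {O K : Type*} [CommRing O] [IsDomain O] [ValuationRing O] [Field K] [CharZero K]
  [Algebra O K] [IsFractionRing O K]

local notation "ι" => algebraMap O K

variable {F : O[X]}

/-- The norm of `1 + 4 a` in terms of the trace of `a`. -/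
theorem exists_norm_one_add_four (hf : IsMonicCubic (F.map ι)) {u v w : K}
    (ha : IsIntegral O (coord (F.map ι) u v w)) :
    ∃ t s : O, ι t = 3 * u - ι (F.coeff 2) * v +
        (ι (F.coeff 2) ^ 2 - 2 * ι (F.coeff 1)) * w ∧
      Algebra.norm K (1 + 4 * coord (F.map ι) u v w) = ι (1 + 4 * (t + 4 * s)) := by
  obtain ⟨e₁, e₂, e₃, h⟩ := exists_splitRoots hf
  have hi := h.isIntegral_hom hf ha
  have htr : algebraMap K (AlgebraicClosure K) (3 * u - ι (F.coeff 2) * v +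
      (ι (F.coeff 2) ^ 2 - 2 * ι (F.coeff 1)) * w) =
      h.hom hf 0 (coord (F.map ι) u v w) + h.hom hf 1 (coord (F.map ι) u v w) +
        h.hom hf 2 (coord (F.map ι) u v w) := by
    have s1 := h.s1
    have s2 := h.s2
    rw [coeff_map] at s1 s2
    simp only [h.hom_coord, Matrix.cons_val, map_add, map_sub, map_mul, map_pow, map_ofNat, s1, s2]
    ring
  obtain ⟨t, ht⟩ := exists_of_isIntegral_algebraMap (O := O) (L := AlgebraicClosure K)
    (htr ▸ ((hi 0).add (hi 1)).add (hi 2))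
  set γ₀ := h.hom hf 0 (coord (F.map ι) u v w)
  set γ₁ := h.hom hf 1 (coord (F.map ι) u v w)
  set γ₂ := h.hom hf 2 (coord (F.map ι) u v w)
  have hn : algebraMap K (AlgebraicClosure K)
      ((Algebra.norm K (1 + 4 * coord (F.map ι) u v w) - 1 - 4 * ι t) / 16) =
      γ₀ * γ₁ + γ₀ * γ₂ + γ₁ * γ₂ + 4 * (γ₀ * γ₁ * γ₂) := by
    rw [ht, map_div₀, map_sub, map_sub, map_mul, htr, h.norm_eq' hf]
    simp only [map_add, map_mul, map_one, map_ofNat]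
    ring
  have h4 : IsIntegral O (4 : AlgebraicClosure K) := by
    rw [← map_ofNat (algebraMap O (AlgebraicClosure K))]
    exact isIntegral_algebraMap
  obtain ⟨s, hs⟩ := exists_of_isIntegral_algebraMap (O := O) (L := AlgebraicClosure K)
    (hn ▸ ((((hi 0).mul (hi 1)).add ((hi 0).mul (hi 2))).add ((hi 1).mul (hi 2))).add
      (h4.mul (((hi 0).mul (hi 1)).mul (hi 2))))
  refine ⟨t, s, ht, ?_⟩
  simp only [map_add, map_mul, map_one, map_ofNat, hs]
  ring

variable [Algebra ℤ_[2] O] [Module.Finite ℤ_[2] O] [Module.Free ℤ_[2] O]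

theorem algebraMap_mem_radical {R : Type*} [CommRing R] [Algebra O R] {z : O}
    (hz : z ∈ IsLocalRing.maximalIdeal O) :
    algebraMap O R z ∈ (Ideal.span {(2 : R)}).radical := by
  obtain ⟨n, hn⟩ := mem_radical_two hz
  refine ⟨n, ?_⟩
  obtain ⟨c, hc⟩ := Ideal.mem_span_singleton.1 hn
  rw [← map_pow, hc, map_mul, map_ofNat]
  exact Ideal.mul_mem_right _ _ (Ideal.mem_span_singleton_self _)

variable [Algebra ℤ_[2] K] [IsScalarTower ℤ_[2] O K]

theorem sqClass_mem_of_adjoin (hf : IsMonicCubic (F.map ι))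
    (hA : Algebra.adjoin O {AdjoinRoot.root (F.map ι)} = integersA O (F.map ι))
    (U : (integersA O (F.map ι))ˣ)
    {g : integersA O (F.map ι)} (hU : (U : integersA O (F.map ι)) = 1 + 4 * g)
    (hn : U ∈ squareNormUnits O (F.map ι)) : inclusionA O _ (sqClass U) ∈ kummerImage hf := by
  obtain ⟨g₀, g₁, g₂, hg⟩ : ∃ g₀ g₁ g₂ : O,
      (g : AdjoinRoot (F.map ι)) = coord (F.map ι) (ι g₀) (ι g₁) (ι g₂) := by
    have hmem : (g : AdjoinRoot (F.map ι)) ∈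
        Algebra.adjoin O {AdjoinRoot.root (F.map ι)} := by rw [hA]; exact g.2
    rw [Algebra.adjoin_singleton_eq_range_aeval] at hmem
    obtain ⟨p, hp⟩ := hmem
    obtain ⟨u, v, w, hc⟩ := exists_coord_of_integral hf p
    refine ⟨u, v, w, ?_⟩
    rw [← hc, ← hp, ← AdjoinRoot.aeval_eq, aeval_map_algebraMap]
    rfl
  obtain ⟨t, s, ht, hN⟩ := exists_norm_one_add_four hf (hg ▸ g.2)
  obtain ⟨h, hh⟩ := exists_norm_eq_sq hn
  have hU' : ((U : integersA O (F.map ι)) : AdjoinRoot (F.map ι)) =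
      1 + 4 * coord (F.map ι) (ι g₀) (ι g₁) (ι g₂) := by
    rw [hU, ← hg]
    rfl
  rw [hU', hN] at hh
  obtain ⟨θ, hθ⟩ := exists_artinSchreier_of_sq hh
  have ht' : t = 3 * g₀ - F.coeff 2 * g₁ + (F.coeff 2 ^ 2 - 2 * F.coeff 1) * g₂ :=
    IsFractionRing.injective O K (by
      rw [ht]
      simp only [map_add, map_sub, map_mul, map_pow, map_ofNat])
  obtain ⟨β, hβ⟩ := exists_sub_sq_mem g₂
  obtain ⟨σ, hσ⟩ := exists_sub_sq_mem (g₁ + β)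
  let r : O →+* integersA O (F.map ι) := algebraMap O _
  set T := rootInt hf with hT
  have hgr : g = r g₀ + r g₁ * T + r g₂ * T ^ 2 := by
    refine Subtype.ext (hg.trans ?_)
    rw [coord_eq, algebraMap_eq_algebraMap, algebraMap_eq_algebraMap, algebraMap_eq_algebraMap]
    rfl
  refine sqClass_mem_of_radical hf U hU (r (θ + F.coeff 2 * β) + r β * T) σ ?_
  have e : g - ((r (θ + F.coeff 2 * β) + r β * T) ^ 2 + (r (θ + F.coeff 2 * β) + r β * T)) -
      (r (F.coeff 2) + T) * r σ ^ 2 =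
      r (g₂ - β ^ 2) * (T ^ 2 - r (F.coeff 2) ^ 2) + r (g₁ + β - σ ^ 2) * (T + r (F.coeff 2)) +
      2 * (r (-g₀ + F.coeff 1 * g₂ - 2 * s - θ * F.coeff 2 * β - F.coeff 2 ^ 2 * β ^ 2 -
        F.coeff 2 * β) - r (β + (θ + F.coeff 2 * β) * β) * T) := by
    have hθ' := congrArg r hθ
    rw [ht'] at hθ'
    rw [hgr]
    simp only [map_add, map_sub, map_mul, map_pow, map_neg, map_ofNat] at hθ' ⊢
    linear_combination -hθ'
  rw [e]
  exact Ideal.add_mem _ (Ideal.add_mem _ (Ideal.mul_mem_right _ _ (algebraMap_mem_radical hβ))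
    (Ideal.mul_mem_right _ _ (algebraMap_mem_radical hσ)))
    (Ideal.le_radical (Ideal.mul_mem_right _ _ (Ideal.mem_span_singleton_self _)))

end FourMonogenic

section Local

variable {O B : Type*} [CommRing O] [CommRing B] [Algebra O B]

theorem IsIntUnit.or_of_one_add (hB : IsValuative O B) (hu : ∀ z : B, z ≠ 0 → IsUnit z) {z w : B}
    (hz : IsIntegral O z) (hw : IsIntegral O w) :
    IsIntUnit O (1 + z * w) ∨ IsIntUnit O z := by
  have h1 : IsIntUnit O (1 + z * w + -(z * w)) := by
    rw [add_neg_cancel_right]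
    exact ⟨isIntegral_one, 1, mul_one 1, isIntegral_one⟩
  rcases h1.add hB (isIntegral_one.add (hz.mul hw)) (hz.mul hw).neg (hu _) with h | h
  · exact Or.inl h
  · have h2 := h.neg
    rw [neg_neg] at h2
    exact Or.inr (h2.of_mul_eq hz hw)

/-- On the curve `y² + α X y = X³ + A₂ X² + A₄ X` with `A₄` a unit, `X` is a unit up to squares. -/
theorem exists_isIntUnit_of_curve (hB : IsValuative O B) (hu : ∀ z : B, z ≠ 0 → IsUnit z)
    {α A₂ A₄ x y : B} (hα : IsIntegral O α) (hA₂ : IsIntegral O A₂) (hA₄ : IsIntUnit O A₄)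
    (e : y * (y + α * x) = x * (x ^ 2 + A₂ * x + A₄)) :
    ∃ v h : B, x = v * h ^ 2 ∧ IsIntUnit O v := by
  have done : IsIntUnit O x → ∃ v h : B, x = v * h ^ 2 ∧ IsIntUnit O v := fun h =>
    ⟨x, 1, by ring, h⟩
  rcases hB x with hx | ⟨τ, hτ, hτi⟩
  · have hq : IsIntegral O (x ^ 2 + A₂ * x + A₄) := ((hx.pow 2).add (hA₂.mul hx)).add hA₄.1
    have hsum : IsIntUnit O ((x ^ 2 + A₂ * x + A₄) + -(x * (x + A₂))) := by
      convert hA₄ using 1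
      ring
    rcases hsum.add hB hq (hx.mul (hx.add hA₂)).neg (hu _) with ⟨-, w, hw, hwi⟩ | h
    swap
    · have h2 := h.neg
      rw [neg_neg] at h2
      exact done (h2.of_mul_eq hx (hx.add hA₂))
    have hy : IsIntegral O y := by
      rcases hB y with hy | ⟨ρ, hρ, hρi⟩
      · exact hy
      · have : y = x * (x ^ 2 + A₂ * x + A₄) * ρ - α * x := by
          linear_combination ρ * e - (y + α * x) * hρ
        rw [this]
        exact ((hx.mul hq).mul hρi).sub (hα.mul hx)
    have hp : IsIntegral O (y + α * x) := hy.add (hα.mul hx)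
    have hwu : IsIntUnit O w := ⟨hwi, _, by rw [mul_comm]; exact hw, hq⟩
    have ex : x = w * y * (y + α * x) := by linear_combination -w * e - x * hw
    have ep : y + α * x = y * (1 + (y + α * x) * (α * w)) := by linear_combination α * ex
    rcases IsIntUnit.or_of_one_add hB hu hp (hα.mul hwi) with h | h
    · exact ⟨w * (1 + (y + α * x) * (α * w)), y, by
        linear_combination ex + w * y * ep, hwu.mul h⟩
    · have hyu : IsIntUnit O y :=
        IsIntUnit.of_mul_eq hy (isIntegral_one.add (hp.mul (hα.mul hwi))) (ep ▸ h)
      exact done (ex ▸ (hwu.mul hyu).mul h)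
  · have done' : IsIntegral O x → ∃ v h : B, x = v * h ^ 2 ∧ IsIntUnit O v := fun h =>
      done ⟨h, τ, hτ, hτi⟩
    have es : y * τ * (y * τ + α) = x + A₂ + A₄ * τ := by
      linear_combination τ ^ 2 * e + (x ^ 2 * τ + x + A₂ * (x * τ + 1) + A₄ * τ -
        y * τ * α) * hτ
    have hxi : IsIntegral O (y * τ) → IsIntegral O x := fun hs => by
      have : x = y * τ * (y * τ + α) - A₂ - A₄ * τ := by linear_combination -es
      rw [this]
      exact ((hs.mul (hs.add hα)).sub hA₂).sub (hA₄.1.mul hτi)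
    rcases hB (y * τ) with hs | ⟨ρ, hρ, hρi⟩
    · exact done' (hxi hs)
    rcases IsIntUnit.or_of_one_add hB hu hρi hα with h1 | h1
    swap
    · exact done' (hxi (h1.symm (by rw [mul_comm, hρ])).1)
    rcases IsIntUnit.or_of_one_add hB hu hτi (hA₂.add (hA₄.1.mul hτi)) with h2 | h2
    swap
    · exact done (h2.symm (by rw [mul_comm, hτ]))
    obtain ⟨h2i, w, hw, hwi⟩ := h2
    refine ⟨(1 + ρ * α) * w, y * τ, ?_, h1.mul ⟨hwi, _, by rw [mul_comm, hw], h2i⟩⟩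
    have e1 : 1 + ρ * α = ρ ^ 2 * (x * (1 + τ * (A₂ + A₄ * τ))) := by
      linear_combination ρ ^ 2 * es - (y * τ * ρ + 1 + ρ * α) * hρ -
        ρ ^ 2 * (A₂ + A₄ * τ) * hτ
    rw [e1]
    linear_combination -x * hw - x * (1 + τ * (A₂ + A₄ * τ)) * w * (y * τ * ρ + 1) * hρ

end Local

section Ordinary

variable {O K : Type*} [CommRing O] [IsDomain O] [ValuationRing O] [Field K] [CharZero K]
  [Algebra O K] [IsFractionRing O K]

/-- After the substitution `x = u² x' + r`, the curve `y² = f(x)` becomes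
`y'² = (4 x' - τ) ((x' + b)² - 4 η)`, as for a curve with good ordinary reduction. -/
structure Ordinary (f : K[X]) (u r : K) (α a τ b η : O) : Prop where
  hu : u ≠ 0
  hα : IsUnit α
  hτ : IsUnit τ
  hη : IsUnit η
  hb : α ^ 2 + 4 * a = 8 * b - τ
  h2 : 4 * f.coeff 2 + 12 * r = u ^ 2 * algebraMap O K (8 * b - τ)
  h4 : 2 * f.coeff 1 + 4 * r * f.coeff 2 + 6 * r ^ 2 =
    u ^ 4 * algebraMap O K (2 * (b ^ 2 - 4 * η) - b * τ)
  h6 : 4 * (f.coeff 0 + r * f.coeff 1 + r ^ 2 * f.coeff 2 + r ^ 3) =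
    -u ^ 6 * algebraMap O K (τ * (b ^ 2 - 4 * η))

local notation "ι" => algebraMap O K

variable {F : O[X]} {u r : K} {α a τ b η : O}

theorem Ordinary.eval {f : K[X]} (h : Ordinary f u r α a τ b η) {B : Type*} [CommRing B]
    (κ : K →+* B) (ξ : B) :
    4 * ((κ u ^ 2 * ξ + κ r) ^ 3 + κ (f.coeff 2) * (κ u ^ 2 * ξ + κ r) ^ 2 +
      κ (f.coeff 1) * (κ u ^ 2 * ξ + κ r) + κ (f.coeff 0)) =
    κ u ^ 6 * ((4 * ξ - κ (ι τ)) * ((ξ + κ (ι b)) ^ 2 - 4 * κ (ι η))) := by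
  have h2 := congrArg κ h.h2
  have h4 := congrArg κ h.h4
  have h6 := congrArg κ h.h6
  simp only [map_add, map_sub, map_mul, map_pow, map_neg, map_ofNat] at h2 h4 h6
  linear_combination κ u ^ 4 * ξ ^ 2 * h2 + 2 * κ u ^ 2 * ξ * h4 + h6

/-- The abscissa of the rational point of order two. -/
def ordRoot (u r : K) (τ : O) : K := u ^ 2 * (ι τ / 4) + r

theorem Ordinary.eval_ordRoot (hf : IsMonicCubic (F.map ι))
    (h : Ordinary (F.map ι) u r α a τ b η) : (F.map ι).eval (ordRoot u r τ) = 0 := by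
  have := h.eval (RingHom.id K) (ι τ / 4)
  simp only [RingHom.id_apply] at this
  rw [hf.eval_eq, ordRoot]
  linear_combination this / 4

variable [Algebra ℤ_[2] O] [Module.Finite ℤ_[2] O] [Module.Free ℤ_[2] O]

/-- At the rational point of order two, the Kummer map takes values in the classes of `1 + 4 O`. -/
theorem Ordinary.exists_sub_ordRoot (h : Ordinary (F.map ι) u r α a τ b η)
    (hf : IsMonicCubic (F.map ι)) {x y : K} (hxy : (F.map ι).eval x = y ^ 2) :
    ∃ (k : O) (g : K), x - ordRoot u r τ = ι (1 + 4 * k) * g ^ 2 := by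
  have hu := h.hu
  obtain ⟨x', rfl⟩ : ∃ x', x = u ^ 2 * x' + r := ⟨(x - r) / u ^ 2, by field_simp; ring⟩
  rcases integral_or_not_integral (O := O) x' with ⟨x', rfl⟩ | ⟨ρ, hρ, hρ'⟩
  · obtain ⟨v, hv⟩ := h.hα.exists_right_inv
    refine ⟨v ^ 2 * (a - 2 * b + x'), u * ι α / 2, ?_⟩
    have e : 4 * x' - τ = (1 + 4 * (v ^ 2 * (a - 2 * b + x'))) * α ^ 2 := by
      linear_combination -h.hb - 4 * (a - 2 * b + x') * (α * v + 1) * hv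
    have e' := congrArg ι e
    rw [ordRoot]
    rw [map_mul, map_pow, map_sub, map_mul, map_ofNat] at e'
    linear_combination u ^ 2 / 4 * e'
  · obtain ⟨v, hv⟩ := (isUnit_one_add_of_not (s := b) hρ').exists_right_inv
    have hu4 : IsUnit (1 + ρ * (-4 * η * ρ * v ^ 2)) := isUnit_one_add_of_not hρ'
    obtain ⟨w, hw⟩ := hu4.exists_right_inv
    refine ⟨η * ρ ^ 2 * v ^ 2 * w, y * ι (ρ * v) / u ^ 2, ?_⟩
    have hw1 : 1 + 4 * (η * ρ ^ 2 * v ^ 2 * w) = w := by linear_combination -hw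
    have hev := h.eval (RingHom.id K) x'
    simp only [RingHom.id_apply] at hev
    rw [hf.eval_eq] at hxy
    rw [hxy] at hev
    have e : ι (ρ * v) ^ 2 * ((x' + ι b) ^ 2 - 4 * ι η) * ι w = 1 := by
      have hv' := congrArg ι hv
      have hw' := congrArg ι hw
      simp only [map_add, map_mul, map_pow, map_neg, map_one, map_ofNat] at hv' hw' ⊢
      linear_combination hw' + ι w * (1 + (1 + ι ρ * ι b) * ι v) * hv' +
        ι v ^ 2 * ι w * (x' * ι ρ + 1 + 2 * ι ρ * ι b) * hρ
    rw [hw1, ordRoot]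
    field_simp
    linear_combination -ι w * ι (ρ * v) ^ 2 * hev - u ^ 6 * (4 * x' - ι τ) * e

variable [Algebra ℤ_[2] K] [IsScalarTower ℤ_[2] O K] [Algebra ℚ_[2] K] [FiniteDimensional ℚ_[2] K]
  [IsScalarTower ℤ_[2] ℚ_[2] K]

theorem Ordinary.exists_isIntUnit (h : Ordinary (F.map ι) u r α a τ b η)
    (hf : IsMonicCubic (F.map ι)) {x y : K} (hxy : (F.map ι).eval x = y ^ 2) :
    ∃ v g : AdjoinRoot (F.map ι),
      AdjoinRoot.mk (F.map ι) (C x - X) = v * g ^ 2 ∧ IsIntUnit O v := by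
  refine exists_isIntUnit_mul_sq hf _ fun m => ?_
  have hB := isValuative_quotient hf m
  have hz : ∀ z : AdjoinRoot (F.map ι) ⧸ m.asIdeal, z ≠ 0 → IsUnit z := fun z => isUnit_quotient m
  have hd : ∀ z w : AdjoinRoot (F.map ι) ⧸ m.asIdeal, z * w = 0 → z = 0 ∨ w = 0 := fun z w e => by
    by_contra! hcon
    exact not_isUnit_zero (M₀ := AdjoinRoot (F.map ι) ⧸ m.asIdeal) (e ▸ (hz _ hcon.1).mul (hz _ hcon.2))
  set B := AdjoinRoot (F.map ι) ⧸ m.asIdeal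
  let κ : K →+* B := algebraMap K B
  have hκ : ∀ o : O, κ (ι o) = algebraMap O B o := fun o =>
    (IsScalarTower.algebraMap_apply O K B o).symm
  have hκi : ∀ {z w : K}, z * w = 1 → κ z * κ w = 1 := fun e => by rw [← map_mul, e, map_one]
  set t : B := Ideal.Quotient.mk m.asIdeal (AdjoinRoot.root (F.map ι)) with ht
  have hx : Ideal.Quotient.mk m.asIdeal (AdjoinRoot.mk (F.map ι) (C x - X)) = κ x - t := by
    rw [map_sub, map_sub, AdjoinRoot.mk_C, AdjoinRoot.mk_X]
    rfl
  rw [hx]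
  have h2' : κ 2 * κ (1 / 2) = 1 := hκi (by norm_num)
  have h2'' : (2 : B) * κ (1 / 2) = 1 := by rwa [map_ofNat] at h2'
  have hu := h.hu
  have huu : κ u * κ u⁻¹ = 1 := hκi (mul_inv_cancel₀ hu)
  obtain ⟨ξ, hξ⟩ : ∃ ξ : B, t = κ u ^ 2 * ξ + κ r :=
    ⟨κ u⁻¹ ^ 2 * (t - κ r), by linear_combination -(t - κ r) * (κ u * κ u⁻¹ + 1) * huu⟩
  have hcub : t ^ 3 + κ ((F.map ι).coeff 2) * t ^ 2 + κ ((F.map ι).coeff 1) * t +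
      κ ((F.map ι).coeff 0) = 0 := by
    have := congrArg (Ideal.Quotient.mk m.asIdeal) (root_cubic hf)
    simp only [map_add, map_mul, map_pow, map_zero, ← algebraMap_eq_algebraMap] at this
    rw [coeff_map, coeff_map, coeff_map]
    exact this
  have hev := h.eval κ ξ
  rw [← hξ, hcub, mul_zero] at hev
  have hev' : (4 * ξ - κ (ι τ)) * ((ξ + κ (ι b)) ^ 2 - 4 * κ (ι η)) = 0 := by
    have hpow : (κ u * κ u⁻¹) ^ 6 = 1 := by rw [huu, one_pow]
    linear_combination -(4 * ξ - κ (ι τ)) * ((ξ + κ (ι b)) ^ 2 - 4 * κ (ι η)) * hpow -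
      κ u⁻¹ ^ 6 * hev
  rcases hd _ _ hev' with h0 | h0
  · have htc : t = κ (ordRoot u r τ) := by
      have h4 : κ (4 * (ι τ / 4)) = κ (ι τ) := by congr 1; field_simp
      rw [map_mul, map_ofNat] at h4
      rw [ordRoot, map_add, map_mul, map_pow, hξ]
      linear_combination κ u ^ 2 * κ (1 / 2) ^ 2 * (h0 - h4) -
        κ u ^ 2 * (ξ - κ (ι τ / 4)) * (2 * κ (1 / 2) + 1) * h2''
    obtain ⟨k, g, e⟩ := h.exists_sub_ordRoot hf hxy
    refine ⟨algebraMap O B (1 + 4 * k), κ g, ?_, isIntUnit_algebraMap ?_⟩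
    · rw [htc, ← map_sub, e, map_mul, map_pow, hκ]
    · have := isUnit_one_add_two_mul (2 * k)
      rwa [← mul_assoc, show (2 : O) * 2 = 4 by norm_num] at this
  · have hint : ∀ o : O, IsIntegral O (κ (ι o)) := fun o => by rw [hκ]; exact isIntegral_algebraMap
    obtain ⟨ρ, hρ⟩ : ∃ ρ, ξ = 2 * ρ - κ (ι b) :=
      ⟨(ξ + κ (ι b)) * κ (1 / 2), by linear_combination -(ξ + κ (ι b)) * h2''⟩
    have hρ2 : ρ ^ 2 = κ (ι η) := by
      rw [hρ] at h0
      linear_combination κ (1 / 2) ^ 2 * h0 - (ρ ^ 2 - κ (ι η)) * (2 * κ (1 / 2) + 1) * h2''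
    have hρi : IsIntegral O ρ := IsIntegral.of_pow two_pos (hρ2 ▸ hint η)
    have h2i : IsIntegral O (2 : B) := by
      have := isIntegral_algebraMap (R := O) (A := B) (x := (2 : O))
      rwa [map_ofNat] at this
    have hξi : IsIntegral O ξ := hρ ▸ (h2i.mul hρi).sub (hint b)
    have hρu : IsIntUnit O ρ := by
      have := isIntUnit_algebraMap (B := B) h.hη
      rw [← hκ, ← hρ2, pow_two] at this
      exact this.of_mul_eq hρi hρi
    have hτu : IsIntUnit O (4 * ξ - κ (ι τ)) := by
      have e1 : (4 * ξ - κ (ι τ)) * (4 * (-2 * κ (ι b) - ξ) - κ (ι τ)) =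
          algebraMap O B (τ ^ 2 + 8 * b * τ + 16 * (b ^ 2 - 4 * η)) := by
        rw [← hκ]
        simp only [map_add, map_sub, map_mul, map_pow, map_ofNat]
        linear_combination -16 * h0
      have h4i : IsIntegral O (4 : B) := by
        have := h2i.mul h2i
        rwa [show (2 : B) * 2 = 4 by norm_num] at this
      refine IsIntUnit.of_mul_eq (w := 4 * (-2 * κ (ι b) - ξ) - κ (ι τ))
        ((h4i.mul hξi).sub (hint τ)) ((h4i.mul ((h2i.neg.mul (hint b)).sub hξi)).sub (hint τ)) ?_
      rw [e1]
      refine isIntUnit_algebraMap ?_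
      obtain ⟨τ', hτ'⟩ := h.hτ.exists_right_inv
      have := (h.hτ.pow 2).mul (isUnit_one_add_two_mul
        (τ' ^ 2 * (4 * b * τ + 8 * (b ^ 2 - 4 * η))))
      convert this using 1
      linear_combination -(8 * b * τ + 16 * (b ^ 2 - 4 * η)) * (τ * τ' + 1) * hτ'
    obtain ⟨x', hx'⟩ : ∃ x', x = u ^ 2 * x' + r := ⟨(x - r) / u ^ 2, by field_simp; ring⟩
    obtain ⟨z, hz'⟩ : ∃ z, y = u ^ 3 * z := ⟨y / u ^ 3, by field_simp⟩
    have hx2 : 4 * z ^ 2 = (4 * x' - ι τ) * ((x' + ι b) ^ 2 - 4 * ι η) := by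
      have h1 := h.eval (RingHom.id K) x'
      simp only [RingHom.id_apply] at h1
      rw [← hx', ← hf.eval_eq, hxy, hz'] at h1
      refine mul_left_cancel₀ (pow_ne_zero 6 hu) ?_
      linear_combination h1
    have hx3 := congrArg κ hx2
    have hb := congrArg (fun o => κ (ι o)) h.hb
    simp only [map_add, map_sub, map_mul, map_pow, map_ofNat] at hx3 hb
    have hA₂ : IsIntegral O (3 * ξ + κ (ι a)) := by
      have := (((h2i.add (isIntegral_one (R := O))).mul hξi).add (hint a))
      rwa [show (2 : B) + 1 = 3 by norm_num] at this
    obtain ⟨v, g, e, hv⟩ := exists_isIntUnit_of_curve hB hz (hint α) hA₂ (hτu.mul hρu)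
      (x := κ x' - ξ) (y := (2 * κ z - κ (ι α) * (κ x' - ξ)) * κ (1 / 2)) (by
        linear_combination κ (1 / 2) ^ 2 * (hx3 - (κ x' - ξ) ^ 2 * hb +
          (4 * κ x' - κ (ι τ)) * h0 + 2 * (κ x' - ξ) * (4 * ξ - κ (ι τ)) * hρ) +
          (-κ (ι α) * (κ x' - ξ) * (2 * κ z - κ (ι α) * (κ x' - ξ)) * κ (1 / 2) +
          (κ x' - ξ) * ((κ x' - ξ) ^ 2 + (3 * ξ + κ (ι a)) * (κ x' - ξ) +
          (4 * ξ - κ (ι τ)) * ρ) * (2 * κ (1 / 2) + 1)) * h2'')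
    refine ⟨v, κ u * g, ?_, hv⟩
    rw [hx', map_add, map_mul, map_pow, hξ]
    linear_combination κ u ^ 2 * e

end Ordinary

section Decomposition

variable {K : Type*} [Field K] {f : K[X]}

/-- The evaluation `K[T]/(f(T)) → K` at a rational root of `f`. -/
def evalHom {c : K} (hc : f.eval c = 0) : AdjoinRoot f →ₐ[K] K :=
  AdjoinRoot.liftAlgHom f (Algebra.ofId K K) c (by simpa [Algebra.ofId] using hc)

theorem evalHom_mk {c : K} (hc : f.eval c = 0) (p : K[X]) :
    evalHom hc (AdjoinRoot.mk f p) = p.eval c := by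
  rw [← coe_aeval_eq_eval]
  exact AdjoinRoot.liftAlgHom_mk ..

theorem evalHom_root {c : K} (hc : f.eval c = 0) : evalHom hc (AdjoinRoot.root f) = c := by
  rw [← AdjoinRoot.mk_X, evalHom_mk, eval_X]

/-- The element `(g, p + q ρ)` of `K × K[ρ]`. -/
def pair (ε ρ : AdjoinRoot f) (g p q : K) : AdjoinRoot f :=
  algebraMap K _ g * ε + algebraMap K _ p * (1 - ε) + algebraMap K _ q * ρ

/-- For `f = (X - c) ((X - d)² - w² δ)`, the algebra `K[T]/(f(T))` is `K × K[√δ]`. -/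
structure Decomposition (f : K[X]) (c d w δ : K) (ε ρ : AdjoinRoot f) : Prop where
  eval_eq_zero : f.eval c = 0
  evalHom_eps : evalHom eval_eq_zero ε = 1
  root_eq : AdjoinRoot.root f = pair ε ρ c d w
  eps_mul_eps : ε * ε = ε
  eps_mul_rho : ε * ρ = 0
  rho_mul_rho : ρ * ρ = algebraMap K _ δ * (1 - ε)
  exists_hom : ∃ φ : Fin 3 → AdjoinRoot f →ₐ[K] AlgebraicClosure K, ∃ s : AlgebraicClosure K,
    s ^ 2 = algebraMap K _ δ ∧ (∀ a, algebraMap K _ (Algebra.norm K a) = φ 0 a * φ 1 a * φ 2 a) ∧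
    φ 0 ε = 1 ∧ φ 1 ε = 0 ∧ φ 2 ε = 0 ∧ φ 0 ρ = 0 ∧ φ 1 ρ = s ∧ φ 2 ρ = -s

theorem exists_decomposition [CharZero K] (hf : IsMonicCubic f) {c d w δ : K} (hw : w ≠ 0)
    (hδ : δ ≠ 0) (h2 : f.coeff 2 = -c - 2 * d) (h1 : f.coeff 1 = 2 * c * d + d ^ 2 - w ^ 2 * δ)
    (h0 : f.coeff 0 = -c * (d ^ 2 - w ^ 2 * δ)) : ∃ ε ρ, Decomposition f c d w δ ε ρ := by
  have hc : f.eval c = 0 := by rw [hf.eval_eq, h2, h1, h0]; ring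
  have hq : (c - d) ^ 2 - w ^ 2 * δ ≠ 0 := by
    have := hf.deriv_ne_zero hc
    rw [h2, h1] at this
    intro h
    refine this ?_
    linear_combination h
  set κ := algebraMap K (AdjoinRoot f) with hκ
  set T := AdjoinRoot.root f with hT
  obtain ⟨s, hs⟩ : ∃ s : AlgebraicClosure K, s ^ 2 = algebraMap K _ δ :=
    IsAlgClosed.exists_pow_nat_eq _ two_pos
  set κ' := algebraMap K (AlgebraicClosure K) with hκ'
  have hs0 : s ≠ 0 := by
    rintro rfl
    refine hδ ((algebraMap K (AlgebraicClosure K)).injective ?_)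
    rw [← hκ', ← hs, map_zero]
    ring
  have hw' : κ' w ≠ 0 := by rwa [hκ', Ne, map_eq_zero]
  have hq' : (κ' c - κ' d) ^ 2 - κ' w ^ 2 * κ' δ ≠ 0 := by
    rw [← map_sub, ← map_pow, ← map_pow, ← map_mul, ← map_sub, hκ', Ne, map_eq_zero]
    exact hq
  have hr : SplitRoots f (κ' c) (κ' d + κ' w * s) (κ' d - κ' w * s) := by
    refine ⟨?_, ?_, ?_, ?_, ?_, ?_⟩
    · rw [h2]
      simp only [map_sub, map_mul, map_neg, map_ofNat]
      ring
    · rw [h1]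
      simp only [map_add, map_sub, map_mul, map_ofNat, map_pow]
      linear_combination κ' w ^ 2 * hs
    · rw [h0]
      simp only [map_sub, map_neg, map_mul, map_pow]
      linear_combination -κ' c * κ' w ^ 2 * hs
    · intro h
      refine hq' ?_
      linear_combination (κ' c - κ' d + κ' w * s) * h + κ' w ^ 2 * hs
    · intro h
      refine hq' ?_
      linear_combination (κ' c - κ' d - κ' w * s) * h + κ' w ^ 2 * hs
    · intro h
      have : (2 : AlgebraicClosure K) * (κ' w * s) = 0 := by linear_combination h
      exact mul_ne_zero two_ne_zero (mul_ne_zero hw' hs0) this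
  set ε : AdjoinRoot f := κ ((c - d) ^ 2 - w ^ 2 * δ)⁻¹ * ((T - κ d) ^ 2 - κ (w ^ 2 * δ)) with hε
  set ρ : AdjoinRoot f := κ w⁻¹ * ((T - κ d) * (1 - ε)) with hρ
  have r0 : hr.hom hf 0 T = κ' c := hr.hom_root hf 0
  have r1 : hr.hom hf 1 T = κ' d + κ' w * s := hr.hom_root hf 1
  have r2 : hr.hom hf 2 T = κ' d - κ' w * s := hr.hom_root hf 2
  have k : ∀ i x, hr.hom hf i (κ x) = κ' x := fun i x => (hr.hom hf i).commutes x
  have ε0 : hr.hom hf 0 ε = 1 := by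
    simp only [hε, map_mul, map_sub, map_pow, k, r0, map_inv₀]
    exact inv_mul_cancel₀ hq'
  have ε1 : hr.hom hf 1 ε = 0 := by
    simp only [hε, map_mul, map_sub, map_pow, k, r1]
    linear_combination κ' ((c - d) ^ 2 - w ^ 2 * δ)⁻¹ * κ' w ^ 2 * hs
  have ε2 : hr.hom hf 2 ε = 0 := by
    simp only [hε, map_mul, map_sub, map_pow, k, r2]
    linear_combination κ' ((c - d) ^ 2 - w ^ 2 * δ)⁻¹ * κ' w ^ 2 * hs
  have ρ0 : hr.hom hf 0 ρ = 0 := by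
    rw [hρ, map_mul, map_mul, map_sub, map_sub, map_one, ε0]
    ring
  have ρ1 : hr.hom hf 1 ρ = s := by
    rw [hρ, map_mul, map_mul, map_sub, map_sub, map_one, ε1, r1, k, k, map_inv₀]
    field_simp
    ring
  have ρ2 : hr.hom hf 2 ρ = -s := by
    rw [hρ, map_mul, map_mul, map_sub, map_sub, map_one, ε2, r2, k, k, map_inv₀]
    field_simp
    ring
  have ext : ∀ a b : AdjoinRoot f, hr.hom hf 0 a = hr.hom hf 0 b → hr.hom hf 1 a = hr.hom hf 1 b →
      hr.hom hf 2 a = hr.hom hf 2 b → a = b := fun a b q0 q1 q2 => hr.hom_ext hf fun i => by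
    obtain rfl | rfl | rfl : i = 0 ∨ i = 1 ∨ i = 2 := by fin_cases i <;> simp
    exacts [q0, q1, q2]
  have φε : evalHom hc ε = 1 := by
    rw [hε, map_mul, map_sub, map_pow, map_sub, evalHom_root, AlgHom.commutes, AlgHom.commutes,
      AlgHom.commutes]
    exact inv_mul_cancel₀ hq
  refine ⟨ε, ρ, hc, φε, ext _ _ ?_ ?_ ?_, ext _ _ ?_ ?_ ?_, ext _ _ ?_ ?_ ?_, ext _ _ ?_ ?_ ?_,
    hr.hom hf, s, hs, hr.norm_eq' hf, ε0, ε1, ε2, ρ0, ρ1, ρ2⟩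
  all_goals
    simp only [pair, ← hκ, ← hT, map_add, map_mul, map_sub, map_one, map_zero, k, r0, r1, r2, ε0, ε1, ε2,
      ρ0, ρ1, ρ2]
    first
      | ring1
      | linear_combination hs

variable {c d w δ : K} {ε ρ : AdjoinRoot f}

theorem Decomposition.pair_mul (h : Decomposition f c d w δ ε ρ) (g p q g' p' q' : K) :
    pair ε ρ g p q * pair ε ρ g' p' q' =
      pair ε ρ (g * g') (p * p' + δ * q * q') (p * q' + q * p') := by
  simp only [pair, map_add, map_mul]
  set κ := algebraMap K (AdjoinRoot f)
  linear_combination (κ g - κ p) * (κ g' - κ p') * h.eps_mul_eps +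
    ((κ g - κ p) * κ q' + (κ g' - κ p') * κ q) * h.eps_mul_rho + κ q * κ q' * h.rho_mul_rho

theorem pair_add (g p q g' p' q' : K) :
    pair ε ρ g p q + pair ε ρ g' p' q' = pair ε ρ (g + g') (p + p') (q + q') := by
  simp only [pair, map_add]
  ring

theorem pair_algebraMap (g : K) : algebraMap K (AdjoinRoot f) g = pair ε ρ g g 0 := by
  simp only [pair, map_zero]
  ring

theorem Decomposition.exists_eq_pair [CharZero K] (hf : IsMonicCubic f)
    (h : Decomposition f c d w δ ε ρ) (a : AdjoinRoot f) : ∃ g p q, a = pair ε ρ g p q := by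
  obtain ⟨x, y, z, rfl⟩ := exists_coord hf a
  rw [coord_eq, pow_two, h.root_eq, h.pair_mul, pair_algebraMap (ε := ε) (ρ := ρ) x,
    pair_algebraMap (ε := ε) (ρ := ρ) y, pair_algebraMap (ε := ε) (ρ := ρ) z,
    h.pair_mul, h.pair_mul, pair_add, pair_add]
  exact ⟨_, _, _, rfl⟩

theorem Decomposition.norm_pair (h : Decomposition f c d w δ ε ρ) (g p q : K) :
    Algebra.norm K (pair ε ρ g p q) = g * (p ^ 2 - δ * q ^ 2) := by
  obtain ⟨φ, s, hs, hn, e0, e1, e2, r0, r1, r2⟩ := h.exists_hom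
  refine (algebraMap K (AlgebraicClosure K)).injective ?_
  rw [hn]
  simp only [pair, map_add, map_mul, map_sub, map_one, map_pow, AlgHom.commutes, e0, e1, e2, r0,
    r1, r2]
  linear_combination -algebraMap K (AlgebraicClosure K) g *
    algebraMap K (AlgebraicClosure K) q ^ 2 * hs

theorem Decomposition.evalHom_pair (h : Decomposition f c d w δ ε ρ) (g p q : K) :
    evalHom h.eval_eq_zero (pair ε ρ g p q) = g := by
  have e := congrArg (evalHom h.eval_eq_zero) h.eps_mul_rho
  rw [map_mul, h.evalHom_eps, one_mul, map_zero] at e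
  simp only [pair, map_add, map_mul, map_sub, map_one, AlgHom.commutes, h.evalHom_eps, e]
  simp

end Decomposition

section Integral

variable {O K : Type*} [CommRing O] [IsDomain O] [ValuationRing O] [Field K]
  [CharZero K] [Algebra O K] [IsFractionRing O K] [Algebra ℤ_[2] O] [Module.Finite ℤ_[2] O]
  [Module.Free ℤ_[2] O]

local notation "ι" => algebraMap O K

variable {F : O[X]} {c d w : K} {δ : O} {ε ρ : AdjoinRoot (F.map (algebraMap O K))}

theorem Decomposition.isIntegral_eps (h : Decomposition (F.map ι) c d w (ι δ) ε ρ) :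
    IsIntegral O ε := by
  refine ⟨X ^ 2 - X, ?_, ?_⟩
  · monicity!
  · simp only [eval₂_sub, eval₂_pow, eval₂_X]
    linear_combination h.eps_mul_eps

theorem Decomposition.isIntegral_rho (h : Decomposition (F.map ι) c d w (ι δ) ε ρ) :
    IsIntegral O ρ := by
  refine IsIntegral.of_pow two_pos ?_
  rw [pow_two, h.rho_mul_rho, algebraMap_eq_algebraMap]
  exact isIntegral_algebraMap.mul (isIntegral_one.sub h.isIntegral_eps)

theorem Decomposition.isIntegral_pair (h : Decomposition (F.map ι) c d w (ι δ) ε ρ) (g p q : O) :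
    IsIntegral O (pair ε ρ (ι g) (ι p) (ι q)) := by
  simp only [pair, algebraMap_eq_algebraMap]
  exact ((isIntegral_algebraMap.mul h.isIntegral_eps).add
    (isIntegral_algebraMap.mul (isIntegral_one.sub h.isIntegral_eps))).add
    (isIntegral_algebraMap.mul h.isIntegral_rho)

theorem Decomposition.exists_of_isIntegral (h : Decomposition (F.map ι) c d w (ι δ) ε ρ)
    {g p q : K} (hi : IsIntegral O (pair ε ρ g p q)) :
    (∃ o, ι o = g) ∧ (∃ o, ι o = 2 * p) ∧ ∃ o, ι o = p ^ 2 - ι δ * q ^ 2 := by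
  obtain ⟨φ, s, hs, hn, e0, e1, e2, r0, r1, r2⟩ := h.exists_hom
  have hφ := fun i => hi.map ((φ i).restrictScalars O)
  simp only [AlgHom.restrictScalars_apply] at hφ
  set κ := algebraMap K (AlgebraicClosure K) with hκ
  have c0 : φ 0 (pair ε ρ g p q) = κ g := by
    simp only [pair, map_add, map_mul, map_sub, map_one, AlgHom.commutes, e0, r0]
    ring
  have c1 : φ 1 (pair ε ρ g p q) = κ p + κ q * s := by
    simp only [pair, map_add, map_mul, map_sub, map_one, AlgHom.commutes, e1, r1, hκ]
    ring
  have c2 : φ 2 (pair ε ρ g p q) = κ p - κ q * s := by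
    simp only [pair, map_add, map_mul, map_sub, map_one, AlgHom.commutes, e2, r2, hκ]
    ring
  have h0 := hφ 0
  have h1 := hφ 1
  have h2 := hφ 2
  rw [c0] at h0
  rw [c1] at h1
  rw [c2] at h2
  have k1 : κ (2 * p) = (κ p + κ q * s) + (κ p - κ q * s) := by
    rw [map_mul, map_ofNat]
    ring
  have k2 : κ (p ^ 2 - ι δ * q ^ 2) = (κ p + κ q * s) * (κ p - κ q * s) := by
    rw [map_sub, map_mul, map_pow, map_pow, ← hs]
    ring
  exact ⟨exists_of_isIntegral_algebraMap h0, exists_of_isIntegral_algebraMap (k1 ▸ h1.add h2),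
    exists_of_isIntegral_algebraMap (k2 ▸ h1.mul h2)⟩

end Integral

section Torsion

variable {K : Type*} [Field K] [CharZero K] {f : K[X]}

/-- The abscissa of a point, if there is one. -/
def abscissa (f : K[X]) : CurvePoint f → Option K
  | .zero => none
  | .some x _ _ => some x

open scoped Classical in
theorem finite_twoTorsion (hf : IsMonicCubic f) : Finite (twoTorsion f) := by
  have ht : (insert none (some '' {x | f.IsRoot x}) : Set (Option K)).Finite :=
    ((finite_setOfPred_isRoot hf.monic.ne_zero).image _).insert _
  refine (Set.Finite.of_injOn (f := abscissa f) (s := (twoTorsion f : Set (CurvePoint f)))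
    (fun P hP => ?_) (fun P hP Q hQ e => ?_) ht).to_subtype
  · match P, hP with
    | .zero, _ => exact Set.mem_insert _ _
    | .some x y h, hP =>
      refine Set.mem_insert_of_mem _ ⟨x, ?_, rfl⟩
      change f.eval x = 0
      rw [eval_eq_sq hf h, mem_twoTorsion.1 hP]
      ring
  · match P, Q, hP, hQ, e with
    | .zero, .zero, _, _, _ => rfl
    | .some x y h, .some x' y' h', hP, hQ, e =>
      obtain rfl : x = x' := Option.some.inj e
      obtain rfl := mem_twoTorsion.1 hP
      obtain rfl := mem_twoTorsion.1 hQ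
      rfl

end Torsion

section Index

variable {O K : Type*} [CommRing O] [IsDomain O] [ValuationRing O] [Field K] [CharZero K]
  [Algebra O K] [IsFractionRing O K] [Algebra ℤ_[2] O] [Module.Finite ℤ_[2] O]
  [Module.Free ℤ_[2] O] [Algebra ℤ_[2] K] [IsScalarTower ℤ_[2] O K] [Algebra ℚ_[2] K]
  [FiniteDimensional ℚ_[2] K] [IsScalarTower ℤ_[2] ℚ_[2] K]

local notation "ι" => algebraMap O K

variable {F : O[X]}

theorem relIndex_kummerImage (hf : IsMonicCubic (F.map ι))
    (h : kummerImage hf ≤ unitClasses O (F.map ι)) :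
    (kummerImage hf).relIndex (unitClasses O (F.map ι)) = 2 ^ Module.finrank ℤ_[2] O := by
  have := finite_twoTorsion hf
  have ht : 0 < Nat.card (twoTorsion (F.map ι)) := Nat.card_pos
  have hD : Nat.card (kummerImage hf) = _ := (card_kummerImage hf).trans (card_range_kummerHom hf)
  have hW : Nat.card (unitClasses O (F.map ι)) = _ :=
    (Subgroup.card_map_of_injective (inclusionA_injective O _)).trans (card_squareNormClasses hf)
  have := Subgroup.card_mul_index ((kummerImage hf).subgroupOf (unitClasses O (F.map ι)))
  rw [Nat.card_congr (Subgroup.subgroupOfEquivOfLe h).toEquiv, hD, hW] at this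
  refine Nat.eq_of_mul_eq_mul_left (Nat.mul_pos (pow_pos two_pos _) ht) (this.trans ?_)
  rw [two_mul, pow_add]
  ring

/-- The classes of the units congruent to `1` modulo `4`. -/
def fourClasses (O K : Type*) [CommRing O] [Field K] [Algebra O K] :
    Subgroup (UnitsModSquares K) :=
  (congrUnits O 2).map (sqClass.comp (Units.map (algebraMap O K : O →* K)))

theorem sqClass_mem_fourClasses {z : Kˣ} :
    sqClass z ∈ fourClasses O K ↔ ∃ (k : O) (g : K), (z : K) = ι (1 + 4 * k) * g ^ 2 := by
  constructor
  · rintro ⟨v, hv, e⟩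
    obtain ⟨k, hk⟩ := mem_congrUnits.1 hv
    obtain ⟨h, hh⟩ := sqClass_eq_iff.1 e
    have hv0 : ι (v : O) ≠ 0 := (v.isUnit.map ι).ne_zero
    refine ⟨k, h / ι v, ?_⟩
    rw [show (1 + 4 * k : O) = v by linear_combination -hk]
    change ι (v : O) * (z : K) = h ^ 2 at hh
    field_simp
    linear_combination hh
  · rintro ⟨k, g, e⟩
    obtain ⟨v, hv⟩ : IsUnit (1 + 4 * k) := by
      have := isUnit_one_add_two_mul (2 * k)
      rwa [← mul_assoc, show (2 : O) * 2 = 4 by norm_num] at this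
    refine ⟨v, mem_congrUnits.2 ⟨k, by rw [hv]; ring⟩, ?_⟩
    refine sqClass_eq_iff.2 ⟨ι v * g, ?_⟩
    change ι (v : O) * (z : K) = _
    rw [e, ← hv]
    ring

variable {u r : K} {α a τ b η : O}

/-- The classes whose value at the rational point of order two is congruent to `1` modulo `4`. -/
def ordClasses (h : Ordinary (F.map (algebraMap O K)) u r α a τ b η)
    (hf : IsMonicCubic (F.map (algebraMap O K))) :
    Subgroup (UnitsModSquares (AdjoinRoot (F.map (algebraMap O K)))) :=
  (fourClasses O K).comap (UnitsModSquares.map (evalHom (h.eval_ordRoot hf)).toRingHom)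

theorem sqClass_mem_ordClasses (h : Ordinary (F.map ι) u r α a τ b η) (hf : IsMonicCubic (F.map ι))
    {z : (AdjoinRoot (F.map ι))ˣ} : sqClass z ∈ ordClasses h hf ↔
      ∃ (k : O) (g : K), evalHom (h.eval_ordRoot hf) z = ι (1 + 4 * k) * g ^ 2 :=
  sqClass_mem_fourClasses

theorem kummerImage_le_ordClasses (h : Ordinary (F.map ι) u r α a τ b η)
    (hf : IsMonicCubic (F.map ι)) : kummerImage hf ≤ ordClasses h hf := by
  intro c hc
  obtain ⟨P, rfl⟩ := mem_kummerImage.1 hc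
  refine kummerMap_mem_of_forall hf (fun x y hxy hy => ?_) P
  refine (sqClass_mem_ordClasses h hf).2 ?_
  obtain ⟨k, g, e⟩ := h.exists_sub_ordRoot hf (eval_eq_sq hf hxy)
  refine ⟨k, g, ?_⟩
  rw [IsUnit.unit_spec, kummerPoly_of_ne hy, evalHom_mk, ← e]
  simp

theorem kummerImage_le_unitClasses (h : Ordinary (F.map ι) u r α a τ b η)
    (hf : IsMonicCubic (F.map ι)) : kummerImage hf ≤ unitClasses O (F.map ι) := by
  intro c hc
  obtain ⟨P, rfl⟩ := mem_kummerImage.1 hc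
  exact kummerMap_mem_of_forall hf (fun x y hxy hy =>
    kummerMap_mem_of_eq hf hy (h.exists_isIntUnit hf (eval_eq_sq hf hxy))) P

end Index

section Split

variable {O K : Type*} [CommRing O] [IsDomain O] [ValuationRing O] [Field K] [CharZero K]
  [Algebra O K] [IsFractionRing O K] [Algebra ℤ_[2] O] [Module.Finite ℤ_[2] O]
  [Module.Free ℤ_[2] O]

local notation "ι" => algebraMap O K

variable {F : O[X]} {u r : K} {α a τ b η : O}

theorem Ordinary.exists_decomposition (h : Ordinary (F.map ι) u r α a τ b η)
    (hf : IsMonicCubic (F.map ι)) {i k : O} (hi : IsUnit i) (hη : η = i ^ 2 * (1 + 2 * k)) :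
    ∃ ε ρ, Decomposition (F.map ι) (ordRoot u r τ) (r - u ^ 2 * ι b) (u ^ 2 * (2 * ι i))
      (ι (1 + 2 * k)) ε ρ := by
  have h2 := h.h2
  have h4 := h.h4
  have h6 := h.h6
  have hη' := congrArg ι hη
  simp only [map_add, map_sub, map_mul, map_pow, map_ofNat, map_one] at h2 h4 h6 hη'
  refine KummerTwo.exists_decomposition hf ?_ ?_ ?_ ?_ ?_
  · exact mul_ne_zero (pow_ne_zero 2 h.hu) (mul_ne_zero two_ne_zero (hi.map ι).ne_zero)
  · exact ((isUnit_one_add_two_mul k).map ι).ne_zero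
  · rw [ordRoot]
    linear_combination h2 / 4
  · rw [ordRoot]
    simp only [map_add, map_mul, map_ofNat, map_one]
    linear_combination h4 / 2 - r / 2 * h2 - 4 * u ^ 4 * hη'
  · rw [ordRoot]
    simp only [map_add, map_mul, map_ofNat, map_one]
    linear_combination h6 / 4 - r / 2 * h4 + r ^ 2 / 4 * h2 +
      4 * (u ^ 6 * ι τ / 4 + u ^ 4 * r) * hη'

theorem two_dvd_or_isUnit (hm : IsLocalRing.maximalIdeal O = Ideal.span {2})
    (o : O) : 2 ∣ o ∨ IsUnit o := by
  by_cases ho : IsUnit o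
  · exact Or.inr ho
  · left
    rw [← Ideal.mem_span_singleton, ← hm]
    exact ho

theorem two_dvd_of_sq (hm : IsLocalRing.maximalIdeal O = Ideal.span {2})
    {o : O} (h : 2 ∣ o ^ 2) : 2 ∣ o := by
  refine (two_dvd_or_isUnit hm o).resolve_right fun ho => ?_
  have h2 := two_mem_maximalIdeal O
  exact h2 (isUnit_of_dvd_unit h (ho.pow 2))

theorem exists_two_dvd_sub_sq (hm : IsLocalRing.maximalIdeal O = Ideal.span {2})
    (o : O) : ∃ s, 2 ∣ o - s ^ 2 := by
  obtain ⟨s, hs⟩ := exists_sub_sq_mem o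
  rw [hm] at hs
  exact ⟨s, Ideal.mem_span_singleton.1 hs⟩

theorem exists_eq_sq_mul (hm : IsLocalRing.maximalIdeal O = Ideal.span {2})
    {η : O} (hη : IsUnit η) :
    ∃ i k : O, IsUnit i ∧ η = i ^ 2 * (1 + 2 * k) := by
  obtain ⟨i, m, hi⟩ := exists_two_dvd_sub_sq hm η
  have hiu : IsUnit i := (two_dvd_or_isUnit hm i).resolve_left fun ⟨j, hj⟩ =>
    two_mem_maximalIdeal O (isUnit_of_dvd_unit
      ⟨m + 2 * j ^ 2, by rw [hj] at hi; linear_combination hi⟩ hη)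
  obtain ⟨j, hj⟩ := hiu.exists_right_inv
  exact ⟨i, j ^ 2 * m, hiu, by linear_combination hi - 2 * m * (i * j + 1) * hj⟩

theorem two_dvd_add_of_four_classes (hm : IsLocalRing.maximalIdeal O = Ideal.span {2})
    {s l l' m : O} {g : K}
    (h : ι (1 + 2 * (l + l') + 4 * s) = ι (1 + 4 * m) * g ^ 2) : 2 ∣ l + l' := by
  obtain ⟨n, hn⟩ := (isUnit_one_add_two_mul (2 * m)).exists_right_inv
  obtain ⟨o, rfl⟩ : ∃ o, ι o = g := by
    refine exists_of_sq (c := n * (1 + 2 * (l + l') + 4 * s)) ?_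
    have hn' := congrArg ι hn
    rw [map_mul, h]
    simp only [map_add, map_mul, map_ofNat, map_one] at hn' ⊢
    linear_combination -g ^ 2 * hn'
  have h' : 1 + 2 * (l + l') + 4 * s = (1 + 4 * m) * o ^ 2 := by
    refine IsFractionRing.injective O K ?_
    rw [h, map_mul, map_pow]
  obtain ⟨j, hj⟩ : 2 ∣ o - 1 := by
    refine two_dvd_of_sq hm ⟨(l + l') + 2 * s - 2 * m * o ^ 2 + 1 - o, ?_⟩
    linear_combination -h'
  refine ⟨j ^ 2 + j + m * o ^ 2 - s, ?_⟩
  have h2 : (2 : O) ≠ 0 := two_ne_zero_of_isFractionRing O K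
  refine mul_left_cancel₀ h2 ?_
  have ho : o = 1 + 2 * j := by linear_combination hj
  linear_combination h' + (o + 1 + 2 * j) * ho

variable [Algebra ℤ_[2] K] [IsScalarTower ℤ_[2] O K] [Algebra ℚ_[2] K]
  [FiniteDimensional ℚ_[2] K] [IsScalarTower ℤ_[2] ℚ_[2] K]

theorem Ordinary.exists_unit_of_even (h : Ordinary (F.map ι) u r α a τ b η)
    (hf : IsMonicCubic (F.map ι)) {i k : O} (hi : IsUnit i) (hη : η = i ^ 2 * (1 + 2 * (2 * k)))
    (l : O) : ∃ U ∈ squareNormUnits O (F.map ι),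
      evalHom (h.eval_ordRoot hf) ((U : integersA O (F.map ι)) : AdjoinRoot (F.map ι)) =
        ι (1 + 2 * l - 4 * k * l ^ 2) := by
  obtain ⟨ε, ρ, d⟩ := h.exists_decomposition hf hi hη
  have hn := d.norm_pair (ι (1 + 2 * l - 4 * k * l ^ 2)) (ι (1 + l)) (ι l)
  have e : (1 + 2 * l - 4 * k * l ^ 2) * ((1 + l) ^ 2 - (1 + 2 * (2 * k)) * l ^ 2) =
      (1 + 2 * l - 4 * k * l ^ 2) ^ 2 := by ring
  rw [← map_pow, ← map_pow, ← map_mul, ← map_sub, ← map_mul, e] at hn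
  have hu : IsUnit (1 + 2 * l - 4 * k * l ^ 2) := by
    have := isUnit_one_add_two_mul (l - 2 * k * l ^ 2)
    convert this using 1
    ring
  obtain ⟨U, hU⟩ := isIntUnit_integersA
    (isIntUnit_of_norm hf (d.isIntegral_pair _ _ _) (hu.pow 2) hn)
  refine ⟨U, mem_square_iff.2 ⟨ι (1 + 2 * l - 4 * k * l ^ 2), ?_⟩, ?_⟩
  · change Algebra.norm K ((U : integersA O (F.map ι)) : AdjoinRoot (F.map ι)) = _
    rw [hU, hn, map_pow]
  · rw [hU]
    exact d.evalHom_pair _ _ _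

theorem inclusionA_mem_ordClasses (h : Ordinary (F.map ι) u r α a τ b η)
    (hf : IsMonicCubic (F.map ι)) (U : (integersA O (F.map ι))ˣ) :
    inclusionA O _ (sqClass U) ∈ ordClasses h hf ↔ ∃ (k : O) (g : K),
      evalHom (h.eval_ordRoot hf) ((U : integersA O (F.map ι)) : AdjoinRoot (F.map ι)) =
        ι (1 + 4 * k) * g ^ 2 := by
  obtain ⟨z, hz⟩ : ∃ z : (AdjoinRoot (F.map ι))ˣ,
      (z : AdjoinRoot (F.map ι)) = ((U : integersA O (F.map ι)) : AdjoinRoot (F.map ι)) :=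
    ⟨Units.map ((integersA O (F.map ι)).val : integersA O (F.map ι) →* _) U, rfl⟩
  have e : inclusionA O _ (sqClass U) = sqClass z := by
    refine congrArg sqClass (Units.ext ?_)
    rw [hz]
    rfl
  rw [e, sqClass_mem_ordClasses, hz]

theorem Ordinary.le_relIndex_of_even (h : Ordinary (F.map ι) u r α a τ b η)
    (hf : IsMonicCubic (F.map ι)) (hm : IsLocalRing.maximalIdeal O = Ideal.span {2})
    {i k : O} (hi : IsUnit i) (hη : η = i ^ 2 * (1 + 2 * (2 * k)))
    (hne : (ordClasses h hf).relIndex (unitClasses O (F.map ι)) ≠ 0) :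
    2 ^ Module.finrank ℤ_[2] O ≤ (ordClasses h hf).relIndex (unitClasses O (F.map ι)) := by
  choose U hU hUe using h.exists_unit_of_even hf hi hη
  obtain ⟨π, hπ, hker⟩ := exists_mod_two_hom O
  choose l hl using hπ
  set W := unitClasses O (F.map ι)
  have hW : ∀ x, inclusionA O _ (sqClass (U (l x))) ∈ W := fun x =>
    Subgroup.mem_map_of_mem _ (Subgroup.mem_map_of_mem _ (hU _))
  have : Finite (W ⧸ (ordClasses h hf).subgroupOf W) := Nat.finite_of_card_ne_zero hne
  have hcard := Nat.card_le_card_of_injective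
    (fun x => (QuotientGroup.mk ⟨_, hW x⟩ : W ⧸ (ordClasses h hf).subgroupOf W)) ?_
  · have hc : Nat.card (Fin (Module.finrank ℤ_[2] O) → ZMod 2) = 2 ^ Module.finrank ℤ_[2] O := by
      simp
    exact hc ▸ hcard
  · intro x x' e
    have e' := QuotientGroup.eq.1 e
    rw [Subgroup.mem_subgroupOf] at e'
    change (inclusionA O _ (sqClass (U (l x))))⁻¹ * inclusionA O _ (sqClass (U (l x'))) ∈
      ordClasses h hf at e'
    rw [UnitsModSquares.inv_eq, ← map_mul, ← map_mul] at e'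
    obtain ⟨m, g, hg⟩ := (inclusionA_mem_ordClasses h hf _).1 e'
    rw [Units.val_mul, MulMemClass.coe_mul] at hg
    rw [map_mul, hUe, hUe, ← map_mul] at hg
    obtain ⟨j, hj⟩ := two_dvd_add_of_four_classes hm (l := l x) (l' := l x')
      (s := l x * l x' - k * l x ^ 2 * (1 + 2 * l x' - 4 * k * l x' ^ 2) -
        k * l x' ^ 2 * (1 + 2 * l x)) (by rw [← hg]; congr 1; ring)
    have := (hker (l x - l x')).2 ⟨j - l x', by linear_combination hj⟩
    rw [map_sub, hl, hl, sub_eq_zero] at this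
    exact this

theorem Ordinary.sqClass_mem_of_even (h : Ordinary (F.map ι) u r α a τ b η)
    (hf : IsMonicCubic (F.map ι)) (hm : IsLocalRing.maximalIdeal O = Ideal.span {2})
    {i k : O} (hi : IsUnit i) (hη : η = i ^ 2 * (1 + 2 * (2 * k)))
    (U : (integersA O (F.map ι))ˣ) {g : integersA O (F.map ι)}
    (hU : (U : integersA O (F.map ι)) = 1 + 4 * g) (hn : U ∈ squareNormUnits O (F.map ι)) :
    inclusionA O _ (sqClass U) ∈ kummerImage hf := by
  set D := kummerImage hf
  set V := ordClasses h hf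
  set W := unitClasses O (F.map ι)
  have hDW : D ≤ W := kummerImage_le_unitClasses h hf
  have hDV : D ≤ V := kummerImage_le_ordClasses h hf
  have h1 := Subgroup.relIndex_mul_relIndex D (V ⊓ W) W (le_inf hDV hDW) inf_le_right
  rw [Subgroup.inf_relIndex_right, relIndex_kummerImage hf hDW] at h1
  have hpos : 0 < 2 ^ Module.finrank ℤ_[2] O := pow_pos two_pos _
  have h2 := h.le_relIndex_of_even hf hm hi hη (right_ne_zero_of_mul (h1 ▸ hpos.ne'))
  have h3 : D.relIndex (V ⊓ W) = 1 := by
    have h0 : D.relIndex (V ⊓ W) ≠ 0 := left_ne_zero_of_mul (h1 ▸ hpos.ne')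
    have : D.relIndex (V ⊓ W) * 2 ^ Module.finrank ℤ_[2] O ≤ 1 * 2 ^ Module.finrank ℤ_[2] O := by
      rw [one_mul]
      exact (Nat.mul_le_mul_left _ h2).trans h1.le
    have := Nat.le_of_mul_le_mul_right this hpos
    omega
  refine Subgroup.relIndex_eq_one.1 h3 ⟨?_, ?_⟩
  · refine (inclusionA_mem_ordClasses h hf U).2 ?_
    obtain ⟨k, hk⟩ : ∃ k, ι k = evalHom (h.eval_ordRoot hf) (g : AdjoinRoot (F.map ι)) :=
      IsIntegrallyClosed.isIntegral_iff.1
        (g.2.map ((evalHom (h.eval_ordRoot hf)).restrictScalars O))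
    have hU' : ((U : integersA O (F.map ι)) : AdjoinRoot (F.map ι)) =
        1 + 4 * (g : AdjoinRoot (F.map ι)) := by
      rw [hU]
      rfl
    have key : evalHom (h.eval_ordRoot hf) ((U : integersA O (F.map ι)) :
        AdjoinRoot (F.map ι)) = ι (1 + 4 * k) * 1 ^ 2 := by
      rw [hU', map_add, map_mul, map_one, map_ofNat, map_add, map_mul, map_one, map_ofNat, hk,
        one_pow, mul_one]
    exact ⟨k, 1, key⟩
  · exact Subgroup.mem_map_of_mem _ (Subgroup.mem_map_of_mem _ hn)

end Split

section Eisenstein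

variable {O K : Type*} [CommRing O] [IsDomain O] [ValuationRing O] [Field K] [CharZero K]
  [Algebra O K] [IsFractionRing O K] [Algebra ℤ_[2] O] [Module.Finite ℤ_[2] O]
  [Module.Free ℤ_[2] O]

local notation "ι" => algebraMap O K

/-- The ring `O[Z]` is integrally closed for `Z² + 2 Z - 2 k = 0`. -/
theorem exists_of_eisenstein (hm : IsLocalRing.maximalIdeal O = Ideal.span {2}) {k : O}
    (hk : IsUnit k) {p q : K} (h : ∃ o, ι o = p ^ 2 - 2 * p * q - 2 * ι k * q ^ 2) :
    (∃ o, ι o = p) ∧ ∃ o, ι o = q := by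
  obtain ⟨o, ho⟩ := h
  rcases integral_or_not_integral (O := O) q with ⟨q, rfl⟩ | ⟨t, ht, htu⟩
  · refine ⟨exists_of_quadratic (b := -2 * q) (c := -2 * k * q ^ 2 - o) ?_, q, rfl⟩
    simp only [map_sub, map_mul, map_neg, map_pow, map_ofNat]
    linear_combination -ho
  · exfalso
    obtain ⟨s, rfl⟩ := (two_dvd_or_isUnit hm t).resolve_right htu
    obtain ⟨R, hR⟩ := exists_of_quadratic (z := p * ι (2 * s)) (b := -2)
      (c := -2 * k - o * (2 * s) ^ 2) (by
        simp only [map_sub, map_mul, map_neg, map_pow, map_ofNat] at ho ht ⊢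
        linear_combination -(2 * ι s) ^ 2 * ho + (2 * p * (2 * ι s) +
          2 * ι k * (q * (2 * ι s) + 1)) * ht)
    have e : R ^ 2 - 2 * R - 2 * k = o * (2 * s) ^ 2 := by
      refine IsFractionRing.injective O K ?_
      simp only [map_sub, map_mul, map_pow, map_ofNat] at ho ht hR ⊢
      rw [hR]
      linear_combination -(2 * ι s) ^ 2 * ho + (2 * p * (2 * ι s) +
        2 * ι k * (q * (2 * ι s) + 1)) * ht
    obtain ⟨R', rfl⟩ := two_dvd_of_sq hm (o := R) ⟨R + k + 2 * o * s ^ 2, by linear_combination e⟩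
    have h2 : (2 : O) ≠ 0 := two_ne_zero_of_isFractionRing O K
    exact two_mem_maximalIdeal O (isUnit_of_dvd_unit ⟨R' ^ 2 - R' - o * s ^ 2,
      mul_left_cancel₀ h2 (by linear_combination -e)⟩ hk)

variable [Algebra ℤ_[2] K] [IsScalarTower ℤ_[2] O K] [Algebra ℚ_[2] K]
  [FiniteDimensional ℚ_[2] K] [IsScalarTower ℤ_[2] ℚ_[2] K]

variable {F : O[X]} {u r : K} {α a τ b η : O}

theorem smul_pair {f : K[X]} {ε ρ : AdjoinRoot f} (x g p q : K) :
    algebraMap K _ x * pair ε ρ g p q = pair ε ρ (x * g) (x * p) (x * q) := by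
  simp only [pair, map_mul]
  ring

theorem Ordinary.exists_kummerMap_eq (h : Ordinary (F.map ι) u r α a τ b η)
    (hf : IsMonicCubic (F.map ι)) {i k : O} {ε ρ : AdjoinRoot (F.map ι)}
    (d : Decomposition (F.map ι) (ordRoot u r τ) (r - u ^ 2 * ι b) (u ^ 2 * (2 * ι i))
      (ι (1 + 2 * k)) ε ρ) (σ : O) (V : (integersA O (F.map ι))ˣ)
    (hV : ((V : integersA O (F.map ι)) : AdjoinRoot (F.map ι)) =
      pair ε ρ 1 (ι (1 + 4 * σ ^ 2 * (τ + 4 * b))) (ι (-32 * i * σ ^ 2))) :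
    inclusionA O _ (sqClass V) ∈ kummerImage hf := by
  by_cases hσ : σ = 0
  · have : V = 1 := by
      refine Units.ext (Subtype.ext ?_)
      rw [hV, hσ]
      simp [pair]
    rw [this, map_one, map_one]
    exact one_mem _
  have hσ' : ι σ ≠ 0 := map_ne_zero_of_ne hσ
  have hu := h.hu
  set s := σ ^ 2 * (τ + 4 * b) with hs
  obtain ⟨y₀, hy₀⟩ := exists_sq_of_eight (s + 2 * s ^ 2 - 128 * σ ^ 4 * η)
  set x : K := u ^ 2 * (ι τ / 4 + 1 / (16 * ι σ ^ 2)) + r with hx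
  set y : K := u ^ 3 * (ι (1 + 2 * y₀) / (64 * ι σ ^ 3)) with hy
  have hy0 : y ≠ 0 := mul_ne_zero (pow_ne_zero 3 hu) (div_ne_zero
    ((isUnit_one_add_two_mul y₀).map ι).ne_zero (mul_ne_zero (by norm_num) (pow_ne_zero 3 hσ')))
  have hxy : (F.map ι).eval x = y ^ 2 := by
    have h1 := h.eval (RingHom.id K) (ι τ / 4 + 1 / (16 * ι σ ^ 2))
    simp only [RingHom.id_apply] at h1
    rw [← hx, ← hf.eval_eq] at h1
    have h2 := congrArg ι hy₀
    rw [hs] at h2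
    simp only [map_add, map_sub, map_mul, map_pow, map_ofNat, map_one] at h2
    have h3 : (4 * (ι τ / 4 + 1 / (16 * ι σ ^ 2)) - ι τ) *
        ((ι τ / 4 + 1 / (16 * ι σ ^ 2) + ι b) ^ 2 - 4 * ι η) =
        4 * ((1 + 2 * ι y₀) / (64 * ι σ ^ 3)) ^ 2 := by
      rw [div_pow, ← h2]
      field_simp
      ring
    rw [h3] at h1
    rw [hy, map_add, map_mul, map_one, map_ofNat]
    linear_combination h1 / 4
  have hns := nonsingular_of_eval hf hxy
  refine mem_kummerImage.2 ⟨.some x y hns, ?_⟩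
  change _ = sqClass _
  refine (kummerMap_eq_iff hf _ _).2 ⟨algebraMap K _ (u / (4 * ι σ)) *
    ((V : integersA O (F.map ι)) : AdjoinRoot (F.map ι)), ?_⟩
  rw [kummerPoly_of_ne hy0]
  change _ * ((V : integersA O (F.map ι)) : AdjoinRoot (F.map ι)) = _
  have key : AdjoinRoot.mk (F.map ι) (C x - X) = algebraMap K _ ((u / (4 * ι σ)) ^ 2) *
      ((V : integersA O (F.map ι)) : AdjoinRoot (F.map ι)) := by
    rw [map_sub, AdjoinRoot.mk_C, AdjoinRoot.mk_X, ← AdjoinRoot.algebraMap_eq, hV, smul_pair,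
      pair_algebraMap (ε := ε) (ρ := ρ) x, sub_eq_iff_eq_add, d.root_eq, pair_add]
    congr 1
    · rw [hx, ordRoot]
      field_simp
      ring
    · rw [hx]
      simp only [map_add, map_mul, map_pow, map_ofNat, map_one]
      field_simp
      ring
    · simp only [map_mul, map_neg, map_pow, map_ofNat]
      field_simp
      ring
  rw [key, map_pow]
  ring

theorem Ordinary.sqClass_mem_of_odd (h : Ordinary (F.map ι) u r α a τ b η)
    (hf : IsMonicCubic (F.map ι)) (hm : IsLocalRing.maximalIdeal O = Ideal.span {2})
    {i k : O} (hi : IsUnit i) (hk : IsUnit k) (hη : η = i ^ 2 * (1 + 2 * k))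
    (U : (integersA O (F.map ι))ˣ) {g : integersA O (F.map ι)}
    (hU : (U : integersA O (F.map ι)) = 1 + 4 * g) (hn : U ∈ squareNormUnits O (F.map ι)) :
    inclusionA O _ (sqClass U) ∈ kummerImage hf := by
  have := finite_integersA hf
  have := free_integersA hf
  obtain ⟨ε, ρ, d⟩ := h.exists_decomposition hf hi hη
  obtain ⟨γ, p, q, hg⟩ := d.exists_eq_pair hf (g : AdjoinRoot (F.map ι))
  obtain ⟨⟨γ, rfl⟩, -, o, ho⟩ := d.exists_of_isIntegral (hg ▸ g.2)
  obtain ⟨⟨m, hm'⟩, q, rfl⟩ := exists_of_eisenstein hm hk (p := p + q) (q := q) ⟨o, by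
    rw [ho, map_add, map_mul, map_one, map_ofNat]
    ring⟩
  obtain ⟨p, rfl⟩ : ∃ o, ι o = p := ⟨m - q, by rw [map_sub, hm']; ring⟩
  obtain ⟨θ, hθ⟩ : ∃ θ, θ ^ 2 + θ =
      γ + 2 * ((1 + 4 * γ) * (p + 2 * (p ^ 2 - (1 + 2 * k) * q ^ 2))) := by
    obtain ⟨x, hx⟩ := exists_norm_eq_sq hn
    refine exists_artinSchreier_of_sq (O := O) (h := x) ?_
    have hU' : ((U : integersA O (F.map ι)) : AdjoinRoot (F.map ι)) =
        pair ε ρ (ι (1 + 4 * γ)) (ι (1 + 4 * p)) (ι (4 * q)) := by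
      rw [hU]
      change 1 + 4 * (g : AdjoinRoot (F.map ι)) = _
      rw [hg]
      simp only [pair, map_add, map_mul, map_one, map_ofNat]
      ring
    rw [← hx, hU', d.norm_pair, ← map_pow, ← map_pow, ← map_mul, ← map_sub, ← map_mul]
    congr 1
    ring
  obtain ⟨τ', hτ'⟩ := h.hτ.exists_right_inv
  obtain ⟨σ, hσ⟩ : ∃ σ, 2 ∣ p + q + σ ^ 2 * τ := by
    obtain ⟨σ, j, hj⟩ := exists_two_dvd_sub_sq hm ((p + q) * τ')
    exact ⟨σ, p + q - τ * j, by linear_combination -τ * hj + (p + q) * hτ'⟩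
  obtain ⟨n, hn⟩ := hσ
  let κ : O →+* integersA O (F.map ι) := algebraMap O _
  let E : integersA O (F.map ι) := ⟨ε, d.isIntegral_eps⟩
  let R : integersA O (F.map ι) := ⟨ρ, d.isIntegral_rho⟩
  have hEE : E * E = E := Subtype.ext d.eps_mul_eps
  have hER : E * R = 0 := Subtype.ext d.eps_mul_rho
  have hRR : R * R = κ (1 + 2 * k) * (1 - E) := by
    refine Subtype.ext (d.rho_mul_rho.trans ?_)
    rw [algebraMap_eq_algebraMap]
    rfl
  have hgE : g = κ γ * E + κ p * (1 - E) + κ q * R := by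
    refine Subtype.ext (hg.trans ?_)
    simp only [pair, algebraMap_eq_algebraMap]
    rfl
  set v : integersA O (F.map ι) :=
    κ (σ ^ 2 * (τ + 4 * b)) * (1 - E) + κ (-8 * i * σ ^ 2) * R with hv
  obtain ⟨V, hV⟩ : IsUnit (1 + 4 * v) := by
    have := isUnit_one_add_two_mul (2 * v)
    rwa [← mul_assoc, show (2 : integersA O (F.map ι)) * 2 = 4 by norm_num] at this
  have hVm := h.exists_kummerMap_eq hf d σ V (by
    rw [hV]
    have e : 1 + 4 * v = κ 1 * E + κ (1 + 4 * σ ^ 2 * (τ + 4 * b)) * (1 - E) +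
        κ (-32 * i * σ ^ 2) * R := by
      rw [hv]
      simp only [map_add, map_mul, map_one, map_ofNat, map_neg, map_pow]
      ring
    rw [e, ← map_one ι]
    simp only [pair, algebraMap_eq_algebraMap]
    rfl)
  have hrad : g + v + 4 * g * v - ((κ θ * E) ^ 2 + κ θ * E) =
      2 * (-κ ((1 + 4 * γ) * (p + 2 * (p ^ 2 - (1 + 2 * k) * q ^ 2))) * E +
        κ (n + 2 * b * σ ^ 2) * (1 - E) - κ (4 * i * σ ^ 2) * R + 2 * g * v) +
      κ q * (R - (1 - E)) := by
    have hθ' := congrArg κ hθ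
    have hn' := congrArg κ hn
    simp only [map_add, map_sub, map_mul, map_pow, map_ofNat, map_one, map_neg] at hθ' hn' hRR hv ⊢
    linear_combination hgE + hv - κ θ ^ 2 * hEE - E * hθ' + (1 - E) * hn'
  have hsq : (R - (1 - E)) ^ 2 = 2 * (κ (1 + k) * (1 - E) - R) := by
    simp only [map_add, map_mul, map_ofNat, map_one] at hRR ⊢
    linear_combination hRR + hEE + 2 * hER
  obtain ⟨t, ht⟩ := exists_sq_add_self (γ := g + v + 4 * g * v) (η := κ θ * E) ⟨2, by
    rw [hrad]
    set A₁ := -κ ((1 + 4 * γ) * (p + 2 * (p ^ 2 - (1 + 2 * k) * q ^ 2))) * E +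
        κ (n + 2 * b * σ ^ 2) * (1 - E) - κ (4 * i * σ ^ 2) * R + 2 * g * v
    exact ⟨2 * A₁ ^ 2 + 2 * A₁ * (κ q * (R - (1 - E))) + κ q ^ 2 * (κ (1 + k) * (1 - E) - R), by
      linear_combination κ q ^ 2 * hsq⟩⟩
  have hUV : sqClass U = sqClass V := by
    refine sqClass_eq_iff.2 ⟨1 + 2 * t, ?_⟩
    rw [hU, hV]
    linear_combination -4 * ht
  rw [hUV]
  exact hVm

theorem Ordinary.sqClass_mem (h : Ordinary (F.map ι) u r α a τ b η)
    (hf : IsMonicCubic (F.map ι)) (hm : IsLocalRing.maximalIdeal O = Ideal.span {2})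
    (U : (integersA O (F.map ι))ˣ) {g : integersA O (F.map ι)}
    (hU : (U : integersA O (F.map ι)) = 1 + 4 * g) (hn : U ∈ squareNormUnits O (F.map ι)) :
    inclusionA O _ (sqClass U) ∈ kummerImage hf := by
  obtain ⟨i, k, hi, hη⟩ := exists_eq_sq_mul hm h.hη
  rcases two_dvd_or_isUnit hm k with ⟨k, rfl⟩ | hk
  · exact h.sqClass_mem_of_even hf hm hi hη U hU hn
  · exact h.sqClass_mem_of_odd hf hm hi hk hη U hU hn

end Eisenstein

section Reduction

variable {O K : Type*} [CommRing O] [IsDomain O] [IsDiscreteValuationRing O] [Field K] [CharZero K]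
  [Algebra O K] [IsFractionRing O K] [Algebra ℤ_[2] O] [Module.Finite ℤ_[2] O]
  [Module.Free ℤ_[2] O]

local notation "ι" => algebraMap O K

theorem exists_ordinary_coeff (h2 : (2 : O) ≠ 0) (W : WeierstrassCurve O) (hΔ : IsUnit W.Δ)
    (ha : IsUnit W.a₁) :
    ∃ τ b η : O, IsUnit τ ∧ IsUnit η ∧ W.b₂ = 8 * b - τ ∧
      W.b₄ = 2 * (b ^ 2 - 4 * η) - b * τ ∧ W.b₆ = -τ * (b ^ 2 - 4 * η) := by
  have h4 : (4 : O) ≠ 0 := by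
    rw [show (4 : O) = 2 * 2 by norm_num]
    exact mul_ne_zero h2 h2
  obtain ⟨a', ha'⟩ := ha.exists_right_inv
  have hb2 : IsUnit W.b₂ := by
    have := (ha.pow 2).mul (isUnit_one_add_two_mul (2 * W.a₂ * a' ^ 2))
    convert this using 1
    rw [WeierstrassCurve.b₂]
    linear_combination -4 * W.a₂ * (W.a₁ * a' + 1) * ha'
  obtain ⟨v, hv⟩ := (hb2.pow 2).exists_right_inv
  have h8 := W.b_relation
  obtain ⟨Y, hY⟩ := exists_fixed_point (v * (W.b₄ * W.b₂ - 2 * W.b₆))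
    (C v * (C (8 * W.b₂) * X ^ 2 - C 32 * X ^ 3 - C (4 * W.b₄) * X))
  simp only [eval_mul, eval_sub, eval_pow, eval_X, eval_C] at hY
  have hτ : IsUnit (8 * Y - W.b₂) := by
    have := (hb2.mul (isUnit_one_add_two_mul (-4 * Y * W.b₂ * v))).neg
    convert this using 1
    linear_combination -8 * Y * hv
  obtain ⟨w, hw⟩ := hτ.exists_right_inv
  set P := W.b₄ * W.b₂ - 2 * W.b₆ with hP
  set Q := 2 * W.b₂ * Y ^ 2 - 8 * Y ^ 3 - W.b₄ * Y with hQ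
  have hY' : W.b₂ ^ 2 * Y = P + 8 * Q := by
    linear_combination W.b₂ ^ 2 * hY + (P + 8 * Q) * hv
  set Z := v ^ 2 * (2 * Y * (P + 8 * Q) ^ 2 - 4 * W.b₂ * P * Q - 16 * W.b₂ * Q ^ 2 +
    W.b₂ ^ 3 * W.b₈ + W.b₄ * W.b₂ ^ 2 * W.b₆ - W.b₂ * W.b₆ ^ 2) with hZ
  have hZ' : 4 * Z = (8 * Y - W.b₂) * Y ^ 2 + W.b₆ := by
    have e : W.b₂ ^ 4 * ((8 * Y - W.b₂) * Y ^ 2 + W.b₆) =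
        4 * (2 * Y * (P + 8 * Q) ^ 2 - 4 * W.b₂ * P * Q - 16 * W.b₂ * Q ^ 2 +
          W.b₂ ^ 3 * W.b₈ + W.b₄ * W.b₂ ^ 2 * W.b₆ - W.b₂ * W.b₆ ^ 2) := by
      linear_combination (8 * Y - W.b₂) * (W.b₂ ^ 2 * Y + P + 8 * Q) * hY' - W.b₂ ^ 3 * h8
    linear_combination -v ^ 2 * e + ((8 * Y - W.b₂) * Y ^ 2 + W.b₆) * (W.b₂ ^ 2 * v + 1) * hv
  clear_value Z
  have e6 : W.b₆ = -(8 * Y - W.b₂) * (Y ^ 2 - 4 * (w * Z)) := by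
    linear_combination -hZ' - 4 * Z * hw
  have e4 : W.b₄ = 2 * (Y ^ 2 - 4 * (w * Z)) - Y * (8 * Y - W.b₂) := by
    refine hτ.mul_left_cancel ?_
    linear_combination -2 * e6 + hY'
  refine ⟨8 * Y - W.b₂, Y, w * Z, hτ, ?_, by ring, e4, e6⟩
  have hD : W.Δ = w * Z * ((8 * Y - W.b₂) ^ 2 + 8 * Y * (8 * Y - W.b₂) +
      16 * (Y ^ 2 - 4 * (w * Z))) ^ 2 := by
    refine mul_left_cancel₀ h4 ?_
    clear_value P Q
    rw [WeierstrassCurve.Δ]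
    obtain ⟨t, ht⟩ : ∃ t, t = 8 * Y - W.b₂ := ⟨_, rfl⟩
    obtain ⟨e, he⟩ : ∃ e, e = w * Z := ⟨_, rfl⟩
    have e2 : W.b₂ = 8 * Y - t := by rw [ht]; ring
    rw [← ht, ← he] at e4 e6 ⊢
    rw [e2, e4, e6] at h8
    rw [e2, e4, e6]
    linear_combination -(8 * Y - t) ^ 2 * h8
  exact isUnit_of_mul_isUnit_left (hD ▸ hΔ)

theorem eval_ne_zero_of_supersingular (hm : IsLocalRing.maximalIdeal O = Ideal.span {2})
    (W : WeierstrassCurve O) (hΔ : IsUnit W.Δ) (ha : 2 ∣ W.a₁) (x : K) :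
    4 * x ^ 3 + ι W.b₂ * x ^ 2 + 2 * ι W.b₄ * x + ι W.b₆ ≠ 0 := by
  intro hx
  have h2 : (2 : O) ≠ 0 := two_ne_zero_of_isFractionRing O K
  have htwo := two_mem_maximalIdeal O
  obtain ⟨a, ha⟩ := ha
  have e2 : W.b₂ = 4 * (a ^ 2 + W.a₂) := by rw [WeierstrassCurve.b₂, ha]; ring
  have e4 : W.b₄ = 2 * (W.a₄ + a * W.a₃) := by rw [WeierstrassCurve.b₄, ha]; ring
  have h6 : IsUnit W.b₆ := (two_dvd_or_isUnit hm _).resolve_left fun ⟨j, hj⟩ =>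
    htwo (isUnit_of_dvd_unit ⟨-8 * (a ^ 2 + W.a₂) ^ 2 * W.b₈ - 4 * W.b₄ ^ 3 - 27 * W.b₆ * j +
      9 * W.b₂ * W.b₄ * j, by
        rw [WeierstrassCurve.Δ]
        linear_combination -(W.b₂ + 4 * (a ^ 2 + W.a₂)) * W.b₈ * e2 +
          (-27 * W.b₆ + 9 * W.b₂ * W.b₄) * hj⟩ hΔ)
  have e2' := congrArg ι e2
  have e4' := congrArg ι e4
  simp only [map_add, map_mul, map_pow, map_ofNat] at e2' e4'
  rcases integral_or_not_integral (O := O) x with ⟨x, rfl⟩ | ⟨t, ht, htu⟩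
  · refine htwo (isUnit_of_dvd_unit ⟨-2 * (x ^ 3 + (a ^ 2 + W.a₂) * x ^ 2 +
      (W.a₄ + a * W.a₃) * x), ?_⟩ h6)
    refine IsFractionRing.injective O K ?_
    simp only [map_add, map_mul, map_pow, map_ofNat, map_neg]
    linear_combination hx - ι x ^ 2 * e2' - 2 * ι x * e4'
  · have hu := isUnit_one_add_of_not (s := (a ^ 2 + W.a₂) + (W.a₄ + a * W.a₃) * t) htu
    obtain ⟨t, rfl⟩ := (two_dvd_or_isUnit hm t).resolve_right htu
    refine htwo (isUnit_of_dvd_unit ⟨-W.b₆ * t ^ 3, ?_⟩ hu)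
    refine mul_left_cancel₀ (mul_ne_zero h2 h2) (IsFractionRing.injective O K ?_)
    simp only [map_add, map_mul, map_pow, map_ofNat, map_neg, map_one] at ht ⊢
    linear_combination (2 * ι t) ^ 3 * hx - (2 * ι t) ^ 3 * x ^ 2 * e2' -
      2 * (2 * ι t) ^ 3 * x * e4' - 4 * ((x * (2 * ι t)) ^ 2 + x * (2 * ι t) + 1 +
      (ι a ^ 2 + ι W.a₂) * (2 * ι t) * (x * (2 * ι t) + 1) +
      (ι W.a₄ + ι a * ι W.a₃) * (2 * ι t) ^ 2) * ht

variable {F : O[X]}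

theorem isField_or_ordinary (hf : IsMonicCubic (F.map ι))
    (hm : IsLocalRing.maximalIdeal O = Ideal.span {2}) (c : WeierstrassCurve.VariableChange K)
    (hc : (c • cubicCurve (F.map ι)).HasGoodReduction O) :
    IsField (AdjoinRoot (F.map ι)) ∨ ∃ (u r : K) (α a τ b η : O),
      Ordinary (F.map ι) u r α a τ b η := by
  set W₀ := c • cubicCurve (F.map ι) with hW₀
  set W := W₀.integralModel O with hW
  have hΔ : IsUnit W.Δ := by
    have := (WeierstrassCurve.hasGoodReduction_iff_isElliptic_reduction O).1 hc
    have h1 := (W₀.reduction O).isUnit_Δ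
    rw [WeierstrassCurve.reduction, WeierstrassCurve.map_Δ] at h1
    exact isUnit_of_map_unit _ _ h1
  have hcu : (c.u : K) ≠ 0 := c.u.ne_zero
  have h2 := WeierstrassCurve.variableChange_b₂ (cubicCurve (F.map ι)) c
  have h4 := WeierstrassCurve.variableChange_b₄ (cubicCurve (F.map ι)) c
  have h6 := WeierstrassCurve.variableChange_b₆ (cubicCurve (F.map ι)) c
  rw [← hW₀, ← WeierstrassCurve.integralModel_b₂_eq O, ← hW] at h2
  rw [← hW₀, ← WeierstrassCurve.integralModel_b₄_eq O, ← hW] at h4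
  rw [← hW₀, ← WeierstrassCurve.integralModel_b₆_eq O, ← hW] at h6
  have c2 : (cubicCurve (F.map ι)).b₂ = 4 * (F.map ι).coeff 2 := by
    simp [WeierstrassCurve.b₂, cubicCurve]
  have c4 : (cubicCurve (F.map ι)).b₄ = 2 * (F.map ι).coeff 1 := by
    simp [WeierstrassCurve.b₄, cubicCurve]
  have c6 : (cubicCurve (F.map ι)).b₆ = 4 * (F.map ι).coeff 0 := by
    simp [WeierstrassCurve.b₆, cubicCurve]
  rw [c2, Units.val_inv_eq_inv_val] at h2
  rw [c2, c4, Units.val_inv_eq_inv_val] at h4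
  rw [c2, c4, c6, Units.val_inv_eq_inv_val] at h6
  have key : ∀ x, 4 * (F.map ι).eval (c.u ^ 2 * x + c.r) =
      (c.u : K) ^ 6 * (4 * x ^ 3 + ι W.b₂ * x ^ 2 + 2 * ι W.b₄ * x + ι W.b₆) := fun x => by
    rw [hf.eval_eq, h2, h4, h6]
    field_simp
    ring
  by_cases ha : IsUnit W.a₁
  · obtain ⟨τ, b, η, hτ, hη, e2, e4, e6⟩ := 
      exists_ordinary_coeff (two_ne_zero_of_isFractionRing O K) W hΔ ha
    refine Or.inr ⟨c.u, c.r, W.a₁, W.a₂, τ, b, η, hcu, ha, hτ, hη, ?_, ?_, ?_, ?_⟩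
    · rw [← e2, WeierstrassCurve.b₂]
    · rw [← e2, h2]
      field_simp
    · rw [← e4, h4]
      field_simp
    · rw [neg_mul, ← mul_neg, ← map_neg, ← neg_mul, ← e6, h6]
      field_simp
      ring
  · refine Or.inl ?_
    have hirr : Irreducible (F.map ι) := by
      rw [hf.monic.irreducible_iff_roots_eq_zero_of_degree_le_three
        (by rw [hf.natDegree_eq]; norm_num) hf.natDegree_eq.le]
      refine Multiset.eq_zero_of_forall_notMem fun x hx => ?_
      have hx0 : (F.map ι).eval x = 0 := isRoot_of_mem_roots hx
      have := key ((x - c.r) / (c.u : K) ^ 2)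
      rw [show (c.u : K) ^ 2 * ((x - c.r) / (c.u : K) ^ 2) + c.r = x by field_simp; ring, hx0,
        mul_zero] at this
      exact mul_ne_zero (pow_ne_zero 6 hcu) (eval_ne_zero_of_supersingular hm W hΔ
        ((two_dvd_or_isUnit hm _).resolve_right ha) _) this.symm
    have : Fact (Irreducible (F.map ι)) := ⟨hirr⟩
    exact Field.toIsField (AdjoinRoot (F.map ι))

end Reduction

section Main

variable {O K : Type*} [CommRing O] [IsDomain O] [IsDiscreteValuationRing O] [Field K] [CharZero K]
  [Algebra O K] [IsFractionRing O K] [Algebra ℤ_[2] O] [Module.Finite ℤ_[2] O]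
  [Module.Free ℤ_[2] O] [Algebra ℤ_[2] K] [IsScalarTower ℤ_[2] O K] [Algebra ℚ_[2] K]
  [FiniteDimensional ℚ_[2] K] [IsScalarTower ℤ_[2] ℚ_[2] K]

local notation "ι" => algebraMap O K

variable {F : O[X]}

variable (O) in
theorem maximalIdeal_eq_span_two (h : Algebra.Unramified ℤ_[2] O) :
    IsLocalRing.maximalIdeal O = Ideal.span {2} := by
  have := h.formallyUnramified
  rw [← Algebra.FormallyUnramified.map_maximalIdeal (R := ℤ_[2]) (S := O),
    PadicInt.maximalIdeal_eq_span_p, Ideal.map_span, Set.image_singleton]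
  congr 2
  exact map_ofNat (algebraMap ℤ_[2] O) 2

theorem Dagger.cases (h : Dagger O 2 K F) :
    IsField (AdjoinRoot (F.map ι)) ∨
    Algebra.adjoin O {AdjoinRoot.root (F.map ι)} = integersA O (F.map ι) ∨
    (IsLocalRing.maximalIdeal O = Ideal.span {2} ∧ ∃ (u r : K) (α a τ b η : O),
      Ordinary (F.map ι) u r α a τ b η) := by
  rcases h.cond with hA | hA | ⟨h2, -⟩ | ⟨-, hu, c, hc⟩
  · exact Or.inl hA
  · exact Or.inr (Or.inl hA)
  · have := charP_residueField O
    have := ringChar.eq (IsLocalRing.ResidueField O) 2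
    omega
  · have hm := maximalIdeal_eq_span_two O hu
    exact (isField_or_ordinary h.isMonicCubic hm c hc).imp_right fun H => Or.inr ⟨hm, H⟩

theorem Dagger.kummerImage_le (h : Dagger O 2 K F) :
    kummerImage h.isMonicCubic ≤ unitClasses O (F.map ι) := by
  rcases h.cases with hA | hA | ⟨-, u, r, α, a, τ, b, η, H⟩
  · intro c hc
    obtain ⟨P, rfl⟩ := mem_kummerImage.1 hc
    exact kummerMap_mem_of_forall _ (fun x y hxy hy => kummerMap_mem_of_eq _ hy
      (exists_isIntUnit_of_isField h.isMonicCubic hA hxy hy)) P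
  · intro c hc
    obtain ⟨P, rfl⟩ := mem_kummerImage.1 hc
    exact kummerMap_mem_of_forall _ (fun x y hxy hy => kummerMap_mem_of_eq _ hy
      (exists_isIntUnit_of_adjoin h.isMonicCubic hA hxy hy)) P
  · exact kummerImage_le_unitClasses H h.isMonicCubic

theorem Dagger.mem_kummerImage (h : Dagger O 2 K F) {u : (integersA O (F.map ι))ˣ}
    (hu : u ∈ unitsFour O (F.map ι)) :
    inclusionA O _ (sqClass u) ∈ kummerImage h.isMonicCubic := by
  refine sqClass_mem_of_unitsFour h.isMonicCubic (fun U g hU hn => ?_) hu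
  rcases h.cases with hA | hA | ⟨hm, u, r, α, a, τ, b, η, H⟩
  · exact sqClass_mem_of_isField _ hA U hU hn
  · exact sqClass_mem_of_adjoin _ hA U hU hn
  · exact H.sqClass_mem _ hm U hU hn

end Main

end KummerTwo

end

theorem mainTheorem6 (K : Type*) [Field K] [Algebra ℚ_[2] K] [FiniteDimensional ℚ_[2] K]
    [Algebra ℤ_[2] K] [IsScalarTower ℤ_[2] ℚ_[2] K]
    (F : (integralClosure ℤ_[2] K)[X])
    (hE : KummerTwo.Dagger (integralClosure ℤ_[2] K) 2 K F) :
    ∃ D : Subgroup (KummerTwo.UnitsModSquares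
        (AdjoinRoot (F.map (algebraMap (integralClosure ℤ_[2] K) K)))),
      (D : Set _) = Set.range (KummerTwo.kummerMap hE.isMonicCubic) ∧
      D ≤ (KummerTwo.squareNormClasses (integralClosure ℤ_[2] K)
        (F.map (algebraMap (integralClosure ℤ_[2] K) K))).map
          (KummerTwo.inclusionA (integralClosure ℤ_[2] K) _) ∧
      D.relIndex ((KummerTwo.squareNormClasses (integralClosure ℤ_[2] K)
        (F.map (algebraMap (integralClosure ℤ_[2] K) K))).map
          (KummerTwo.inclusionA (integralClosure ℤ_[2] K) _)) = 2 ^ Module.finrank ℚ_[2] K ∧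
      ∀ u ∈ KummerTwo.unitsFour (integralClosure ℤ_[2] K)
          (F.map (algebraMap (integralClosure ℤ_[2] K) K)),
        KummerTwo.inclusionA (integralClosure ℤ_[2] K) _ (KummerTwo.sqClass u) ∈ D := by
  have : CharZero K := charZero_of_injective_algebraMap (algebraMap ℚ_[2] K).injective
  have : FaithfulSMul ℤ_[2] K := (faithfulSMul_iff_algebraMap_injective _ _).2 <| by
    rw [IsScalarTower.algebraMap_eq ℤ_[2] ℚ_[2] K]
    exact (algebraMap ℚ_[2] K).injective.comp (IsFractionRing.injective ℤ_[2] ℚ_[2])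
  have : Module.Finite ℤ_[2] (integralClosure ℤ_[2] K) :=
    IsIntegralClosure.finite ℤ_[2] ℚ_[2] K _
  have : Module.Free ℤ_[2] (integralClosure ℤ_[2] K) :=
    IsIntegralClosure.module_free ℤ_[2] ℚ_[2] K _
  refine ⟨KummerTwo.kummerImage hE.isMonicCubic, KummerTwo.coe_kummerImage _, hE.kummerImage_le,
    ?_, fun u hu => hE.mem_kummerImage hu⟩
  rw [← IsIntegralClosure.rank ℤ_[2] ℚ_[2] K (integralClosure ℤ_[2] K)]
  exact KummerTwo.relIndex_kummerImage _ hE.kummerImage_le
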